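/- Let $k$ be an algebraically closed field, let $f_1,\dots,f_r\in S=k[x_0,\dots,x_n]$ be homogeneous, let $I=(f_1,\dots,f_r)$, and let $X=\operatorname{Proj}(S/I)\subset\mathbb P^n$ be the projective scheme that they define. Fix an integer $d\ge 1$ with $d\ge\deg f_j$ for all $j$. Let $Q$ be the enlarged Beilinson quiver: it has vertices $0,1,\dots,d$ and $n+1$ arrows $x_0^a,\dots,x_n^a$ from $a$ to $a+1$ for each $0\le a<d$. For each $j$ choose a set $T_j$ of starting vertices containing at least one vertex $a$ with $a+\deg f_j\le d$. Let $J$ be the two-sided ideal of the path algebra $kQ$ generated by the commutativity relations $x_j^{a+1}x_i^a-x_i^{a+1}x_j^a$ and by the linear combinations of paths of length $\deg f_j$ starting at $a$ that represent $f_j$, for all $j$ and all $a\in T_j$ with $a+\deg f_j\le d$. Let $M$ be the $kQ$-module with $M_m=\operatorname{Hom}_k(S_{d-m}/I_{d-m},k)$ for $0\le m\le d$, on which $x_i^m:M_m\to M_{m+1}$ acts as the transpose of multiplication by $x_i$. Then: (1) The $k$-scheme $X$ is the fine moduli space of indecomposable $kQ/J$-modules of dimension vector $(1,\dots,1)$: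 it represents the functor sending a commutative $k$-algebra $R$ to the set of families over $R$ of $kQ/J$-modules, locally free of dimension vector $(1,\dots,1)$ and with indecomposable geometric fibres, up to isomorphism and twist by a line bundle on $\operatorname{Spec}R$. Moreover there is a weight $\theta\in\mathbb Z^{\{0,\dots,d\}}$ such that a $kQ/J$-module of dimension vector $(1,\dots,1)$ is indecomposable if and only if it is $\theta$-semistable, and if and only if it is $\theta$-stable, in the sense of King. (2) The $k$-scheme $X$ is the quiver grassmannian of submodules of $M$ of dimension vector $(1,\dots,1)$: it represents the functor sending $R$ to the set of $kQ$-stable $R$-submodules $N$ of $R\otimes_k M$ with locally free quotient such that $N_m$ has rank $1$ for every vertex $m$. (3) If every $T_j$ consists of all vertices, then $M$ is annihilated by $J$, it is injective as a $kQ/J$-module, and it is an injective hull of every indecomposable $kQ/J$-module of dimension vector $(1,\dots,1)$. -/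

import Mathlib

open scoped TensorProduct DirectSum
open CategoryTheory AlgebraicGeometry

universe u

/-! ### Path algebras -/

/-- Generators of the path algebra of a quiver: the trivial paths and the arrows. -/
inductive PathAlgebra.Gen (V : Type) [Quiver.{0} V] : Type
  | vertex (v : V) : PathAlgebra.Gen V
  | arrow {a b : V} (h : a ⟶ b) : PathAlgebra.Gen V

/-- The relations in the standard presentation of the path algebra of a finite quiver: the trivial
paths are orthogonal idempotents with sum `1`, and an arrow `h : a ⟶ b` satisfies
`h = e_b * h = h * e_a`.  So paths are composed from right to left, a product of non-composable
arrows is zero, and left modules are covariant representations of the quiver. -/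
inductive PathAlgebra.Rel (k : Type u) [Field k] (V : Type) [Quiver.{0} V] [Fintype V] :
    FreeAlgebra k (PathAlgebra.Gen V) → FreeAlgebra k (PathAlgebra.Gen V) → Prop
  | idem (v : V) : PathAlgebra.Rel k V
      (FreeAlgebra.ι k (.vertex v) * FreeAlgebra.ι k (.vertex v)) (FreeAlgebra.ι k (.vertex v))
  | orth (v w : V) (h : v ≠ w) : PathAlgebra.Rel k V
      (FreeAlgebra.ι k (.vertex v) * FreeAlgebra.ι k (.vertex w)) 0
  | one : PathAlgebra.Rel k V (∑ v : V, FreeAlgebra.ι k (.vertex v)) 1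
  | target {a b : V} (h : a ⟶ b) : PathAlgebra.Rel k V
      (FreeAlgebra.ι k (.vertex b) * FreeAlgebra.ι k (.arrow h)) (FreeAlgebra.ι k (.arrow h))
  | source {a b : V} (h : a ⟶ b) : PathAlgebra.Rel k V
      (FreeAlgebra.ι k (.arrow h) * FreeAlgebra.ι k (.vertex a)) (FreeAlgebra.ι k (.arrow h))

/-- The path algebra `kQ` of a finite quiver `Q` with vertex set `V`. -/
abbrev PathAlgebra (k : Type u) [Field k] (V : Type) [Quiver.{0} V] [Fintype V] : Type u :=
  RingQuot (PathAlgebra.Rel k V)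

namespace PathAlgebra

variable (k : Type u) [Field k] {V : Type} [Quiver.{0} V] [Fintype V]

/-- The trivial path at `v`. -/
noncomputable def e (v : V) : PathAlgebra k V :=
  RingQuot.mkAlgHom k (Rel k V) (FreeAlgebra.ι k (.vertex v))

/-- An arrow, as an element of the path algebra. -/
noncomputable def arrow {a b : V} (h : a ⟶ b) : PathAlgebra k V :=
  RingQuot.mkAlgHom k (Rel k V) (FreeAlgebra.ι k (.arrow h))

end PathAlgebra

/-! ### Families of modules over an algebra -/

/-- A family of (left) `A`-modules over `Spec R`, for a `k`-algebra `A` and a commutative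
`k`-algebra `R`: an `R`-module with an action of `A` by `R`-linear maps, compatible with `k`; in
other words a module over `R ⊗[k] A`.  For `R = k` this is an `A`-module. -/
structure ModuleFamily (k : Type u) [Field k] (A : Type u) [Ring A] [Algebra k A]
    (R : Type u) [CommRing R] [Algebra k R] where
  carrier : Type u
  [addCommGroup : AddCommGroup carrier]
  [module : Module R carrier]
  act : A →+* Module.End R carrier
  act_algebraMap : ∀ c : k, act (algebraMap k A c) =
    algebraMap R (Module.End R carrier) (algebraMap k R c)

attribute [instance] ModuleFamily.addCommGroup ModuleFamily.module

namespace ModuleFamily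

variable {k : Type u} [Field k] {A : Type u} [Ring A] [Algebra k A]

section

variable {R : Type u} [CommRing R] [Algebra k R]

/-- The base change of a family along a homomorphism `R → R'` of `k`-algebras. -/
noncomputable def baseChange (F : ModuleFamily k A R) (R' : Type u) [CommRing R'] [Algebra k R']
    [Algebra R R'] [IsScalarTower k R R'] : ModuleFamily k A R' where
  carrier := R' ⊗[R] F.carrier
  act :=
    { toFun := fun a => (F.act a).baseChange R'
      map_one' := by
        rw [map_one]; exact LinearMap.baseChange_id
      map_mul' := fun a b => by
        rw [map_mul]; exact LinearMap.baseChange_comp _ _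
      map_zero' := by rw [map_zero]; exact LinearMap.baseChange_zero
      map_add' := fun a b => by rw [map_add]; exact LinearMap.baseChange_add _ _ }
  act_algebraMap := fun c => by
    refine TensorProduct.AlgebraTensorModule.ext fun x y => ?_
    simp only [RingHom.coe_mk, MonoidHom.coe_mk, OneHom.coe_mk, LinearMap.baseChange_tmul,
      F.act_algebraMap, Module.algebraMap_end_apply]
    rw [TensorProduct.tmul_smul, IsScalarTower.algebraMap_apply k R R', algebraMap_smul R']

/-- The property of an `R`-submodule of a family to be stable under the action of `A`. -/
def IsStable (F : ModuleFamily k A R) (P : Submodule R F.carrier) : Prop :=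
  ∀ a : A, ∀ x ∈ P, F.act a x ∈ P

/-- Nonzero, and not the direct sum of two nonzero submodules. -/
def IsIndecomposable (F : ModuleFamily k A R) : Prop :=
  Nontrivial F.carrier ∧ ∀ P Q : Submodule R F.carrier, F.IsStable P → F.IsStable Q →
    IsCompl P Q → P = ⊥ ∨ Q = ⊥

/-- The family is locally free of dimension vector `α`, where `e v : A` are the idempotents that
belong to the vertices `v`: `F` is finitely generated projective over `R`, and the direct summand
`e v · F` has rank `α v` at every point of `Spec R`. -/
def HasDimVector {V : Type} (e : V → A) (α : V → ℕ) (F : ModuleFamily k A R) : Prop :=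
  Module.Finite R F.carrier ∧ Module.Projective R F.carrier ∧
    ∀ (v : V) (p : PrimeSpectrum R),
      Module.rankAtStalk (R := R) (LinearMap.range (F.act (e v))) p = α v

/-- The families that the moduli functor classifies: locally free of dimension vector `α`, with
indecomposable geometric fibres. -/
def IsIndecomposableFamily {V : Type} (e : V → A) (α : V → ℕ) (F : ModuleFamily k A R) : Prop :=
  F.HasDimVector e α ∧
    ∀ (K : Type u) [Field K] [IsAlgClosed K] [Algebra k K] [Algebra R K] [IsScalarTower k R K],
      (F.baseChange K).IsIndecomposable

/-- Equivalence of families: isomorphism up to a twist with a line bundle on the base. -/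
def IsEquivalent (F F' : ModuleFamily k A R) : Prop :=
  ∃ (L : Type u) (_ : AddCommGroup L) (_ : Module R L) (_ : Module.Invertible R L)
    (φ : (L ⊗[R] F.carrier) ≃ₗ[R] F'.carrier),
    ∀ (a : A) (x : L ⊗[R] F.carrier), φ ((F.act a).lTensor L x) = F'.act a (φ x)

end

/-! #### Modules over the ground field -/

/-- `A`-linear maps. -/
def IsHom (M N : ModuleFamily k A k) (g : M.carrier →ₗ[k] N.carrier) : Prop :=
  ∀ (a : A) (x : M.carrier), g (M.act a x) = N.act a (g x)

/-- `M` is an injective `A`-module. -/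
def IsInjective (M : ModuleFamily k A k) : Prop :=
  ∀ (N N' : ModuleFamily k A k) (i : N.carrier →ₗ[k] N'.carrier) (g : N.carrier →ₗ[k] M.carrier),
    IsHom N N' i → Function.Injective i → IsHom N M g →
      ∃ h : N'.carrier →ₗ[k] M.carrier, IsHom N' M h ∧ h ∘ₗ i = g

/-- `M` is an injective hull of the `A`-module `N`: it is injective, and contains `N` as an
essential submodule. -/
def IsInjectiveHull (N M : ModuleFamily k A k) : Prop :=
  M.IsInjective ∧ ∃ i : N.carrier →ₗ[k] M.carrier, IsHom N M i ∧ Function.Injective i ∧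
    ∀ P : Submodule k M.carrier, M.IsStable P → P ⊓ LinearMap.range i = ⊥ → P = ⊥

/-- The value of the weight `θ` on the dimension vector of a submodule `P` of `M`. -/
noncomputable def weight {V : Type} [Fintype V] (e : V → A) (θ : V → ℤ)
    (M : ModuleFamily k A k) (P : Submodule k M.carrier) : ℤ :=
  ∑ v : V, θ v * (Module.finrank k (P.map (M.act (e v))) : ℤ)

/-- King's `θ`-semistability. -/
def IsSemistable {V : Type} [Fintype V] (e : V → A) (θ : V → ℤ) (M : ModuleFamily k A k) : Prop :=
  M.weight e θ ⊤ = 0 ∧ ∀ P : Submodule k M.carrier, M.IsStable P → 0 ≤ M.weight e θ P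

/-- King's `θ`-stability. -/
def IsThetaStable {V : Type} [Fintype V] (e : V → A) (θ : V → ℤ) (M : ModuleFamily k A k) : Prop :=
  Nontrivial M.carrier ∧ M.weight e θ ⊤ = 0 ∧
    ∀ P : Submodule k M.carrier, M.IsStable P → P ≠ ⊥ → P ≠ ⊤ → 0 < M.weight e θ P

/-- An `A`-module annihilated by an ideal `J`, regarded as an `A/J`-module. -/
noncomputable def descend (M : ModuleFamily k A k) (J : Ideal A) [J.IsTwoSided]
    (h : ∀ a ∈ J, M.act a = 0) : ModuleFamily k (A ⧸ J) k where
  carrier := M.carrier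
  act := Ideal.Quotient.lift J M.act h
  act_algebraMap := fun c => M.act_algebraMap c

end ModuleFamily

/-! ### Points of schemes, fine moduli spaces and quiver grassmannians -/

/-- The `R`-valued points of a `k`-scheme `s : X ⟶ Spec k`, for a `k`-algebra `R`. -/
def AlgPoint {k : Type u} [Field k] {X : Scheme.{u}} (s : X ⟶ Spec (.of k))
    (R : Type u) [CommRing R] [Algebra k R] : Type u :=
  {g : Spec (.of R) ⟶ X // g ≫ s = Spec.map (CommRingCat.ofHom (algebraMap k R))}

/-- The image of an `R`-valued point under a homomorphism `R → R'` of `k`-algebras. -/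
noncomputable def AlgPoint.baseChange {k : Type u} [Field k] {X : Scheme.{u}}
    {s : X ⟶ Spec (.of k)} {R : Type u} [CommRing R] [Algebra k R] (g : AlgPoint s R)
    (R' : Type u) [CommRing R'] [Algebra k R'] [Algebra R R'] [IsScalarTower k R R'] :
    AlgPoint s R' :=
  ⟨Spec.map (CommRingCat.ofHom (algebraMap R R')) ≫ g.1, by
    rw [Category.assoc, g.2, ← Spec.map_comp, ← CommRingCat.ofHom_comp,
      ← IsScalarTower.algebraMap_eq k R R']⟩

/-- The `k`-scheme `s : X ⟶ Spec k` is the (fine) moduli space of indecomposable `A`-modules of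
dimension vector `α`: it represents the functor that sends a commutative `k`-algebra `R` to the set
of equivalence classes of families over `R` of indecomposable `A`-modules of dimension vector
`α`.  Here `Φ R` is the classifying map; it induces a bijection from equivalence classes of
families to `R`-valued points of `X`, and is natural in `R`. -/
def IsModuliOfIndecomposables {k : Type u} [Field k] (A : Type u) [Ring A] [Algebra k A] {V : Type}
    (e : V → A) (α : V → ℕ) {X : Scheme.{u}} (s : X ⟶ Spec (.of k)) : Prop :=
  ∃ Φ : ∀ (R : Type u) [CommRing R] [Algebra k R] (F : ModuleFamily k A R),
      F.IsIndecomposableFamily e α → AlgPoint s R,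
    (∀ (R : Type u) [CommRing R] [Algebra k R] (g : AlgPoint s R),
      ∃ (F : ModuleFamily k A R) (hF : F.IsIndecomposableFamily e α), Φ R F hF = g) ∧
    (∀ (R : Type u) [CommRing R] [Algebra k R] (F F' : ModuleFamily k A R)
      (hF : F.IsIndecomposableFamily e α) (hF' : F'.IsIndecomposableFamily e α),
      Φ R F hF = Φ R F' hF' ↔ F.IsEquivalent F') ∧
    (∀ (R R' : Type u) [CommRing R] [Algebra k R] [CommRing R'] [Algebra k R'] [Algebra R R']
      [IsScalarTower k R R'] (F : ModuleFamily k A R) (hF : F.IsIndecomposableFamily e α),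
      ∃ hF' : (F.baseChange R').IsIndecomposableFamily e α,
        Φ R' (F.baseChange R') hF' = (Φ R F hF).baseChange R')

/-- The `R`-valued points of the grassmannian of submodules of dimension vector `α` of the
`A`-module `M`: the `A`-stable `R`-submodules `N` of `R ⊗[k] M` with locally free quotient, such
that `e v · N` has rank `α v` for every vertex `v`. -/
structure SubmoduleGrassmannian {k : Type u} [Field k] {A : Type u} [Ring A] [Algebra k A]
    {V : Type} (e : V → A) (α : V → ℕ) (M : ModuleFamily k A k)
    (R : Type u) [CommRing R] [Algebra k R] where
  toSubmodule : Submodule R (R ⊗[k] M.carrier)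
  stable : (M.baseChange R).IsStable toSubmodule
  finite : Module.Finite R ((R ⊗[k] M.carrier) ⧸ toSubmodule)
  projective : Module.Projective R ((R ⊗[k] M.carrier) ⧸ toSubmodule)
  rank_eq : ∀ (v : V) (p : PrimeSpectrum R),
    Module.rankAtStalk (R := R) (toSubmodule.map ((M.act (e v)).baseChange R)) p = α v

/-- The `k`-scheme `s : X ⟶ Spec k` is the quiver grassmannian of submodules of `M` of dimension
vector `α`: it represents the functor `SubmoduleGrassmannian`.  A homomorphism `R → R'` sends a
submodule `N` of `R ⊗[k] M` to the `R'`-submodule of `R' ⊗[k] M` generated by its image. -/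
def IsQuiverGrassmannian {k : Type u} [Field k] {A : Type u} [Ring A] [Algebra k A] {V : Type}
    (e : V → A) (α : V → ℕ) (M : ModuleFamily k A k) {X : Scheme.{u}}
    (s : X ⟶ Spec (.of k)) : Prop :=
  ∃ Φ : ∀ (R : Type u) [CommRing R] [Algebra k R],
      SubmoduleGrassmannian e α M R ≃ AlgPoint s R,
    ∀ (R R' : Type u) [CommRing R] [Algebra k R] [CommRing R'] [Algebra k R'] [Algebra R R']
      [IsScalarTower k R R'] (N : SubmoduleGrassmannian e α M R),
      ∃ N' : SubmoduleGrassmannian e α M R',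
        N'.toSubmodule = Submodule.span R' ((IsScalarTower.toAlgHom k R R').toLinearMap.rTensor
          M.carrier '' (N.toSubmodule : Set (R ⊗[k] M.carrier))) ∧
        Φ R' N' = (Φ R N).baseChange R'

/-! ### Representations of quivers as modules over the path algebra -/

/-- A representation of a quiver over `k`. -/
structure QuiverRep (k : Type u) [Field k] (V : Type) [Quiver.{0} V] where
  space : V → Type u
  [addCommGroup : ∀ v, AddCommGroup (space v)]
  [module : ∀ v, Module k (space v)]
  map : ∀ {a b : V}, (a ⟶ b) → (space a →ₗ[k] space b)

attribute [instance] QuiverRep.addCommGroup QuiverRep.module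

namespace QuiverRep

variable {k : Type u} [Field k] {V : Type} [Quiver.{0} V] [Fintype V] [DecidableEq V]

/-- The action of the generators of `kQ` on the direct sum of the spaces of a representation: the
trivial path at `v` is the projection to the component at `v`, and an arrow `h : a ⟶ b` is
the given map from the component at `a` to the one at `b`. -/
def genAct (W : QuiverRep k V) : PathAlgebra.Gen V → Module.End k (∀ v, W.space v)
  | .vertex v => LinearMap.single k W.space v ∘ₗ LinearMap.proj v
  | .arrow (a := a) (b := b) h => LinearMap.single k W.space b ∘ₗ W.map h ∘ₗ LinearMap.proj a

/-- The action of the path algebra on the direct sum of the spaces of a representation. -/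
noncomputable def algAct (W : QuiverRep k V) :
    PathAlgebra k V →ₐ[k] Module.End k (∀ v, W.space v) :=
  RingQuot.liftAlgHom k ⟨FreeAlgebra.lift k W.genAct, by
    intro x y h
    induction h with
    | idem v =>
      ext x w
      simp [genAct]
    | orth v w h =>
      rw [map_mul, FreeAlgebra.lift_ι_apply, FreeAlgebra.lift_ι_apply, map_zero]
      refine LinearMap.ext fun x => ?_
      simp [genAct, Pi.single_eq_of_ne h]
    | one =>
      rw [map_sum, map_one]
      refine LinearMap.ext fun x => ?_
      simp [genAct, Finset.univ_sum_single]
    | target h =>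
      rw [map_mul, FreeAlgebra.lift_ι_apply, FreeAlgebra.lift_ι_apply]
      refine LinearMap.ext fun x => ?_
      simp [genAct]
    | source h =>
      rw [map_mul, FreeAlgebra.lift_ι_apply, FreeAlgebra.lift_ι_apply]
      refine LinearMap.ext fun x => ?_
      simp [genAct]⟩

/-- The `kQ`-module that belongs to a representation of `Q`. -/
noncomputable def toModule (W : QuiverRep k V) : ModuleFamily k (PathAlgebra k V) k where
  carrier := ∀ v, W.space v
  act := W.algAct.toRingHom
  act_algebraMap := fun c => W.algAct.commutes c

end QuiverRep

/-! ### The projective scheme defined by homogeneous equations -/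

namespace ProjEquations

open MvPolynomial

variable {k : Type u} [Field k] {n r : ℕ} (f : Fin r → MvPolynomial (Fin (n + 1)) k)

/-- The ideal generated by the equations. -/
noncomputable def ideal : Ideal (MvPolynomial (Fin (n + 1)) k) := Ideal.span (Set.range f)

/-- The homogeneous coordinate ring. -/
abbrev CoordRing : Type u := MvPolynomial (Fin (n + 1)) k ⧸ ideal f

/-- The homogeneous component `S^m V / I_m` of the coordinate ring, as the image of `S^m V`. -/
noncomputable def piece (m : ℕ) : Submodule k (CoordRing f) :=
  (homogeneousSubmodule (Fin (n + 1)) k m).map (Ideal.Quotient.mkₐ k (ideal f)).toLinearMap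

theorem mk_mem_piece {m : ℕ} {p : MvPolynomial (Fin (n + 1)) k} (hp : p.IsHomogeneous m) :
    Ideal.Quotient.mkₐ k (ideal f) p ∈ piece f m :=
  Submodule.mem_map_of_mem ((mem_homogeneousSubmodule m p).2 hp)

instance gradedMonoid : SetLike.GradedMonoid (piece f) where
  one_mem := by
    have := mk_mem_piece f (isHomogeneous_one (Fin (n + 1)) k)
    rwa [map_one] at this
  mul_mem := by
    rintro a b _ _ ⟨x, hx, rfl⟩ ⟨y, hy, rfl⟩
    have := mk_mem_piece f (IsHomogeneous.mul ((mem_homogeneousSubmodule _ _).1 hx)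
      ((mem_homogeneousSubmodule _ _).1 hy))
    rwa [map_mul] at this

/-- The map from the polynomial ring to the external direct sum of the components. -/
noncomputable def toSum : MvPolynomial (Fin (n + 1)) k →ₐ[k] ⨁ m, piece f m :=
  aeval fun i => DirectSum.of (fun m => piece f m) 1
    ⟨Ideal.Quotient.mkₐ k (ideal f) (X i), mk_mem_piece f (isHomogeneous_X k i)⟩

theorem coe_toSum (p : MvPolynomial (Fin (n + 1)) k) :
    DirectSum.coeAlgHom (piece f) (toSum f p) = Ideal.Quotient.mkₐ k (ideal f) p := by
  have : (DirectSum.coeAlgHom (piece f)).comp (toSum f) = Ideal.Quotient.mkₐ k (ideal f) := by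
    ext i
    simp [toSum]
  exact DFunLike.congr_fun this p

theorem toSum_monomial_mem (s : Fin (n + 1) →₀ ℕ) (c : k) :
    ∃ y : piece f s.degree, toSum f (monomial s c) = DirectSum.of (fun m => piece f m) _ y := by
  induction s using Finsupp.induction_linear generalizing c with
  | zero =>
    refine ⟨⟨algebraMap k _ c, ?_⟩, ?_⟩
    · simpa using SetLike.algebraMap_mem_graded (piece f) c
    · have h : monomial (0 : Fin (n + 1) →₀ ℕ) c = algebraMap k _ c := rfl
      rw [h, AlgHom.commutes, DirectSum.algebraMap_apply]
      rfl
  | add s t hs ht =>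
    obtain ⟨y, hy⟩ := hs c
    obtain ⟨z, hz⟩ := ht 1
    have h : monomial (s + t) c = monomial s c * monomial t (1 : k) := by
      rw [monomial_mul, mul_one]
    rw [h, map_mul, hy, hz, DirectSum.of_mul_of, map_add]
    exact ⟨_, rfl⟩
  | single i m =>
    have h : monomial (Finsupp.single i m) c = algebraMap k _ c * X i ^ m := by
      rw [X_pow_eq_monomial, algebraMap_eq, C_mul_monomial, mul_one]
    rw [h, map_mul, map_pow, AlgHom.commutes, DirectSum.algebraMap_apply]
    have h1 : toSum f (X i) = DirectSum.of (fun m => piece f m) 1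
      ⟨Ideal.Quotient.mkₐ k (ideal f) (X i), mk_mem_piece f (isHomogeneous_X k i)⟩ := by
      simp [toSum]
    rw [h1, DirectSum.ofPow, DirectSum.of_mul_of]
    have h2 : 0 + m • 1 = (Finsupp.single i m).degree := by simp [Finsupp.degree_single]
    rw [← h2]
    exact ⟨_, rfl⟩

theorem toSum_homogeneous {m : ℕ} {p : MvPolynomial (Fin (n + 1)) k} (hp : p.IsHomogeneous m) :
    toSum f p = DirectSum.of (fun m => piece f m) m
      ⟨Ideal.Quotient.mkₐ k (ideal f) p, mk_mem_piece f hp⟩ := by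
  have key : ∃ y : piece f m, toSum f p = DirectSum.lof k ℕ (fun m => piece f m) m y := by
    have : toSum f p ∈ LinearMap.range (DirectSum.lof k ℕ (fun m => piece f m) m) := by
      rw [p.as_sum, map_sum]
      refine Submodule.sum_mem _ fun s hs => ?_
      obtain ⟨y, hy⟩ := toSum_monomial_mem f s (coeff s p)
      have hd : s.degree = m := by
        by_contra hne
        exact (mem_support_iff.1 hs) (hp.coeff_eq_zero hne)
      subst hd
      exact ⟨y, hy.symm⟩
    obtain ⟨y, hy⟩ := this
    exact ⟨y, hy.symm⟩
  obtain ⟨y, hy⟩ := key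
  have h := coe_toSum f p
  rw [hy, DirectSum.lof_eq_of, DirectSum.coeAlgHom_of] at h
  rw [hy, DirectSum.lof_eq_of]
  congr 1
  exact Subtype.ext h

/-- The grading of the homogeneous coordinate ring. -/
@[reducible] noncomputable def gradedAlgebra {deg : Fin r → ℕ}
    (hf : ∀ j, (f j).IsHomogeneous (deg j)) : GradedAlgebra (piece f) :=
  GradedAlgebra.ofAlgHom (piece f)
    (Ideal.Quotient.liftₐ (ideal f) (toSum f) (by
      intro p hp
      have hle : ideal f ≤ RingHom.ker (toSum f) := by
        refine Ideal.span_le.2 ?_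
        rintro _ ⟨j, rfl⟩
        rw [SetLike.mem_coe, RingHom.mem_ker, toSum_homogeneous f (hf j)]
        have h0 : Ideal.Quotient.mkₐ k (ideal f) (f j) = 0 :=
          Ideal.Quotient.eq_zero_iff_mem.2 (Ideal.subset_span ⟨j, rfl⟩)
        convert map_zero (DirectSum.of (fun m => piece f m) (deg j)) using 2
        exact Subtype.ext h0
      exact hle hp))
    (by
      refine AlgHom.ext fun x => ?_
      obtain ⟨p, rfl⟩ := Ideal.Quotient.mk_surjective x
      exact coe_toSum f p)
    (by
      rintro m ⟨_, p, hp, rfl⟩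
      exact toSum_homogeneous f ((mem_homogeneousSubmodule _ _).1 hp))

/-- The closed subscheme of `ℙ^n` defined by the equations: `Proj` of the homogeneous coordinate
ring. -/
noncomputable def scheme {deg : Fin r → ℕ} (hf : ∀ j, (f j).IsHomogeneous (deg j)) : Scheme.{u} :=
  letI := gradedAlgebra f hf
  Proj (piece f)

/-- Its structure morphism to `Spec k`. -/
noncomputable def structureMap {deg : Fin r → ℕ} (hf : ∀ j, (f j).IsHomogeneous (deg j)) :
    scheme f hf ⟶ Spec (.of k) :=
  letI := gradedAlgebra f hf
  Proj.toSpecZero (piece f) ≫ Spec.map (CommRingCat.ofHom (algebraMap k (piece f 0)))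

/-- Multiplication with the variable `x_i`, from degree `p` to degree `p + 1`. -/
noncomputable def mulX (i : Fin (n + 1)) {p q : ℕ} (h : q = p + 1) : piece f p →ₗ[k] piece f q :=
  LinearMap.restrict (LinearMap.mulLeft k (Ideal.Quotient.mkₐ k (ideal f) (X i))) (by
    intro x hx
    have := SetLike.mul_mem_graded (mk_mem_piece f (isHomogeneous_X k i)) hx
    have hq : 1 + p = q := by omega
    exact hq ▸ this)

end ProjEquations

/-! ### The enlarged Beilinson quiver -/

/-- The vertices `0, …, d` of the (enlarged) Beilinson quiver of `ℙ^n`. -/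
def BeilinsonQuiver (_n d : ℕ) : Type := Fin (d + 1)

namespace BeilinsonQuiver

variable {n d : ℕ}

instance : Fintype (BeilinsonQuiver n d) := inferInstanceAs (Fintype (Fin (d + 1)))

instance : DecidableEq (BeilinsonQuiver n d) := inferInstanceAs (DecidableEq (Fin (d + 1)))

/-- The number of a vertex. -/
def level (a : BeilinsonQuiver n d) : ℕ := Fin.val (n := d + 1) a

theorem level_le (a : BeilinsonQuiver n d) : a.level ≤ d := Nat.lt_succ_iff.1 (Fin.isLt (n := d + 1) a)

/-- The vertex with a given number. -/
def vertex (n : ℕ) {d : ℕ} (a : ℕ) (h : a ≤ d) : BeilinsonQuiver n d :=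
  (⟨a, Nat.lt_succ_iff.2 h⟩ : Fin (d + 1))

/-- There are `n + 1` arrows from `a` to `a + 1`, and no others. -/
instance : Quiver.{0} (BeilinsonQuiver n d) where
  Hom a b := {_i : Fin (n + 1) // b.level = a.level + 1}

variable (k : Type u) [Field k]

/-- The arrow number `i` from `a` to `a + 1`. -/
noncomputable def x (i : Fin (n + 1)) (a : ℕ) (h : a + 1 ≤ d) :
    PathAlgebra k (BeilinsonQuiver n d) :=
  PathAlgebra.arrow k (a := vertex n a (Nat.le_of_succ_le h)) (b := vertex n (a + 1) h) ⟨i, rfl⟩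

/-- The path `x_{w (m - 1)} ⋯ x_{w 1} x_{w 0}` of length `m` that starts at the vertex `a`. -/
noncomputable def path (a : ℕ) : (m : ℕ) → (w : Fin m → Fin (n + 1)) → a + m ≤ d →
    PathAlgebra k (BeilinsonQuiver n d)
  | 0, _, h => PathAlgebra.e k (vertex n a h)
  | m + 1, w, h => x k (w (Fin.last m)) (a + m) h *
      path a m (fun i => w i.castSucc) (Nat.le_of_succ_le h)

variable {k} {r : ℕ}

/-- A linear combination `c` of words of length `m` in the variables represents the polynomial
`g`. -/
def Represents {m : ℕ} (c : (Fin m → Fin (n + 1)) → k) (g : MvPolynomial (Fin (n + 1)) k) : Prop :=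
  ∑ w : Fin m → Fin (n + 1), c w • ∏ i, (MvPolynomial.X (w i) : MvPolynomial (Fin (n + 1)) k) = g

/-- The generators of the ideal of relations: the commutativity relations, and for every equation
`f j` of degree `deg j` and every chosen starting vertex `a ∈ T j` for which there is room in
the quiver, the linear combinations of paths of length `deg j` from `a` that represent `f j`.  (Two
of these differ by an element of the ideal generated by the commutativity relations.) -/
inductive IsRelation (d : ℕ) (f : Fin r → MvPolynomial (Fin (n + 1)) k) (deg : Fin r → ℕ)
    (T : Fin r → Set ℕ) : PathAlgebra k (BeilinsonQuiver n d) → Prop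
  | comm (i j : Fin (n + 1)) (a : ℕ) (h : a + 1 + 1 ≤ d) : IsRelation d f deg T
      (x k j (a + 1) h * x k i a (Nat.le_of_succ_le h) -
        x k i (a + 1) h * x k j a (Nat.le_of_succ_le h))
  | equation (j : Fin r) (a : ℕ) (ha : a ∈ T j) (h : a + deg j ≤ d)
      (c : (Fin (deg j) → Fin (n + 1)) → k) (hc : Represents c (f j)) : IsRelation d f deg T
      (∑ w : Fin (deg j) → Fin (n + 1), c w • path k a (deg j) w h)

/-- The ideal `J` of the path algebra generated by the relations. -/
def relationIdeal (d : ℕ) (f : Fin r → MvPolynomial (Fin (n + 1)) k) (deg : Fin r → ℕ)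
    (T : Fin r → Set ℕ) : Ideal (PathAlgebra k (BeilinsonQuiver n d)) :=
  (TwoSidedIdeal.span {y | IsRelation d f deg T y}).asIdeal

instance (d : ℕ) (f : Fin r → MvPolynomial (Fin (n + 1)) k) (deg : Fin r → ℕ)
    (T : Fin r → Set ℕ) : (relationIdeal d f deg T).IsTwoSided :=
  inferInstanceAs (TwoSidedIdeal.asIdeal _).IsTwoSided

/-- The algebra `kQ/J`. -/
abbrev QuotAlgebra (d : ℕ) (f : Fin r → MvPolynomial (Fin (n + 1)) k) (deg : Fin r → ℕ)
    (T : Fin r → Set ℕ) : Type u :=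
  PathAlgebra k (BeilinsonQuiver n d) ⧸ relationIdeal d f deg T

/-- The idempotents of `kQ/J` that belong to the vertices. -/
noncomputable def idem (d : ℕ) (f : Fin r → MvPolynomial (Fin (n + 1)) k) (deg : Fin r → ℕ)
    (T : Fin r → Set ℕ) (v : BeilinsonQuiver n d) : BeilinsonQuiver.QuotAlgebra d f deg T :=
  Ideal.Quotient.mk _ (PathAlgebra.e k v)

/-- The representation `M` of the Beilinson quiver with `M_m` the dual space of
`S^{d-m} V / I_{d-m}`, where the `i`-th arrow from `m` to `m + 1` acts as the transpose of the
multiplication with `x_i`. -/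
noncomputable def dualRep (d : ℕ) (f : Fin r → MvPolynomial (Fin (n + 1)) k) :
    QuiverRep k (BeilinsonQuiver n d) where
  space a := Module.Dual k (ProjEquations.piece f (d - a.level))
  map {a b} h := (ProjEquations.mulX f h.1 (p := d - b.level) (q := d - a.level) (by
    have h1 := h.2
    have h2 := b.level_le
    omega)).dualMap

end BeilinsonQuiver

/-! Over a `k`-algebra `R`, the points of the scheme, the families of indecomposable modules and the
submodules of `R ⊗ M` are all classified by one object: a line subbundle `N` of the trivial bundle
`R ^ (n + 1)` on which the equations vanish (`IsLine`). For points this is the description by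
homogeneous coordinates, which exist locally and are unique up to units (`exists_classifies`,
`exists_line`, `Classifies.line_unique`).

Families: if all arrows from `a` to `a + 1` vanish in a geometric fibre, that fibre splits into its
parts on the vertices `≤ a` and `> a`. So indecomposability means that at every point some arrow out
of each vertex `a < d` is nonzero (`IsGood`, `isGood_iff_geometric`). Then vertex `0` generates the
family, and the ratio of the arrows from `0` to `1` is a line. Commutativity carries this ratio to
all vertices (`mem_line_iff`). Hence, for `u` in the line, paths of equal length are in the ratio of
the corresponding monomials in `u`, and the relation for `f j` at a single vertex with enough room
forces `f j` to vanish at `u` (`line_isZero`). If two families have the same line, a homomorphism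
can be prescribed at vertex `0` and extends uniquely; so the homomorphisms form a line bundle, and
evaluation identifies its tensor product with the first family with the second one
(`hom_invertible`, `evalHom_injective`, `evalHom_surjective`).

Submodules of `M`: an element at vertex `a` is a linear form on degree `d - a` of the coordinate
ring. If the variables act on it with ratio `u`, then up to powers of the `u j` it is a multiple of
evaluation at `u` (`pow_smul_E`). The elements of this kind form a direct summand `gr` of rank one
at each vertex (`gr_isGood`); it realises every line both by a family and by a point of the
grassmannian. Conversely, the coordinate ring is generated in degree one, so no nonzero element of
`M` at a vertex `a < d` is killed by all arrows. A submodule with rank one vertices therefore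
automatically has nonvanishing arrows (`restrict_isGood`), and it equals the `gr` of its line
(`eq_gr_line`).

Injectivity: pairing with `1` at vertex `d` turns homomorphisms from `V` to `M` into linear forms on
`V_d`, for every `V` that satisfies all relations. Linear forms extend along injections, so `M` is
injective. The space of `M` at `d` is at most one-dimensional and meets every nonzero submodule, so
a form that is nonzero on `V_d` embeds an indecomposable `V` as an essential submodule. For
stability the weight is `-1` at vertex `0` and `1` at vertex `d`: a proper submodule of an
indecomposable module misses the source, and a nonzero one contains the sink.

Local trivialisations are mostly avoided. Rank one is expressed by `l (E x) • E y = l (E y) • E x`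
together with values `l (E x)` that generate the unit ideal (`IsRankOneOn`), and claims are checked
after multiplication with such generators. -/

/-! ### Points of `Proj` of a graded ring -/

namespace ProjPoint

open HomogeneousLocalization

variable {σ : Type*} {A : Type u} [CommRing A] [SetLike σ A] [AddSubgroupClass σ A] (𝒜 : ℕ → σ)
  [GradedRing 𝒜]

/-- The ring homomorphism from the degree zero part of `A_x` induced by a ring homomorphism on `A`
that inverts `x`. -/
noncomputable def awayEval {R : Type u} [CommRing R] (ε : A →+* R) (x : A) (hu : IsUnit (ε x)) :
    Away 𝒜 x →+* R :=
  (IsLocalization.Away.lift (S := Localization.Away x) x hu).comp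
    (algebraMap (Away 𝒜 x) (Localization.Away x))

variable {R R' : Type u} [CommRing R] [CommRing R'] (ε : A →+* R)

/-- Clearing the denominator of `a / x ^ n` characterises its value, because `ε x` is a unit. Most
later computations with `awayEval` use this form. -/
theorem awayEval_mk {x : A} (hu : IsUnit (ε x)) {m : ℕ} (hx : x ∈ 𝒜 m) (n : ℕ) (a : A)
    (ha : a ∈ 𝒜 (n • m)) : awayEval 𝒜 ε x hu (Away.mk 𝒜 hx n a ha) * ε x ^ n = ε a := by
  have h : algebraMap (Away 𝒜 x) (Localization.Away x) (Away.mk 𝒜 hx n a ha) *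
      algebraMap A _ x ^ n = algebraMap A _ a := by
    rw [HomogeneousLocalization.algebraMap_apply, Away.val_mk, ← map_pow,
      Localization.mk_eq_mk', ← IsLocalization.mk'_spec (Localization.Away x) a
        (⟨x ^ n, n, rfl⟩ : Submonoid.powers x)]
  have h2 := congrArg (IsLocalization.Away.lift (S := Localization.Away x) x hu) h
  rw [map_mul, map_pow, IsLocalization.Away.lift_eq, IsLocalization.Away.lift_eq] at h2
  exact h2

theorem awayEval_ext {x : A} {m : ℕ} (hx : x ∈ 𝒜 m) (φ ψ : Away 𝒜 x →+* R)
    (h : ∀ n a (ha : a ∈ 𝒜 (n • m)), φ (Away.mk 𝒜 hx n a ha) = ψ (Away.mk 𝒜 hx n a ha)) :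
    φ = ψ := by
  ext z
  obtain ⟨n, a, ha, rfl⟩ := Away.mk_surjective 𝒜 hx z
  exact h n a ha

/-- The morphism to `Proj` given by a ring homomorphism that inverts an element of degree one. -/
noncomputable def point {x : A} (hx : x ∈ 𝒜 1) (hu : IsUnit (ε x)) :
    Spec (.of R) ⟶ Proj 𝒜 :=
  Spec.map (CommRingCat.ofHom (awayEval 𝒜 ε x hu)) ≫ Proj.awayι 𝒜 x hx one_pos

theorem comp_awayEval (φ : R →+* R') {x : A} (hu : IsUnit (ε x)) :
    φ.comp (awayEval 𝒜 ε x hu) = awayEval 𝒜 (φ.comp ε) x (hu.map φ) := by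
  unfold awayEval
  rw [← RingHom.comp_assoc]
  congr 1
  refine IsLocalization.ringHom_ext (Submonoid.powers x) ?_
  ext a
  simp

theorem map_point (φ : R →+* R') {x : A} (hx : x ∈ 𝒜 1) (hu : IsUnit (ε x)) :
    Spec.map (CommRingCat.ofHom φ) ≫ point 𝒜 ε hx hu = point 𝒜 (φ.comp ε) hx (hu.map φ) := by
  unfold point
  rw [← Category.assoc, ← Spec.map_comp, ← CommRingCat.ofHom_comp, comp_awayEval]

theorem awayEval_comp_awayMap {x y z : A} (hx : x ∈ 𝒜 1) (hy : y ∈ 𝒜 1) (hz : z = x * y)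
    (hu : IsUnit (ε x)) (hu' : IsUnit (ε z)) :
    (awayEval 𝒜 ε z hu').comp (awayMap 𝒜 hy hz) = awayEval 𝒜 ε x hu := by
  refine awayEval_ext 𝒜 hx _ _ fun n a ha => ?_
  rw [RingHom.comp_apply, awayMap_mk, ← (hu.pow n).mul_left_inj, awayEval_mk]
  have hy' : IsUnit (ε y) := by
    rw [hz, map_mul] at hu'
    exact isUnit_of_mul_isUnit_right hu'
  subst hz
  rw [← (hy'.pow n).mul_left_inj, mul_assoc, ← mul_pow, ← map_mul, awayEval_mk, map_mul,
    map_pow]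

/-- If `x` and `y` both become units, so does `x * y`, and both morphisms factor through the chart
of `x * y`, where they agree. -/
theorem point_eq_of_mul {x y : A} (hx : x ∈ 𝒜 1) (hy : y ∈ 𝒜 1) (hu : IsUnit (ε x))
    (hv : IsUnit (ε y)) : point 𝒜 ε hx hu = point 𝒜 ε hy hv := by
  have huv : IsUnit (ε (x * y)) := by rw [map_mul]; exact hu.mul hv
  unfold point
  rw [← awayEval_comp_awayMap 𝒜 ε hx hy rfl hu huv,
    ← awayEval_comp_awayMap 𝒜 ε hy hx (mul_comm x y) hv huv, CommRingCat.ofHom_comp,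
    CommRingCat.ofHom_comp, Spec.map_comp, Spec.map_comp, Category.assoc, Category.assoc,
    Proj.SpecMap_awayMap_awayι, Proj.SpecMap_awayMap_awayι]

theorem point_toSpecZero {x : A} (hx : x ∈ 𝒜 1) (hu : IsUnit (ε x)) :
    point 𝒜 ε hx hu ≫ Proj.toSpecZero 𝒜 =
      Spec.map (CommRingCat.ofHom ((awayEval 𝒜 ε x hu).comp (fromZeroRingHom 𝒜 _))) := by
  unfold point
  rw [Category.assoc, Proj.awayι_toSpecZero, ← Spec.map_comp, ← CommRingCat.ofHom_comp]

theorem awayEval_fromZeroRingHom {x : A} (hu : IsUnit (ε x)) (a : 𝒜 0) :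
    awayEval 𝒜 ε x hu (fromZeroRingHom 𝒜 _ a) = ε a := by
  have : algebraMap (Away 𝒜 x) (Localization.Away x) (fromZeroRingHom 𝒜 _ a) =
      algebraMap A _ (a : A) := by
    rw [HomogeneousLocalization.algebraMap_apply]
    rfl
  unfold awayEval
  rw [RingHom.comp_apply, this, IsLocalization.Away.lift_eq]

/-- In the chart of `x`, the open set of `y` is the locus where `y / x` is invertible. If all of
`Spec R` lands there, `y / x` becomes a unit, and hence so does `y = (y / x) * x`. -/
theorem point_range_subset_iff {x y : A} (hx : x ∈ 𝒜 1) (hy : y ∈ 𝒜 1) (hu : IsUnit (ε x))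
    (h : Set.range (point 𝒜 ε hx hu) ⊆ Proj.basicOpen 𝒜 y) : IsUnit (ε y) := by
  have h1 : point 𝒜 ε hx hu ⁻¹ᵁ Proj.basicOpen 𝒜 y = ⊤ := by
    ext p
    simp only [TopologicalSpace.Opens.map_coe, Set.mem_preimage, SetLike.mem_coe,
      TopologicalSpace.Opens.coe_top, Set.mem_univ, iff_true]
    exact h ⟨p, rfl⟩
  unfold point at h1
  rw [Scheme.Hom.comp_preimage, Proj.awayι_preimage_basicOpen 𝒜 hx one_pos hy one_pos] at h1
  have h2 : PrimeSpectrum.basicOpen (awayEval 𝒜 ε x hu (Away.isLocalizationElem hx hy)) = ⊤ := h1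
  have h3 : IsUnit (awayEval 𝒜 ε x hu (Away.isLocalizationElem hx hy)) := by
    by_contra hn
    obtain ⟨I, hI, hmem⟩ := exists_max_ideal_of_mem_nonunits hn
    have : (⟨I, hI.isPrime⟩ : PrimeSpectrum R) ∈
        PrimeSpectrum.basicOpen (awayEval 𝒜 ε x hu (Away.isLocalizationElem hx hy)) :=
      h2 ▸ TopologicalSpace.Opens.mem_top _
    exact this hmem
  have h4 := awayEval_mk 𝒜 ε hu hx 1 (y ^ 1) (by simpa using hy)
  rw [map_pow ε y, pow_one (ε y), pow_one (ε x)] at h4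
  rw [← h4]
  exact IsUnit.mul h3 hu

theorem range_point_subset {x : A} (hx : x ∈ 𝒜 1) (hu : IsUnit (ε x)) :
    Set.range (point 𝒜 ε hx hu) ⊆ Proj.basicOpen 𝒜 x := by
  rw [← Proj.opensRange_awayι 𝒜 x hx one_pos]
  unfold point
  rintro _ ⟨p, rfl⟩
  exact ⟨Spec.map (CommRingCat.ofHom (awayEval 𝒜 ε x hu)) p, rfl⟩

/-- The inclusion of the chart of `x` is a monomorphism. -/
theorem awayEval_eq_of_point_eq {x : A} (ε' : A →+* R) (hx : x ∈ 𝒜 1) (hu : IsUnit (ε x))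
    (hu' : IsUnit (ε' x)) (h : point 𝒜 ε hx hu = point 𝒜 ε' hx hu') :
    awayEval 𝒜 ε x hu = awayEval 𝒜 ε' x hu' := by
  unfold point at h
  rw [cancel_mono] at h
  exact congrArg CommRingCat.Hom.hom (Spec.map_injective h)

theorem exists_of_range_subset {x : A} (hx : x ∈ 𝒜 1) (g : Spec (.of R) ⟶ Proj 𝒜)
    (h : Set.range g ⊆ Proj.basicOpen 𝒜 x) : ∃ φ : Away 𝒜 x →+* R,
      g = Spec.map (CommRingCat.ofHom φ) ≫ Proj.awayι 𝒜 x hx one_pos := by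
  rw [← Proj.opensRange_awayι 𝒜 x hx one_pos] at h
  refine ⟨(Spec.preimage (IsOpenImmersion.lift (Proj.awayι 𝒜 x hx one_pos) g h)).hom, ?_⟩
  rw [CommRingCat.ofHom_hom, Spec.map_preimage]
  exact (IsOpenImmersion.lift_fac _ _ _).symm

end ProjPoint

/-! ### Points with given homogeneous coordinates -/

theorem MvPolynomial.IsHomogeneous.eval₂_mul_left {σ S R : Type*} [CommSemiring S] [CommSemiring R]
    {p : MvPolynomial σ S} {m : ℕ} (hp : p.IsHomogeneous m) (g : S →+* R) (c : R) (v : σ → R) :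
    MvPolynomial.eval₂ g (fun i => c * v i) p = c ^ m * MvPolynomial.eval₂ g v p := by
  rw [MvPolynomial.eval₂_eq, MvPolynomial.eval₂_eq, Finset.mul_sum]
  refine Finset.sum_congr rfl fun s hs => ?_
  have hd : s.degree = m := by
    by_contra hne
    exact (MvPolynomial.mem_support_iff.1 hs) (hp.coeff_eq_zero hne)
  have h : ∏ i ∈ s.support, c ^ s i = c ^ m := by
    rw [Finset.prod_pow_eq_pow_sum, ← hd]; rfl
  simp_rw [mul_pow, Finset.prod_mul_distrib]
  rw [h]
  ring

theorem MvPolynomial.IsHomogeneous.aeval_mul_left {σ S R : Type*} [CommSemiring S] [CommSemiring R]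
    [Algebra S R] {p : MvPolynomial σ S} {m : ℕ} (hp : p.IsHomogeneous m) (c : R) (v : σ → R) :
    MvPolynomial.aeval (fun i => c * v i) p = c ^ m * MvPolynomial.aeval v p :=
  hp.eval₂_mul_left _ c v

namespace ProjEquations

open MvPolynomial

variable {k : Type u} [Field k] {n r : ℕ} (f : Fin r → MvPolynomial (Fin (n + 1)) k)
  {R : Type u} [CommRing R] [Algebra k R] {R' : Type u} [CommRing R'] [Algebra k R']

/-- The coordinates `x_i` of the homogeneous coordinate ring. -/
noncomputable def coord (i : Fin (n + 1)) : CoordRing f := Ideal.Quotient.mkₐ k (ideal f) (X i)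

theorem coord_mem (i : Fin (n + 1)) : coord f i ∈ piece f 1 :=
  mk_mem_piece f (isHomogeneous_X k i)

/-- `v` is a common zero of the equations. -/
def IsZero (v : Fin (n + 1) → R) : Prop := ∀ j, aeval v (f j) = 0

variable {f}

theorem IsZero.map_ringHom {v : Fin (n + 1) → R} (hv : IsZero f v) (φ : R →ₐ[k] R') :
    IsZero f (fun i => φ (v i)) := fun j => by
  have : aeval (fun i => φ (v i)) (f j) = φ (aeval v (f j)) := by
    rw [← AlgHom.comp_apply, comp_aeval]
  rw [this, hv j, map_zero]

/-- Evaluation of elements of the coordinate ring at a common zero of the equations. -/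
noncomputable def evalAt {v : Fin (n + 1) → R} (hv : IsZero f v) : CoordRing f →ₐ[k] R :=
  Ideal.Quotient.liftₐ (ideal f) (aeval v) (by
    intro p hp
    have : ideal f ≤ RingHom.ker (aeval v : MvPolynomial (Fin (n + 1)) k →ₐ[k] R) := by
      refine Ideal.span_le.2 ?_
      rintro _ ⟨j, rfl⟩
      exact hv j
    exact this hp)

theorem evalAt_mk {v : Fin (n + 1) → R} (hv : IsZero f v) (p : MvPolynomial (Fin (n + 1)) k) :
    evalAt hv (Ideal.Quotient.mkₐ k (ideal f) p) = aeval v p := rfl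

@[simp]
theorem evalAt_coord {v : Fin (n + 1) → R} (hv : IsZero f v) (i : Fin (n + 1)) :
    evalAt hv (coord f i) = v i := by
  rw [coord, evalAt_mk, aeval_X]

theorem map_comp_evalAt {v : Fin (n + 1) → R} (hv : IsZero f v) (φ : R →ₐ[k] R') :
    φ.comp (evalAt hv) = evalAt (hv.map_ringHom φ) := by
  refine Ideal.Quotient.algHom_ext k ?_
  ext i
  change φ (evalAt hv (coord f i)) = evalAt (hv.map_ringHom φ) (coord f i)
  simp

theorem evalAt_mul_left {v w : Fin (n + 1) → R} (hv : IsZero f v) (hw : IsZero f w) (c : R)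
    (h : ∀ i, w i = c * v i) {m : ℕ} {a : CoordRing f} (ha : a ∈ piece f m) :
    evalAt hw a = c ^ m * evalAt hv a := by
  obtain ⟨p, hp, rfl⟩ := ha
  obtain rfl : w = fun i => c * v i := funext h
  exact ((mem_homogeneousSubmodule _ _).1 hp).aeval_mul_left c v

variable {deg : Fin r → ℕ} (hf : ∀ j, (f j).IsHomogeneous (deg j))

theorem structureMap_eq : structureMap f hf = (letI := gradedAlgebra f hf
    Proj.toSpecZero (piece f) ≫ Spec.map (CommRingCat.ofHom (algebraMap k (piece f 0)))) := rfl

theorem point_comp_structureMap (ε : CoordRing f →ₐ[k] R) {x : CoordRing f} (hx : x ∈ piece f 1)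
    (hu : IsUnit ((ε : CoordRing f →+* R) x)) : (letI := gradedAlgebra f hf
    ProjPoint.point (piece f) (ε : CoordRing f →+* R) hx hu ≫ structureMap f hf =
      Spec.map (CommRingCat.ofHom (algebraMap k R))) := by
  let := gradedAlgebra f hf
  rw [structureMap_eq, ← Category.assoc, ProjPoint.point_toSpecZero, ← Spec.map_comp,
    ← CommRingCat.ofHom_comp]
  congr 2
  ext c
  rw [RingHom.comp_apply, RingHom.comp_apply, ProjPoint.awayEval_fromZeroRingHom]
  exact ε.commutes c

/-- The point of the projective scheme with homogeneous coordinates `v`, one of which is a unit. -/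
noncomputable def point {v : Fin (n + 1) → R} (hv : IsZero f v) (l : Fin (n + 1))
    (hl : IsUnit (v l)) : AlgPoint (structureMap f hf) R :=
  letI := gradedAlgebra f hf
  ⟨ProjPoint.point (piece f) (evalAt hv : CoordRing f →+* R) (coord_mem f l)
      (by simpa using hl), point_comp_structureMap hf _ _ _⟩

theorem point_eq_of_index {v : Fin (n + 1) → R} (hv : IsZero f v) {l m : Fin (n + 1)}
    (hl : IsUnit (v l)) (hm : IsUnit (v m)) : point hf hv l hl = point hf hv m hm := by
  let := gradedAlgebra f hf
  exact Subtype.ext (ProjPoint.point_eq_of_mul (piece f) _ _ _ _ _)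

/-- Numerator and denominator of a fraction `a / x_l ^ N` of degree zero both acquire the factor `c
^ N`. That `c` is a unit follows from `hl'`. -/
theorem point_eq_of_smul {v w : Fin (n + 1) → R} (hv : IsZero f v) (hw : IsZero f w)
    {l : Fin (n + 1)} (hl : IsUnit (v l)) (hl' : IsUnit (w l)) (c : R) (h : ∀ i, w i = c * v i) :
    point hf hv l hl = point hf hw l hl' := by
  let := gradedAlgebra f hf
  refine Subtype.ext ?_
  change ProjPoint.point (piece f) _ _ _ = ProjPoint.point (piece f) _ _ _
  unfold ProjPoint.point
  congr 3
  refine ProjPoint.awayEval_ext (piece f) (coord_mem f l) _ _ fun N a ha => ?_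
  have hw1 : IsUnit ((evalAt hw : CoordRing f →+* R) (coord f l)) := by simpa using hl'
  have hv1 : IsUnit ((evalAt hv : CoordRing f →+* R) (coord f l)) := by simpa using hl
  rw [← (hw1.pow N).mul_left_inj, ProjPoint.awayEval_mk]
  have h1 := ProjPoint.awayEval_mk (piece f) (evalAt hv : CoordRing f →+* R) hv1 (coord_mem f l) N
    a ha
  have h2 : (evalAt hw : CoordRing f →+* R) (coord f l) =
      c * (evalAt hv : CoordRing f →+* R) (coord f l) := by simpa using h l
  rw [h2, mul_pow, mul_left_comm, h1]
  refine (evalAt_mul_left hv hw c h (m := N) ?_).symm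
  simpa using ha

theorem point_eq {v w : Fin (n + 1) → R} (hv : IsZero f v) (hw : IsZero f w)
    {l m : Fin (n + 1)} (hl : IsUnit (v l)) (hm : IsUnit (w m))
    (h : ∀ i j, v i * w j = v j * w i) : point hf hv l hl = point hf hw m hm := by
  obtain ⟨c, hc⟩ := hl.exists_right_inv
  -- Since `c` inverts `v l`, the factor is `w l / v l`; it is a unit because it divides the unit `w
  -- m`.
  have h1 : ∀ i, w i = (c * w l) * v i := fun i => by
    linear_combination (-w i) * hc + c * h l i
  have hc' : IsUnit (c * w l) := isUnit_of_mul_isUnit_left (h1 m ▸ hm)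
  have hl' : IsUnit (w l) := isUnit_of_mul_isUnit_right hc'
  rw [point_eq_of_index hf hw hm hl']
  exact point_eq_of_smul hf hv hw hl hl' _ h1

/-- Equality of the points first puts the second one in the chart of `l`, so that `w l` is a unit
too. Comparing the values of the coordinate functions `x_i / x_l` on that chart then gives the
proportionality. -/
theorem proportional_of_point_eq {v w : Fin (n + 1) → R} (hv : IsZero f v) (hw : IsZero f w)
    {l m : Fin (n + 1)} (hl : IsUnit (v l)) (hm : IsUnit (w m))
    (h : point hf hv l hl = point hf hw m hm) : ∀ i j, v i * w j = v j * w i := by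
  let := gradedAlgebra f hf
  have hw1 : IsUnit ((evalAt hw : CoordRing f →+* R) (coord f m)) := by simpa using hm
  have hv1 : IsUnit ((evalAt hv : CoordRing f →+* R) (coord f l)) := by simpa using hl
  have hl' : IsUnit ((evalAt hw : CoordRing f →+* R) (coord f l)) := by
    refine ProjPoint.point_range_subset_iff (piece f) _ (coord_mem f m) (coord_mem f l) hw1 ?_
    have h2 : ProjPoint.point (piece f) (evalAt hv : CoordRing f →+* R) (coord_mem f l) hv1 =
      ProjPoint.point (piece f) (evalAt hw : CoordRing f →+* R) (coord_mem f m) hw1 :=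
      congrArg Subtype.val h
    rw [← h2]
    exact ProjPoint.range_point_subset _ _ _ _
  have hl1 : IsUnit (w l) := by simpa using hl'
  rw [point_eq_of_index hf hw hm hl1] at h
  have h2 := ProjPoint.awayEval_eq_of_point_eq (piece f) (evalAt hv : CoordRing f →+* R)
    (evalAt hw : CoordRing f →+* R) (coord_mem f l) hv1 hl' (congrArg Subtype.val h)
  have h3 : ∀ i, v i * w l = w i * v l := fun i => by
    have hi : coord f i ∈ piece f (1 • 1) := by simpa using coord_mem f i
    have e1 := ProjPoint.awayEval_mk (piece f) (evalAt hv : CoordRing f →+* R) hv1 (coord_mem f l) 1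
      (coord f i) hi
    have e2 := ProjPoint.awayEval_mk (piece f) (evalAt hw : CoordRing f →+* R) hl' (coord_mem f l) 1
      (coord f i) hi
    rw [h2] at e1
    simp only [pow_one, RingHom.coe_coe, evalAt_coord] at e1 e2
    linear_combination (-w l) * e1 + v l * e2
  intro i j
  refine (hl.mul hl1).mul_left_cancel ?_
  linear_combination v l * w j * h3 i - v l * w i * h3 j
end ProjEquations

/-! ### Vanishing is local -/

/-- A maximal ideal containing the annihilator of `x` would contain a power of every `s ∈ S`, hence
all of `S`. -/
theorem eq_zero_of_forall_pow_mul_eq_zero {R : Type*} [CommRing R] {S : Set R}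
    (hS : Ideal.span S = ⊤) {x : R} (h : ∀ s ∈ S, ∃ K : ℕ, s ^ K * x = 0) : x = 0 := by
  by_contra hx
  have hne : Ideal.span {x} ≠ ⊥ := by simpa using hx
  have hann : (Ideal.span {x}).annihilator ≠ ⊤ := by
    intro ht
    rw [Submodule.annihilator_eq_top_iff] at ht
    exact hne ht
  obtain ⟨m, hm, hle⟩ := Ideal.exists_le_maximal _ hann
  refine hm.ne_top (top_unique (hS ▸ Ideal.span_le.2 fun s hs => ?_))
  obtain ⟨K, hK⟩ := h s hs
  refine hm.isPrime.mem_of_pow_mem K (hle ?_)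
  rw [Submodule.mem_annihilator_span_singleton]
  exact hK

theorem eq_zero_of_forall_away {R : Type*} [CommRing R] {S : Set R}
    (hS : Ideal.span S = ⊤) {x : R}
    (h : ∀ s ∈ S, algebraMap R (Localization.Away s) x = 0) : x = 0 := by
  refine eq_zero_of_forall_pow_mul_eq_zero hS fun s hs => ?_
  obtain ⟨⟨_, K, rfl⟩, hK⟩ := (IsLocalization.map_eq_zero_iff (Submonoid.powers s) _ x).1 (h s hs)
  exact ⟨K, hK⟩

/-! ### Functoriality and gluing of points -/

namespace AlgPoint

variable {k : Type u} [Field k] {X : Scheme.{u}} {s : X ⟶ Spec (.of k)}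
  {R R' R'' : Type u} [CommRing R] [Algebra k R] [CommRing R'] [Algebra k R'] [CommRing R'']
  [Algebra k R'']

/-- The image of a point under a homomorphism of `k`-algebras. -/
noncomputable def map (φ : R →ₐ[k] R') (g : AlgPoint s R) : AlgPoint s R' :=
  ⟨Spec.map (CommRingCat.ofHom (φ : R →+* R')) ≫ g.1, by
    rw [Category.assoc, g.2, ← Spec.map_comp, ← CommRingCat.ofHom_comp, AlgHom.comp_algebraMap]⟩

theorem map_map (φ : R →ₐ[k] R') (ψ : R' →ₐ[k] R'') (g : AlgPoint s R) :
    (g.map φ).map ψ = g.map (ψ.comp φ) := by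
  refine Subtype.ext ?_
  change Spec.map _ ≫ Spec.map _ ≫ _ = Spec.map _ ≫ _
  rw [← Category.assoc, ← Spec.map_comp, ← CommRingCat.ofHom_comp]
  rfl

/-- The localization map as a homomorphism of `k`-algebras. -/
noncomputable abbrev toAway (k : Type u) [Field k] {R : Type u} [CommRing R] [Algebra k R] (a : R) :
    R →ₐ[k] Localization.Away a :=
  IsScalarTower.toAlgHom k R (Localization.Away a)

theorem ext_of_cover {ι : Type u} (a : ι → R) (ha : Ideal.span (Set.range a) = ⊤)
    {g g' : AlgPoint s R} (h : ∀ i, g.map (toAway k (a i)) = g'.map (toAway k (a i))) : g = g' := by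
  refine Subtype.ext ?_
  refine Scheme.Cover.hom_ext
    (Scheme.affineOpenCoverOfSpanRangeEqTop (R := .of R) a ha).openCover _ _ fun i => ?_
  exact congrArg Subtype.val (h i)

theorem pullback_fst_comp_eq {R S T : Type u} [CommRing R] [CommRing S] [CommRing T] [Algebra R S]
    [Algebra R T] {X : Scheme.{u}} (g : Spec (.of S) ⟶ X) (g' : Spec (.of T) ⟶ X)
    (h : Spec.map (CommRingCat.ofHom (Algebra.TensorProduct.includeLeftRingHom :
        S →+* S ⊗[R] T)) ≫ g =
      Spec.map (CommRingCat.ofHom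
        ((Algebra.TensorProduct.includeRight : T →ₐ[R] S ⊗[R] T) : T →+* S ⊗[R] T)) ≫ g') :
    Limits.pullback.fst (Spec.map (CommRingCat.ofHom (algebraMap R S)))
      (Spec.map (CommRingCat.ofHom (algebraMap R T))) ≫ g =
    Limits.pullback.snd (Spec.map (CommRingCat.ofHom (algebraMap R S)))
      (Spec.map (CommRingCat.ofHom (algebraMap R T))) ≫ g' := by
  rw [← pullbackSpecIso_hom_fst, Category.assoc, h, ← Category.assoc]
  congr 1
  exact pullbackSpecIso_hom_snd R S T

/-- The compatibility hypothesis quantifies over all algebras `T` under both localizations, which is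
convenient to verify. It is needed only for the tensor product of the two localizations, whose
spectrum is the overlap. -/
theorem exists_glue {ι : Type u} (a : ι → R) (ha : Ideal.span (Set.range a) = ⊤)
    (g : ∀ i, AlgPoint s (Localization.Away (a i)))
    (h : ∀ i j (T : Type u) [CommRing T] [Algebra k T] (φ : Localization.Away (a i) →ₐ[k] T)
      (ψ : Localization.Away (a j) →ₐ[k] T),
      φ.comp (toAway k (a i)) = ψ.comp (toAway k (a j)) → (g i).map φ = (g j).map ψ) :
    ∃ g' : AlgPoint s R, ∀ i, g'.map (toAway k (a i)) = g i := by
  let 𝒰 := (Scheme.affineOpenCoverOfSpanRangeEqTop (R := .of R) a ha).openCover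
  have hcompat : ∀ i j : ι, Limits.pullback.fst (𝒰.f i) (𝒰.f j) ≫ (g i).1 =
      Limits.pullback.snd (𝒰.f i) (𝒰.f j) ≫ (g j).1 := by
    intro i j
    let φ : Localization.Away (a i) →ₐ[k]
        (Localization.Away (a i) ⊗[R] Localization.Away (a j)) :=
      (Algebra.TensorProduct.includeLeft (R := R) (S := R)).restrictScalars k
    let ψ : Localization.Away (a j) →ₐ[k]
        (Localization.Away (a i) ⊗[R] Localization.Away (a j)) :=
      (Algebra.TensorProduct.includeRight (R := R)).restrictScalars k
    have hφψ : φ.comp (toAway k (a i)) = ψ.comp (toAway k (a j)) := by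
      refine AlgHom.ext fun x => ?_
      exact ((Algebra.TensorProduct.includeLeft (R := R) (S := R)
        (A := Localization.Away (a i)) (B := Localization.Away (a j))).commutes x).trans
        ((Algebra.TensorProduct.includeRight (R := R)
        (A := Localization.Away (a i)) (B := Localization.Away (a j))).commutes x).symm
    exact pullback_fst_comp_eq _ _ (congrArg Subtype.val (h i j _ φ ψ hφψ))
  let G := Scheme.Cover.glueMorphisms 𝒰 (fun i => (g i).1) hcompat
  have hG : ∀ i, 𝒰.f i ≫ G = (g i).1 := Scheme.Cover.ι_glueMorphisms 𝒰 _ hcompat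
  refine ⟨⟨G, ?_⟩, fun i => Subtype.ext (hG i)⟩
  refine Scheme.Cover.hom_ext 𝒰 _ _ fun i => ?_
  rw [← Category.assoc, hG]
  refine (g i).2.trans ?_
  change _ = Spec.map _ ≫ Spec.map _
  rw [← Spec.map_comp, ← CommRingCat.ofHom_comp, ← IsScalarTower.algebraMap_eq]

end AlgPoint

/-! ### Local homogeneous coordinates of an arbitrary point -/

namespace ProjEquations

open MvPolynomial

variable {k : Type u} [Field k] {n r : ℕ} {f : Fin r → MvPolynomial (Fin (n + 1)) k}
  {R : Type u} [CommRing R] [Algebra k R] {R' : Type u} [CommRing R'] [Algebra k R']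
  {deg : Fin r → ℕ} (hf : ∀ j, (f j).IsHomogeneous (deg j))

theorem point_map (φ : R →ₐ[k] R') {v : Fin (n + 1) → R} (hv : IsZero f v) (l : Fin (n + 1))
    (hl : IsUnit (v l)) :
    (point hf hv l hl).map φ = point hf (hv.map_ringHom φ) l (hl.map φ) := by
  let := gradedAlgebra f hf
  refine Subtype.ext ?_
  refine (ProjPoint.map_point (piece f) _ (φ : R →+* R') (coord_mem f l) _).trans ?_
  change ProjPoint.point (piece f) _ _ _ = ProjPoint.point (piece f) _ _ _
  congr 1
  exact congrArg (fun φ : CoordRing f →ₐ[k] R' => (φ : CoordRing f →+* R'))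
    (map_comp_evalAt hv φ)

theorem iSup_basicOpen_coord : (letI := gradedAlgebra f hf
    ⨆ l, Proj.basicOpen (piece f) (coord f l) = ⊤) := by
  let := gradedAlgebra f hf
  refine Proj.iSup_basicOpen_eq_top' (piece f) (coord f) (fun l => ⟨1, coord_mem f l⟩) ?_
  refine top_unique fun x _ => ?_
  obtain ⟨p, rfl⟩ := Ideal.Quotient.mk_surjective x
  induction p using MvPolynomial.induction_on with
  | C c => exact Subalgebra.algebraMap_mem _ (algebraMap k (piece f 0) c)
  | add p q hp hq => rw [map_add]; exact add_mem (hp trivial) (hq trivial)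
  | mul_X p i hp =>
    rw [map_mul]
    exact mul_mem (hp trivial) (Algebra.subset_adjoin ⟨i, rfl⟩)

/-- A point that lies in the basic open subset of a coordinate has homogeneous coordinates. -/
theorem exists_eq_point_of_range_subset [GradedAlgebra (piece f)]
    (hf : ∀ j, (f j).IsHomogeneous (deg j)) (g : Spec (.of R) ⟶ Proj (piece f))
    (hg : g ≫ Proj.toSpecZero (piece f) ≫
      Spec.map (CommRingCat.ofHom (algebraMap k (piece f 0))) =
        Spec.map (CommRingCat.ofHom (algebraMap k R))) (l : Fin (n + 1))
    (h : Set.range g ⊆ Proj.basicOpen (piece f) (coord f l)) :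
    ∃ (v : Fin (n + 1) → R) (hv : IsZero f v)
      (hl : IsUnit ((evalAt hv : CoordRing f →+* R) (coord f l))),
      v l = 1 ∧ g = ProjPoint.point (piece f) (evalAt hv : CoordRing f →+* R) (coord_mem f l) hl := by
  obtain ⟨φ, hφ⟩ := ProjPoint.exists_of_range_subset (piece f) (coord_mem f l) g h
  have hstr : φ.comp ((HomogeneousLocalization.fromZeroRingHom (piece f) _).comp
      (algebraMap k (piece f 0))) = algebraMap k R := by
    rw [hφ, Category.assoc, ← Category.assoc (Proj.awayι _ _ _ _), Proj.awayι_toSpecZero,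
      ← Spec.map_comp, ← Spec.map_comp] at hg
    exact congrArg CommRingCat.Hom.hom (Spec.map_injective hg)
  have hmem : ∀ i, coord f i ∈ piece f (1 • 1) := fun i => by simpa using coord_mem f i
  let y : Fin (n + 1) → HomogeneousLocalization.Away (piece f) (coord f l) := fun i =>
    HomogeneousLocalization.Away.mk (piece f) (coord_mem f l) 1 (coord f i) (hmem i)
  let ι := algebraMap (HomogeneousLocalization.Away (piece f) (coord f l))
    (Localization.Away (coord f l))
  have hι : Function.Injective ι := HomogeneousLocalization.val_injective _
  -- Dehomogenisation: substitute the fractions `y i = x_i / x_l` for the variables.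
  let ψ : MvPolynomial (Fin (n + 1)) k →+* HomogeneousLocalization.Away (piece f) (coord f l) :=
    eval₂Hom ((HomogeneousLocalization.fromZeroRingHom (piece f) _).comp
      (algebraMap k (piece f 0))) y
  have hιmk : ∀ N a ha, ι (HomogeneousLocalization.Away.mk (piece f) (coord_mem f l) N a ha) *
      algebraMap _ _ (coord f l) ^ N = algebraMap _ (Localization.Away (coord f l)) a := by
    intro N a ha
    rw [← map_pow, HomogeneousLocalization.algebraMap_apply, HomogeneousLocalization.Away.val_mk,
      Localization.mk_eq_mk', ← IsLocalization.mk'_spec (Localization.Away (coord f l)) a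
        (⟨coord f l ^ N, N, rfl⟩ : Submonoid.powers (coord f l))]
  have hunit : IsUnit (algebraMap _ (Localization.Away (coord f l)) (coord f l)) :=
    IsLocalization.Away.algebraMap_isUnit _
  -- For `p` homogeneous of degree `N` this is `p (x / x_l) = p (x) / x_l ^ N`, verified in the full
  -- localization after multiplication with `x_l ^ N`.
  have hψ : ∀ N p (hp : p.IsHomogeneous N) (ha : Ideal.Quotient.mkₐ k (ideal f) p ∈
      piece f (N • 1)), ψ p = HomogeneousLocalization.Away.mk (piece f) (coord_mem f l) N
        (Ideal.Quotient.mkₐ k (ideal f) p) ha := by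
    intro N p hp ha
    apply hι
    rw [← (hunit.pow N).mul_left_inj, hιmk, mul_comm]
    have e1 : ι (ψ p) = eval₂ (ι.comp ((HomogeneousLocalization.fromZeroRingHom (piece f) _).comp
      (algebraMap k (piece f 0)))) (fun i => ι (y i)) p := by
      rw [← hom_eval₂]; rfl
    rw [e1, ← hp.eval₂_mul_left]
    have e2 : (fun i => algebraMap _ (Localization.Away (coord f l)) (coord f l) * ι (y i)) =
        fun i => algebraMap _ (Localization.Away (coord f l)) (coord f i) := by
      funext i
      rw [mul_comm, ← hιmk 1 (coord f i) (hmem i), pow_one]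
    rw [e2]
    have e3 : algebraMap _ (Localization.Away (coord f l)) (Ideal.Quotient.mkₐ k (ideal f) p) =
      ((algebraMap (CoordRing f) (Localization.Away (coord f l))).comp
        (Ideal.Quotient.mk (ideal f))) (eval₂ C X p) := by rw [eval₂_eta]; rfl
    rw [e3, hom_eval₂]
    rfl
  let v : Fin (n + 1) → R := fun i => φ (y i)
  have hφψ : ∀ p, φ (ψ p) = aeval v p := by
    intro p
    change φ (eval₂ _ _ p) = _
    rw [hom_eval₂, hstr]
    rfl
  have hv : IsZero f v := fun j => by
    have hz : Ideal.Quotient.mkₐ k (ideal f) (f j) = 0 :=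
      Ideal.Quotient.eq_zero_iff_mem.2 (Ideal.subset_span ⟨j, rfl⟩)
    have hmem' : Ideal.Quotient.mkₐ k (ideal f) (f j) ∈ piece f (deg j • 1) := by
      rw [hz]; exact zero_mem _
    rw [← hφψ, hψ (deg j) (f j) (hf j) hmem']
    have : HomogeneousLocalization.Away.mk (piece f) (coord_mem f l) (deg j) _ hmem' = 0 := by
      apply hι
      rw [← (hunit.pow (deg j)).mul_left_inj, hιmk, hz, map_zero, map_zero, zero_mul]
    rw [this, map_zero]
  have hvl : v l = 1 := by
    have : y l = 1 := by
      apply hι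
      rw [← (hunit.pow 1).mul_left_inj, hιmk, map_one, one_mul, pow_one]
    change φ (y l) = 1
    rw [this, map_one]
  have hu : IsUnit ((evalAt hv : CoordRing f →+* R) (coord f l)) := by
    simp [hvl]
  refine ⟨v, hv, hu, hvl, ?_⟩
  rw [hφ]
  unfold ProjPoint.point
  congr 3
  refine ProjPoint.awayEval_ext (piece f) (coord_mem f l) _ _ fun N a ha => ?_
  rw [← (hu.pow N).mul_left_inj, ProjPoint.awayEval_mk]
  have ha' : a ∈ piece f N := by simpa using ha
  obtain ⟨p, hp, rfl⟩ := ha'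
  rw [RingHom.coe_coe, evalAt_coord, hvl, one_pow, mul_one]
  have := hψ N p ((mem_homogeneousSubmodule _ _).1 hp) ha
  change φ (HomogeneousLocalization.Away.mk (piece f) (coord_mem f l) N
    (Ideal.Quotient.mkₐ k (ideal f) p) ha) = aeval v p
  rw [← this, hφψ]

theorem exists_local_coordinates (g : AlgPoint (structureMap f hf) R) :
    ∃ t : Finset R, Ideal.span (t : Set R) = ⊤ ∧ ∀ a ∈ t, ∃ (v : Fin (n + 1) → Localization.Away a)
      (hv : IsZero f v) (l : Fin (n + 1)) (hl : IsUnit (v l)), v l = 1 ∧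
      g.map (AlgPoint.toAway k a) = point hf hv l hl := by
  let := gradedAlgebra f hf
  let g' : Spec (.of R) ⟶ Proj (piece f) := g.1
  -- The elements whose nonvanishing locus maps into a single standard chart. They generate the unit
  -- ideal because the standard charts cover and basic open sets form a basis.
  let S : Set R := {a | ∃ l, ∀ p : PrimeSpectrum R, a ∉ p.asIdeal →
    g' p ∈ Proj.basicOpen (piece f) (coord f l)}
  have hS : Ideal.span S = ⊤ := by
    by_contra hne
    obtain ⟨m, hm, hle⟩ := Ideal.exists_le_maximal _ hne
    let p : PrimeSpectrum R := ⟨m, hm.isPrime⟩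
    have hp : g' p ∈ (⨆ l, Proj.basicOpen (piece f) (coord f l)) := by
      rw [iSup_basicOpen_coord hf]; exact TopologicalSpace.Opens.mem_top _
    obtain ⟨l, hl⟩ := TopologicalSpace.Opens.mem_iSup.1 hp
    let U : TopologicalSpace.Opens (PrimeSpectrum R) :=
      g' ⁻¹ᵁ Proj.basicOpen (piece f) (coord f l)
    obtain ⟨_, ⟨a, rfl⟩, hpa, hsub⟩ := TopologicalSpace.Opens.isBasis_iff_nbhd.1
      PrimeSpectrum.isBasis_basic_opens (show p ∈ U from hl)
    exact hpa (hle (Ideal.subset_span ⟨l, fun q hq => hsub hq⟩))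
  obtain ⟨t, ht, ht'⟩ := (Ideal.span_eq_top_iff_finite S).1 hS
  refine ⟨t, ht', fun a ha => ?_⟩
  obtain ⟨l, hl⟩ := ht ha
  obtain ⟨v, hv, hu, h1, h2⟩ := exists_eq_point_of_range_subset hf
    (g.map (AlgPoint.toAway k a)).1 (g.map (AlgPoint.toAway k a)).2 l (by
      rintro _ ⟨p, rfl⟩
      refine hl (PrimeSpectrum.comap (algebraMap R (Localization.Away a)) p) ?_
      have := PrimeSpectrum.localization_away_comap_range (Localization.Away a) a
      exact this.subset ⟨p, rfl⟩)
  exact ⟨v, hv, l, by rw [h1]; exact isUnit_one, h1, Subtype.ext h2⟩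

end ProjEquations

/-! ### Line subbundles and the points they define -/

namespace ProjEquations

open MvPolynomial

variable {k : Type u} [Field k] {n r : ℕ} {f : Fin r → MvPolynomial (Fin (n + 1)) k}
  {R : Type u} [CommRing R] [Algebra k R] {R' : Type u} [CommRing R'] [Algebra k R']

/-- From `w i • u = u i • w` and homogeneity, `(w i) ^ deg j` times the value of `f j` at `u` is `(u
i) ^ deg j` times its value at `w`, which is zero. -/
theorem isZero_of_proportional {deg : Fin r → ℕ} (hf : ∀ j, (f j).IsHomogeneous (deg j))
    {u : Fin (n + 1) → R} {S : Set R} (hS : Ideal.span S = ⊤)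
    (h : ∀ c ∈ S, ∃ w : Fin (n + 1) → R, IsZero f w ∧ (∃ i, w i = c) ∧
      ∀ i j, w i * u j = w j * u i) : IsZero f u := by
  intro j
  refine eq_zero_of_forall_pow_mul_eq_zero hS fun c hc => ⟨deg j, ?_⟩
  obtain ⟨w, hw, ⟨i, rfl⟩, hp⟩ := h c hc
  rw [← (hf j).aeval_mul_left]
  have : (fun a => w i * u a) = fun a => u i * w a := by
    funext a
    rw [hp, mul_comm]
  rw [this, (hf j).aeval_mul_left, hw j, mul_zero]

/-- `N` is a line subbundle of the trivial bundle of rank `n + 1` on which the equations vanish: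
any two elements are proportional, and the coordinates of the elements generate the unit ideal. -/
structure IsLine (f : Fin r → MvPolynomial (Fin (n + 1)) k) (N : Submodule R (Fin (n + 1) → R)) :
    Prop where
  minors : ∀ u ∈ N, ∀ v ∈ N, ∀ i j, u i * v j = u j * v i
  unimodular : Ideal.span {c | ∃ u ∈ N, ∃ i, u i = c} = ⊤
  isZero : ∀ u ∈ N, IsZero f u

namespace IsLine

variable {N N' : Submodule R (Fin (n + 1) → R)}

/-- For `u ∈ N` one has `u i • w = w i • u ∈ N`, and the scalars `u i` generate the unit ideal. So a
line contains everything proportional to it, and an inclusion of lines is an equality. -/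
theorem mem_of_minors (hN : IsLine f N) {w : Fin (n + 1) → R}
    (hw : ∀ u ∈ N, ∀ i j, w i * u j = w j * u i) : w ∈ N := by
  suffices h : ∀ c ∈ Ideal.span {c | ∃ u ∈ N, ∃ i, u i = c}, c • w ∈ N by
    simpa using h 1 (hN.unimodular ▸ Submodule.mem_top)
  intro c hc
  induction hc using Submodule.span_induction with
  | mem c hc =>
    obtain ⟨u, hu, i, rfl⟩ := hc
    have : u i • w = w i • u := by
      ext j
      simp only [Pi.smul_apply, smul_eq_mul]
      rw [hw u hu i j, mul_comm]
    rw [this]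
    exact N.smul_mem _ hu
  | zero => simp
  | add x y _ _ hx hy => rw [add_smul]; exact N.add_mem hx hy
  | smul a x _ hx => rw [smul_assoc]; exact N.smul_mem _ hx

theorem eq_of_le (hN : IsLine f N) (hN' : IsLine f N') (h : N ≤ N') : N = N' :=
  le_antisymm h fun w hw => hN.mem_of_minors fun u hu => hN'.minors w hw u (h hu)

theorem span_minors (hN : IsLine f N) (φ : R →ₐ[k] R') :
    ∀ u ∈ Submodule.span R' {v | ∃ u ∈ N, v = fun i => φ (u i)},
    ∀ v ∈ Submodule.span R' {v | ∃ u ∈ N, v = fun i => φ (u i)},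
    ∀ i j, u i * v j = u j * v i := by
  intro u hu v hv i j
  induction hu using Submodule.span_induction with
  | mem u hu =>
    obtain ⟨u, hu, rfl⟩ := hu
    induction hv using Submodule.span_induction with
    | mem v hv =>
      obtain ⟨v, hv, rfl⟩ := hv
      dsimp only
      rw [← map_mul, hN.minors u hu v hv i j, map_mul]
    | zero => simp
    | add x y _ _ hx hy => simp only [Pi.add_apply, mul_add, hx, hy]
    | smul a x _ hx =>
      simp only [Pi.smul_apply, smul_eq_mul]
      linear_combination a * hx
  | zero => simp
  | add x y _ _ hx hy => simp only [Pi.add_apply, add_mul, hx, hy]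
  | smul a x _ hx =>
    simp only [Pi.smul_apply, smul_eq_mul]
    linear_combination a * hx
theorem span_coords (hN : IsLine f N) (φ : R →ₐ[k] R') :
    Ideal.span {c | ∃ u ∈ N, ∃ i, φ (u i) = c} = ⊤ := by
  refine (Ideal.eq_top_iff_one _).2 ?_
  have h1 : (1 : R) ∈ Ideal.span {c | ∃ u ∈ N, ∃ i, u i = c} := by
    rw [hN.unimodular]; exact Submodule.mem_top
  have h2 := Ideal.mem_map_of_mem (φ : R →+* R') h1
  rw [map_one, Ideal.map_span] at h2
  refine Ideal.span_mono ?_ h2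
  rintro _ ⟨_, ⟨u, hu, i, rfl⟩, rfl⟩
  exact ⟨u, hu, i, rfl⟩

theorem baseChange (hN : IsLine f N) {deg : Fin r → ℕ} (hf : ∀ j, (f j).IsHomogeneous (deg j))
    (φ : R →ₐ[k] R') : IsLine f (Submodule.span R' {v | ∃ u ∈ N, v = fun i => φ (u i)}) where
  minors := hN.span_minors φ
  unimodular := by
    refine top_unique ((hN.span_coords φ).symm.le.trans (Ideal.span_mono ?_))
    rintro _ ⟨u, hu, i, rfl⟩
    exact ⟨_, Submodule.subset_span ⟨u, hu, rfl⟩, i, rfl⟩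
  isZero u hu := isZero_of_proportional hf (hN.span_coords φ) (by
    rintro _ ⟨w, hw, i, rfl⟩
    exact ⟨_, (hN.isZero w hw).map_ringHom φ, ⟨i, rfl⟩, fun a b =>
      hN.span_minors φ _ (Submodule.subset_span ⟨w, hw, rfl⟩) u hu a b⟩)

theorem exists_isUnit_atPrime (hN : IsLine f N) (m : Ideal R) [m.IsPrime] :
    ∃ u ∈ N, ∃ i, IsUnit (algebraMap R (Localization.AtPrime m) (u i)) := by
  by_contra! h
  refine Ideal.IsPrime.ne_top ‹_› (top_unique (hN.unimodular.symm.le.trans (Ideal.span_le.2 ?_)))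
  rintro _ ⟨u, hu, i, rfl⟩
  by_contra hm
  exact h u hu i (IsLocalization.map_units (M := m.primeCompl) _ ⟨u i, hm⟩)

end IsLine

variable {deg : Fin r → ℕ} (hf : ∀ j, (f j).IsHomogeneous (deg j))

theorem point_map_eq (φ : R →ₐ[k] R') {v : Fin (n + 1) → R} (hv : IsZero f v) (l : Fin (n + 1))
    (hl : IsUnit (v l)) {w : Fin (n + 1) → R'} (hw : IsZero f w) (hl' : IsUnit (w l))
    (h : ∀ i, φ (v i) = w i) : (point hf hv l hl).map φ = point hf hw l hl' := by
  obtain rfl : w = fun i => φ (v i) := funext fun i => (h i).symm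
  exact point_map hf φ hv l hl

theorem isUnit_toAway (a : R) : IsUnit (AlgPoint.toAway k a a) :=
  IsLocalization.Away.algebraMap_isUnit a

theorem exists_toAway_lift (φ : R →ₐ[k] R') (a : R) (ha : IsUnit (φ a)) :
    ∃ χ : Localization.Away a →ₐ[k] R', χ.comp (AlgPoint.toAway k a) = φ :=
  ⟨IsLocalization.Away.liftAlgHom (f := φ) a ha, AlgHom.ext fun x =>
    IsLocalization.Away.lift_eq (g := (φ : R →+* R')) a ha x⟩

/-- The point `g` has homogeneous coordinates in the line `N`. -/
def Classifies (g : AlgPoint (structureMap f hf) R) (N : Submodule R (Fin (n + 1) → R)) : Prop :=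
  ∀ (R' : Type u) [CommRing R'] [Algebra k R'] (φ : R →ₐ[k] R'), ∀ u ∈ N,
    ∀ (hu : IsZero f fun i => φ (u i)) (l : Fin (n + 1)) (hl : IsUnit (φ (u l))),
      g.map φ = point hf hu l hl

theorem span_range_coords {N : Submodule R (Fin (n + 1) → R)} (hN : IsLine f N) :
    Ideal.span (Set.range fun p : N × ULift.{u} (Fin (n + 1)) => (p.1 : Fin (n + 1) → R) p.2.down)
      = ⊤ := by
  rw [← hN.unimodular]
  congr 1
  ext c
  constructor
  · rintro ⟨⟨u, i⟩, rfl⟩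
    exact ⟨u.1, u.2, i.down, rfl⟩
  · rintro ⟨u, hu, i, rfl⟩
    exact ⟨⟨⟨u, hu⟩, ⟨i⟩⟩, rfl⟩

/-- The loci where a coordinate `u i` of some `u ∈ N` is invertible cover `Spec R`. On each of them
`u` itself serves as homogeneous coordinates, and the vanishing minors make these points agree on
overlaps. -/
theorem exists_classifies {N : Submodule R (Fin (n + 1) → R)} (hN : IsLine f N) :
    ∃ g : AlgPoint (structureMap f hf) R, Classifies hf g N := by
  let a : N × ULift.{u} (Fin (n + 1)) → R := fun p => (p.1 : Fin (n + 1) → R) p.2.down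
  have hz : ∀ p : N × ULift.{u} (Fin (n + 1)),
      IsZero f fun i => AlgPoint.toAway k (a p) ((p.1 : Fin (n + 1) → R) i) :=
    fun p => (hN.isZero _ p.1.2).map_ringHom _
  obtain ⟨g, hg⟩ := AlgPoint.exists_glue (s := structureMap f hf) a (span_range_coords hN)
    (fun p => point hf (hz p) p.2.down (isUnit_toAway (a p))) (by
      intro p q T _ _ φ ψ h
      refine (point_map hf φ (hz p) _ _).trans
        (Eq.trans (point_eq hf _ _ _ _ fun i j => ?_) (point_map hf ψ (hz q) _ _).symm)
      have e : ∀ x, φ (AlgPoint.toAway k (a p) x) = ψ (AlgPoint.toAway k (a q) x) :=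
        fun x => DFunLike.congr_fun h x
      rw [e, e, ← map_mul, ← map_mul, ← map_mul, ← map_mul, hN.minors _ p.1.2 _ q.1.2])
  refine ⟨g, fun R' _ _ φ u hu hu' l hl => ?_⟩
  let p : N × ULift.{u} (Fin (n + 1)) := ⟨⟨u, hu⟩, ⟨l⟩⟩
  obtain ⟨ψ, hψ⟩ := exists_toAway_lift φ (a p) hl
  have e : ∀ x, ψ (AlgPoint.toAway k (a p) x) = φ x := fun x => DFunLike.congr_fun hψ x
  calc g.map φ = (g.map (AlgPoint.toAway k (a p))).map ψ := by rw [AlgPoint.map_map, hψ]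
    _ = _ := by
      rw [hg p]
      exact point_map_eq hf ψ (hz p) _ _ hu' hl fun i => e _

theorem Classifies.unique {N : Submodule R (Fin (n + 1) → R)} (hN : IsLine f N)
    {g g' : AlgPoint (structureMap f hf) R} (h : Classifies hf g N) (h' : Classifies hf g' N) :
    g = g' := by
  refine AlgPoint.ext_of_cover _ (span_range_coords hN) fun p => ?_
  have hz := (hN.isZero _ p.1.2).map_ringHom (AlgPoint.toAway k ((p.1 : Fin (n + 1) → R) p.2.down))
  rw [h _ _ p.1.1 p.1.2 hz p.2.down (isUnit_toAway _),
    h' _ _ p.1.1 p.1.2 hz p.2.down (isUnit_toAway _)]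

/-- The extended line has more elements than the images of those of `N`, so the property is not
directly inherited. Instead the image of `g` is compared with a point that classifies the extended
line, on the cover by the images of the coordinates of `N`, where both are given by the same
vectors. -/
theorem Classifies.map {N : Submodule R (Fin (n + 1) → R)} (hN : IsLine f N)
    {g : AlgPoint (structureMap f hf) R} (h : Classifies hf g N) (φ : R →ₐ[k] R') :
    Classifies hf (g.map φ) (Submodule.span R' {v | ∃ u ∈ N, v = fun i => φ (u i)}) := by
  have hN' := hN.baseChange hf φ
  obtain ⟨g', hg'⟩ := exists_classifies hf hN'
  suffices g.map φ = g' by rwa [this]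
  refine AlgPoint.ext_of_cover
    (fun p : N × ULift.{u} (Fin (n + 1)) => φ ((p.1 : Fin (n + 1) → R) p.2.down)) ?_ fun p => ?_
  · refine Eq.trans ?_ (hN.span_coords φ)
    congr 1
    ext c
    constructor
    · rintro ⟨⟨u, i⟩, rfl⟩
      exact ⟨u.1, u.2, i.down, rfl⟩
    · rintro ⟨u, hu, i, rfl⟩
      exact ⟨⟨⟨u, hu⟩, ⟨i⟩⟩, rfl⟩
  · let ψ := AlgPoint.toAway k (φ ((p.1 : Fin (n + 1) → R) p.2.down))
    have hz := ((hN.isZero _ p.1.2).map_ringHom φ).map_ringHom ψ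
    have hu := isUnit_toAway (k := k) (φ ((p.1 : Fin (n + 1) → R) p.2.down))
    rw [AlgPoint.map_map, h _ (ψ.comp φ) p.1.1 p.1.2 hz p.2.down hu]
    exact (hg' _ ψ _ (Submodule.subset_span ⟨_, p.1.2, rfl⟩) hz p.2.down hu).symm

theorem proportional_trans {u v w : Fin (n + 1) → R} {l : Fin (n + 1)} (hl : IsUnit (w l))
    (h : ∀ i j, u i * w j = u j * w i) (h' : ∀ i j, v i * w j = v j * w i) (i j : Fin (n + 1)) :
    u i * v j = u j * v i := by
  refine (hl.mul hl).mul_left_cancel ?_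
  linear_combination (w l * v j) * h i l + (u l * w i) * h' j l - (w l * v i) * h j l
    - (u l * w j) * h' i l

/-- The minors between the two lines vanish because they do so in the local rings: there each line
has an element with a unit coordinate, and the equality of points makes these two elements
proportional. -/
theorem Classifies.line_unique {N N' : Submodule R (Fin (n + 1) → R)} (hN : IsLine f N)
    (hN' : IsLine f N') {g : AlgPoint (structureMap f hf) R} (h : Classifies hf g N)
    (h' : Classifies hf g N') : N = N' := by
  have key : ∀ u ∈ N, ∀ v ∈ N', ∀ i j, u i * v j - u j * v i = 0 := by
    intro u hu v hv i j
    refine eq_zero_of_localization _ fun m hm => ?_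
    let φ : R →ₐ[k] Localization.AtPrime m := IsScalarTower.toAlgHom k R _
    obtain ⟨u₀, hu₀, l, hl⟩ := hN.exists_isUnit_atPrime m
    obtain ⟨v₀, hv₀, l', hl'⟩ := hN'.exists_isUnit_atPrime m
    have e : ∀ i j, φ (u₀ i) * φ (v₀ j) = φ (u₀ j) * φ (v₀ i) :=
      proportional_of_point_eq hf ((hN.isZero u₀ hu₀).map_ringHom φ)
        ((hN'.isZero v₀ hv₀).map_ringHom φ) hl hl' ((h _ φ u₀ hu₀ _ l hl).symm.trans
          (h' _ φ v₀ hv₀ _ l' hl'))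
    have e1 : ∀ i j, φ (u i) * φ (u₀ j) = φ (u j) * φ (u₀ i) := fun i j => by
      rw [← map_mul, hN.minors u hu u₀ hu₀ i j, map_mul]
    have e2 : ∀ i j, φ (v i) * φ (v₀ j) = φ (v j) * φ (v₀ i) := fun i j => by
      rw [← map_mul, hN'.minors v hv v₀ hv₀ i j, map_mul]
    have e3 := proportional_trans (u := fun i => φ (v i)) (v := fun i => φ (u₀ i))
      (w := fun i => φ (v₀ i)) hl' e2 e
    have e4 := proportional_trans (u := fun i => φ (u i)) (v := fun i => φ (v i))
      (w := fun i => φ (u₀ i)) hl e1 e3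
    change φ _ = 0
    rw [map_sub, map_mul, map_mul, e4 i j, sub_self]
  refine hN.eq_of_le hN' fun u hu => hN'.mem_of_minors fun v hv i j => ?_
  exact sub_eq_zero.1 (key u hu v hv i j)

theorem exists_line (g : AlgPoint (structureMap f hf) R) :
    ∃ N : Submodule R (Fin (n + 1) → R), IsLine f N ∧ Classifies hf g N := by
  obtain ⟨t, ht, hloc⟩ := exists_local_coordinates hf g
  choose v hv l hl hvl hpt using fun a : t => hloc a.1 a.2
  -- The vectors that are proportional, on each piece of the cover, to the local coordinates `v a`
  -- of the point.
  let N : Submodule R (Fin (n + 1) → R) :=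
    { carrier := {u | ∀ (a : t) i j, AlgPoint.toAway k a.1 (u i) * v a j =
        AlgPoint.toAway k a.1 (u j) * v a i}
      add_mem' := fun {x y} hx hy a i j => by
        simp only [Pi.add_apply, map_add, add_mul, hx a i j, hy a i j]
      zero_mem' := fun a i j => by simp
      smul_mem' := fun c x hx a i j => by
        simp only [Pi.smul_apply, smul_eq_mul, map_mul, mul_assoc, hx a i j] }
  have hclass : Classifies hf g N := by
    intro R' _ _ φ u hu hu' l' hl'
    refine AlgPoint.ext_of_cover (fun a : t => φ a.1) ?_ fun a => ?_
    · have h2 := Ideal.map_span (φ : R →+* R') (t : Set R)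
      rw [ht, Ideal.map_top] at h2
      rw [h2]
      congr 1
      ext c
      constructor
      · rintro ⟨a, rfl⟩
        exact ⟨a.1, a.2, rfl⟩
      · rintro ⟨a, ha, rfl⟩
        exact ⟨⟨a, ha⟩, rfl⟩
    · let ψ := AlgPoint.toAway k (φ a.1)
      obtain ⟨χ, hχ⟩ := exists_toAway_lift (ψ.comp φ) a.1 (isUnit_toAway (k := k) (φ a.1))
      have e : ∀ x, χ (AlgPoint.toAway k a.1 x) = ψ (φ x) := fun x => DFunLike.congr_fun hχ x
      rw [AlgPoint.map_map, ← hχ, ← AlgPoint.map_map, hpt a, point_map, point_map]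
      refine point_eq hf _ _ _ _ fun i j => ?_
      have h3 := congrArg χ (hu a j i)
      rw [map_mul, map_mul, e, e] at h3
      rw [mul_comm, h3, mul_comm]
  refine ⟨N, ⟨?_, ?_, ?_⟩, hclass⟩
  · intro u hu w hw i j
    refine sub_eq_zero.1 (eq_zero_of_forall_away ht fun a ha => ?_)
    have := proportional_trans (u := fun i => AlgPoint.toAway k a (u i))
      (v := fun i => AlgPoint.toAway k a (w i)) (hl ⟨a, ha⟩) (hu ⟨a, ha⟩) (hw ⟨a, ha⟩) i j
    change AlgPoint.toAway k a _ = 0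
    rw [map_sub, map_mul, map_mul, this, sub_self]
  · by_contra hne
    obtain ⟨m, hm, hle⟩ := Ideal.exists_le_maximal _ hne
    refine hm.ne_top (top_unique (ht.symm.le.trans (Ideal.span_le.2 fun a ha => ?_)))
    -- To show that `a` lies in `m`, the local coordinates `v a` are made into an element of `N`.
    -- First the denominators are cleared: `w` represents `a ^ K • v a`.
    obtain ⟨⟨_, K, rfl⟩, hb⟩ := IsLocalization.exist_integer_multiples_of_finite
      (Submonoid.powers a) (v ⟨a, ha⟩)
    choose w hw using hb
    have hw' : ∀ i, AlgPoint.toAway k a (w i) = AlgPoint.toAway k a a ^ K * v ⟨a, ha⟩ i := by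
      intro i
      refine (hw i).trans ?_
      change a ^ K • v ⟨a, ha⟩ i = _
      rw [Algebra.smul_def, map_pow]
      rfl
    -- Where `a` and `b` are both inverted, `v a` and `v b` describe the same point, so `w` is
    -- proportional to `v b` there. Over the piece of `b` this holds up to a power of `a`.
    have key : ∀ (b : t) (i j : Fin (n + 1)), ∃ L : ℕ, AlgPoint.toAway k b.1 a ^ L *
        (AlgPoint.toAway k b.1 (w i) * v b j - AlgPoint.toAway k b.1 (w j) * v b i) = 0 := by
      intro b i j
      let ψ := AlgPoint.toAway k (AlgPoint.toAway k b.1 a)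
      obtain ⟨χ, hχ⟩ := exists_toAway_lift (ψ.comp (AlgPoint.toAway k b.1)) a
        (isUnit_toAway (k := k) (AlgPoint.toAway k b.1 a))
      have e : ∀ x, χ (AlgPoint.toAway k a x) = ψ (AlgPoint.toAway k b.1 x) :=
        fun x => DFunLike.congr_fun hχ x
      have hp := congrArg (AlgPoint.map χ) (hpt ⟨a, ha⟩)
      have hp' := congrArg (AlgPoint.map ψ) (hpt b)
      rw [AlgPoint.map_map, hχ, ← AlgPoint.map_map, hp', point_map, point_map] at hp
      have hprop := proportional_of_point_eq hf _ _ _ _ hp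
      have h0 : ψ (AlgPoint.toAway k b.1 (w i) * v b j - AlgPoint.toAway k b.1 (w j) * v b i) = 0 := by
        rw [map_sub, map_mul, map_mul, ← e, ← e, hw', hw', map_mul, map_mul]
        linear_combination (-(χ (AlgPoint.toAway k a a ^ K))) * hprop i j
      obtain ⟨⟨_, L, rfl⟩, hL⟩ := (IsLocalization.map_eq_zero_iff
        (Submonoid.powers (AlgPoint.toAway k b.1 a)) _ _).1 h0
      exact ⟨L, hL⟩
    choose L hL using key
    -- A sum is a uniform bound for these finitely many exponents.
    let L₀ := ∑ b : t, ∑ i, ∑ j, L b i j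
    have hle' : ∀ b i j, L b i j ≤ L₀ := fun b i j =>
      (Finset.single_le_sum (f := fun j => L b i j) (fun _ _ => Nat.zero_le _)
        (Finset.mem_univ j)).trans
      ((Finset.single_le_sum (f := fun i => ∑ j, L b i j) (fun _ _ => Nat.zero_le _)
        (Finset.mem_univ i)).trans
      (Finset.single_le_sum (f := fun b => ∑ i, ∑ j, L b i j) (fun _ _ => Nat.zero_le _)
        (Finset.mem_univ b)))
    have hmem : (a ^ L₀ • w) ∈ N := by
      intro b i j
      have h1 := hL b i j
      obtain ⟨q, hq⟩ := Nat.exists_eq_add_of_le (hle' b i j)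
      simp only [Pi.smul_apply, smul_eq_mul, map_mul, map_pow]
      rw [hq, pow_add]
      linear_combination (AlgPoint.toAway k b.1 a ^ q) * h1
    have hcoord := hle (Ideal.subset_span ⟨_, hmem, l ⟨a, ha⟩, rfl⟩)
    have h2 : AlgPoint.toAway k a (w (l ⟨a, ha⟩) - a ^ K) = 0 := by
      rw [map_sub, hw', hvl, mul_one, map_pow, sub_self]
    obtain ⟨⟨_, P, rfl⟩, hP⟩ := (IsLocalization.map_eq_zero_iff (Submonoid.powers a) _ _).1 h2
    -- Since `v a` has coordinate `1` at its index `l`, the coordinate of `w` there is `a ^ K` up to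
    -- torsion killed by `a ^ P`. So a power of `a` is a multiple of a coordinate of an element of
    -- `N`, and lies in `m`.
    have h3 : a ^ (P + L₀ + K) = a ^ P * ((a ^ L₀ • w) (l ⟨a, ha⟩)) := by
      simp only [Pi.smul_apply, smul_eq_mul, pow_add] at hP ⊢
      linear_combination (-(a ^ L₀)) * hP
    exact hm.isPrime.mem_of_pow_mem (P + L₀ + K) (h3 ▸ m.mul_mem_left _ hcoord)
  · intro u hu j
    refine eq_zero_of_forall_away ht fun a ha => ?_
    obtain ⟨c, hc⟩ := (hl ⟨a, ha⟩).exists_left_inv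
    have hu' : (fun i => AlgPoint.toAway k a (u i)) = fun i =>
        (c * AlgPoint.toAway k a (u (l ⟨a, ha⟩))) * v ⟨a, ha⟩ i := by
      funext i
      have := hu ⟨a, ha⟩ i (l ⟨a, ha⟩)
      linear_combination (-(AlgPoint.toAway k a (u i))) * hc + c * this
    change AlgPoint.toAway k a (aeval u (f j)) = 0
    rw [← AlgHom.comp_apply, comp_aeval, hu', (hf j).aeval_mul_left, hv ⟨a, ha⟩ j, mul_zero]

end ProjEquations

/-! ### Rank one summands -/

namespace Module

variable {R L : Type*} [CommRing R] [AddCommGroup L] [Module R L]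

/-- The commutation rule gives `l w • t = contract t • (l ⊗ w)` for every tensor `t`. So a tensor
with zero contraction is killed by all values `l w`, hence is zero; surjectivity of the contraction
is the span condition. -/
theorem Invertible.of_functionals (Λ : Set (Module.Dual R L))
    (hcomm : ∀ l ∈ Λ, ∀ x y, l x • y = l y • x)
    (hspan : Ideal.span {c | ∃ l ∈ Λ, ∃ x, l x = c} = ⊤) : Module.Invertible R L := by
  have key : ∀ l ∈ Λ, ∀ w, ∀ t : Module.Dual R L ⊗[R] L,
      l w • t = contractLeft R L t • (l ⊗ₜ[R] w) := by
    intro l hl w t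
    induction t with
    | zero => simp
    | add x y hx hy => rw [smul_add, hx, hy, map_add, add_smul]
    | tmul m y =>
      have h : l y • m = m y • l := by
        ext z
        have := congrArg m (hcomm l hl y z)
        simp only [map_smul, smul_eq_mul] at this
        simp only [LinearMap.smul_apply, smul_eq_mul]
        rw [this, mul_comm]
      rw [contractLeft_apply, ← TensorProduct.tmul_smul, hcomm l hl w y, ← TensorProduct.smul_tmul,
        h, TensorProduct.smul_tmul']
  refine ⟨⟨?_, ?_⟩⟩
  · rw [injective_iff_map_eq_zero]
    intro t ht
    suffices h : ∀ c ∈ Ideal.span {c | ∃ l ∈ Λ, ∃ x, l x = c}, c • t = 0 by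
      simpa using h 1 (hspan ▸ Submodule.mem_top)
    intro c hc
    induction hc using Submodule.span_induction with
    | mem c hc =>
      obtain ⟨l, hl, w, rfl⟩ := hc
      rw [key l hl, ht, zero_smul]
    | zero => simp
    | add x y _ _ hx hy => rw [add_smul, hx, hy, add_zero]
    | smul a x _ hx => rw [smul_assoc, hx, smul_zero]
  · rw [← LinearMap.range_eq_top]
    refine top_unique (hspan.symm.le.trans (Ideal.span_le.2 ?_))
    rintro _ ⟨l, _, x, rfl⟩
    exact ⟨l ⊗ₜ x, contractLeft_apply _ _⟩

theorem Invertible.dual_smul_comm [Module.Invertible R L] (l : Module.Dual R L) (x y : L) :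
    l x • y = l y • x := by
  have h := congrArg ((TensorProduct.lid R L).toLinearMap ∘ₗ l.rTensor L)
    (Module.Invertible.tmul_comm (R := R) (m₁ := x) (m₂ := y))
  simpa using h

theorem Invertible.span_dual_apply [Module.Invertible R L] :
    Ideal.span {c | ∃ (l : Module.Dual R L) (x : L), l x = c} = ⊤ := by
  refine top_unique fun c _ => ?_
  obtain ⟨t, rfl⟩ := (Module.Invertible.bijective (R := R) (M := L)).2 c
  induction t with
  | zero => simp
  | add x y hx hy => rw [map_add]; exact add_mem (hx trivial) (hy trivial)
  | tmul m y => exact Ideal.subset_span ⟨m, y, (contractLeft_apply _ _).symm⟩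

theorem Invertible.rankAtStalk_eq_one [Module.Invertible R L] (p : PrimeSpectrum R) :
    Module.rankAtStalk (R := R) L p = 1 :=
  Module.Invertible.finrank_eq_one _ _

/-- A dual basis of a finitely generated projective module. -/
theorem exists_dual_basis [Module.Finite R L] [Module.Projective R L] :
    ∃ (m : ℕ) (l : Fin m → Module.Dual R L) (b : Fin m → L), ∀ x, ∑ i, l i x • b i = x := by
  obtain ⟨m, g, hg⟩ := Module.Finite.exists_fin' R L
  obtain ⟨s, hs⟩ := LinearMap.exists_rightInverse_of_surjective g (LinearMap.range_eq_top.2 hg)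
  refine ⟨m, fun i => LinearMap.proj (R := R) (φ := fun _ : Fin m => R) i ∘ₗ s, fun i => g (Pi.single i 1), fun x => ?_⟩
  have := DFunLike.congr_fun hs x
  rw [LinearMap.comp_apply, LinearMap.id_apply, pi_eq_sum_univ' (R := R) (s x), map_sum] at this
  simpa [← Pi.single_apply] using this

/-- Commutation can be tested in the localizations at maximal ideals, where the module is free of
rank one. -/
theorem Invertible.of_rankAtStalk_eq_one [Module.Finite R L] [Module.Projective R L]
    (h : ∀ p : PrimeSpectrum R, Module.rankAtStalk (R := R) L p = 1) : Module.Invertible R L := by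
  refine Invertible.of_functionals Set.univ ?_ ?_
  · intro l _ x y
    refine Module.eq_of_localization_maximal
      (fun (P : Ideal R) _ => LocalizedModule P.primeCompl L)
      (fun (P : Ideal R) _ => LocalizedModule.mkLinearMap P.primeCompl L)
      _ _ fun P hP => ?_
    have hr := h ⟨P, hP.isPrime⟩
    unfold Module.rankAtStalk at hr
    have : Module.Free (Localization.AtPrime P) (LocalizedModule P.primeCompl L) :=
      Module.free_of_flat_of_isLocalRing
    obtain ⟨v, -, hv⟩ := finrank_eq_one_iff'.1 hr
    let ι := LocalizedModule.mkLinearMap P.primeCompl L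
    let l' : LocalizedModule P.primeCompl L →ₗ[Localization.AtPrime P] Localization.AtPrime P :=
      (IsLocalizedModule.map P.primeCompl ι (Algebra.linearMap R (Localization.AtPrime P)) l
        ).extendScalarsOfIsLocalization P.primeCompl _
    have hl' : ∀ z, l' (ι z) = algebraMap R _ (l z) := fun z =>
      IsLocalizedModule.map_apply P.primeCompl ι (Algebra.linearMap R (Localization.AtPrime P)) l z
    obtain ⟨a, ha⟩ := hv (ι x)
    obtain ⟨b, hb⟩ := hv (ι y)
    have e : l' (ι x) • ι y = l' (ι y) • ι x := by
      rw [← ha, ← hb, map_smul, map_smul, smul_smul, smul_smul, smul_eq_mul, smul_eq_mul]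
      congr 1
      ring
    rw [hl', hl', algebraMap_smul, algebraMap_smul] at e
    rw [map_smul, map_smul]
    exact e
  · by_contra hne
    obtain ⟨P, hP, hle⟩ := Ideal.exists_le_maximal _ hne
    have hr := h ⟨P, hP.isPrime⟩
    obtain ⟨m, l, b, hb⟩ := exists_dual_basis (R := R) (L := L)
    -- If all functionals had values in `P`, the dual basis would give `P L = L`. Nakayama's lemma
    -- then kills the localization at `P`, contradicting rank one.
    have hsub : P • (⊤ : Submodule R L) = ⊤ := by
      refine top_unique fun x _ => ?_
      rw [← hb x]
      exact Submodule.sum_mem _ fun i _ => Submodule.smul_mem_smul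
        (hle (Ideal.subset_span ⟨l i, trivial, x, rfl⟩)) trivial
    obtain ⟨c, hc, hc0⟩ := Submodule.exists_sub_one_mem_and_smul_eq_zero_of_fg_of_le_smul P
      (⊤ : Submodule R L) Module.Finite.fg_top hsub.ge
    have hcP : c ∉ P := fun hcm => hP.ne_top ((Ideal.eq_top_iff_one _).2 (by
      simpa using P.sub_mem hcm hc))
    have : Subsingleton (LocalizedModule P.primeCompl L) := by
      rw [LocalizedModule.subsingleton_iff]
      exact fun z => ⟨c, hcP, hc0 z trivial⟩
    unfold Module.rankAtStalk at hr
    rw [Module.finrank_zero_of_subsingleton] at hr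
    exact zero_ne_one hr

variable {F : Type*} [AddCommGroup F] [Module R F]

/-- The image of the projection `E` is a line bundle, expressed in terms of functionals. -/
structure IsRankOneOn (E : Module.End R F) : Prop where
  comm : ∀ (l : Module.Dual R F) (x y : F), l (E x) • E y = l (E y) • E x
  span : Ideal.span {c | ∃ (l : Module.Dual R F) (x : F), l (E x) = c} = ⊤

theorem isRankOneOn_iff_invertible {E : Module.End R F} (hE : E * E = E) :
    IsRankOneOn E ↔ Module.Invertible R (LinearMap.range E) := by
  have hEE : ∀ x, E (E x) = E x := fun x => DFunLike.congr_fun hE x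
  constructor
  · intro h
    refine Invertible.of_functionals
      (Set.range fun l : Module.Dual R F => l ∘ₗ (LinearMap.range E).subtype) ?_ ?_
    · rintro _ ⟨l, rfl⟩ ⟨_, x, rfl⟩ ⟨_, y, rfl⟩
      exact Subtype.ext (h.comm l x y)
    · refine top_unique (h.span.symm.le.trans (Ideal.span_mono ?_))
      rintro _ ⟨l, x, rfl⟩
      exact ⟨_, ⟨l, rfl⟩, ⟨E x, x, rfl⟩, rfl⟩
  · intro h
    constructor
    · intro l x y
      exact congrArg Subtype.val (Invertible.dual_smul_comm (R := R) (L := LinearMap.range E)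
        (l ∘ₗ (LinearMap.range E).subtype) ⟨E x, x, rfl⟩ ⟨E y, y, rfl⟩)
    · refine top_unique ((Invertible.span_dual_apply (R := R) (L := LinearMap.range E)).symm.le.trans
        (Ideal.span_mono ?_))
      rintro _ ⟨l, ⟨_, x, rfl⟩, rfl⟩
      refine ⟨l ∘ₗ E.rangeRestrict, E x, ?_⟩
      rw [LinearMap.comp_apply]
      congr 1
      exact Subtype.ext (by simp [hEE])

theorem isRankOneOn_iff_rankAtStalk [Module.Finite R F] [Module.Projective R F]
    {E : Module.End R F} (hE : E * E = E) :
    IsRankOneOn E ↔ ∀ p, Module.rankAtStalk (R := R) (LinearMap.range E) p = 1 := by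
  rw [isRankOneOn_iff_invertible hE]
  have hp : Module.Projective R (LinearMap.range E) :=
    Module.Projective.of_split (LinearMap.range E).subtype E.rangeRestrict (by
      ext ⟨_, x, rfl⟩
      exact DFunLike.congr_fun hE x)
  exact ⟨fun _ => Invertible.rankAtStalk_eq_one, Invertible.of_rankAtStalk_eq_one⟩

namespace IsRankOneOn

variable {E : Module.End R F}

theorem tmul_comm (hE : E * E = E) (h : IsRankOneOn E) (x y : F) :
    E x ⊗ₜ[R] E y = E y ⊗ₜ[R] E x := by
  have := (isRankOneOn_iff_invertible hE).1 h
  have h1 := congrArg (TensorProduct.map (LinearMap.range E).subtype (LinearMap.range E).subtype)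
    (Module.Invertible.tmul_comm (R := R) (M := LinearMap.range E)
      (m₁ := ⟨E x, x, rfl⟩) (m₂ := ⟨E y, y, rfl⟩))
  simpa using h1

theorem eq_zero_of_smul (h : IsRankOneOn E) {c : R} (hc : ∀ x, c • E x = 0) : c = 0 := by
  have : ∀ a ∈ Ideal.span {c | ∃ (l : Module.Dual R F) (x : F), l (E x) = c}, a * c = 0 := by
    intro a ha
    induction ha using Submodule.span_induction with
    | mem a ha =>
      obtain ⟨l, x, rfl⟩ := ha
      rw [mul_comm, ← smul_eq_mul, ← map_smul, hc, map_zero]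
    | zero => simp
    | add x y _ _ hx hy => rw [add_mul, hx, hy, add_zero]
    | smul a x _ hx => rw [smul_eq_mul, mul_assoc, hx, mul_zero]
  simpa using this 1 (h.span ▸ Submodule.mem_top)

/-- A functional on `R' ⊗ F` need not come from `F`, so commutation is not inherited directly. The
symmetry `E x ⊗ E y = E y ⊗ E x` does not mention functionals, and `β` turns it into the required
identity. -/
theorem baseChange (hE : E * E = E) (h : IsRankOneOn E) (R' : Type*) [CommRing R'] [Algebra R R'] :
    IsRankOneOn (E.baseChange R') := by
  constructor
  · intro l x y
    let β : F ⊗[R] F →ₗ[R] R' ⊗[R] F :=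
      TensorProduct.map (l.restrictScalars R ∘ₗ TensorProduct.mk R R' F 1) LinearMap.id
    have hβ : ∀ a b, β (a ⊗ₜ b) = l (1 ⊗ₜ a) • ((1 : R') ⊗ₜ[R] b) := fun a b => by
      simp [β, TensorProduct.smul_tmul']
    induction x with
    | zero => simp
    | add x x' hx hx' => simp only [map_add, add_smul, smul_add, hx, hx']
    | tmul s a =>
      induction y with
      | zero => simp
      | add y y' hy hy' => simp only [map_add, add_smul, smul_add, hy, hy']
      | tmul t b =>
        have h1 := congrArg β (h.tmul_comm hE a b)
        rw [hβ, hβ] at h1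
        have e : ∀ (s : R') (a : F), s ⊗ₜ[R] a = s • ((1 : R') ⊗ₜ[R] a) := fun s a => by
          rw [TensorProduct.smul_tmul', smul_eq_mul, mul_one]
        rw [LinearMap.baseChange_tmul, LinearMap.baseChange_tmul, e s, e t, map_smul, map_smul,
          smul_eq_mul, smul_eq_mul, smul_smul, smul_smul, mul_right_comm, mul_smul, h1,
          smul_smul]
        congr 1
        ring
  · refine (Ideal.eq_top_iff_one _).2 ?_
    have h1 : (1 : R) ∈ Ideal.span {c | ∃ (l : Module.Dual R F) (x : F), l (E x) = c} := by
      rw [h.span]; exact Submodule.mem_top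
    have h2 := Ideal.mem_map_of_mem (algebraMap R R') h1
    rw [map_one, Ideal.map_span] at h2
    refine Ideal.span_mono ?_ h2
    rintro _ ⟨_, ⟨l, x, rfl⟩, rfl⟩
    refine ⟨Module.Dual.baseChange R' l, 1 ⊗ₜ x, ?_⟩
    simp [Algebra.algebraMap_eq_smul_one]

end IsRankOneOn

end Module

/-! ### Checking membership and equality on generators of the unit ideal -/

theorem Submodule.smul_mem_induction {R M : Type*} [CommRing R] [AddCommGroup M] [Module R M]
    {S : Set R} (hS : Ideal.span S = ⊤) (P : Submodule R M) {x : M} (h : ∀ c ∈ S, c • x ∈ P) :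
    x ∈ P := by
  suffices h : ∀ c ∈ Ideal.span S, c • x ∈ P by
    simpa using h 1 (hS ▸ Submodule.mem_top)
  intro c hc
  induction hc using Submodule.span_induction with
  | mem c hc => exact h c hc
  | zero => simp
  | add x y _ _ hx hy => rw [add_smul]; exact P.add_mem hx hy
  | smul a x _ hx => rw [smul_assoc]; exact P.smul_mem _ hx

theorem eq_of_forall_smul_eq {R M : Type*} [CommRing R] [AddCommGroup M] [Module R M]
    {S : Set R} (hS : Ideal.span S = ⊤) {x y : M} (h : ∀ c ∈ S, c • x = c • y) : x = y := by
  have := Submodule.smul_mem_induction hS (⊥ : Submodule R M) (x := x - y) fun c hc => by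
    rw [smul_sub, h c hc, sub_self]; exact Submodule.zero_mem _
  exact sub_eq_zero.1 ((Submodule.mem_bot R).1 this)

/-! ### Representations of the Beilinson quiver in families -/

/-- A representation of the Beilinson quiver with commutativity relations over a commutative
ring, given by the projections `E a` to the vertices and the total actions `X i` of the
variables. -/
@[ext]
structure BeilinsonAction (R : Type u) [CommRing R] (F : Type u) [AddCommGroup F] [Module R F]
    (n d : ℕ) where
  E : ℕ → Module.End R F
  X : Fin (n + 1) → Module.End R F
  idem : ∀ a x, E a (E a x) = E a x
  orth : ∀ a b, a ≠ b → ∀ x, E a (E b x) = 0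
  eq_zero : ∀ a, d < a → E a = 0
  sum : ∀ x, ∑ a ∈ Finset.range (d + 1), E a x = x
  shift : ∀ i a x, X i (E a x) = E (a + 1) (X i x)
  comm : ∀ i j x, X i (X j x) = X j (X i x)

namespace BeilinsonAction

variable {R : Type u} [CommRing R] {F F' : Type u} [AddCommGroup F] [Module R F] [AddCommGroup F']
  [Module R F'] {n d : ℕ}

/-- The action of a path on a representation. -/
def pathAct (A : BeilinsonAction R F n d) : (m : ℕ) → (Fin m → Fin (n + 1)) → Module.End R F
  | 0, _ => 1
  | m + 1, w => A.X (w (Fin.last m)) * A.pathAct m (fun i => w i.castSucc)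

theorem pathAct_succ (A : BeilinsonAction R F n d) {m : ℕ} (w : Fin (m + 1) → Fin (n + 1)) (x : F) :
    A.pathAct (m + 1) w x = A.X (w (Fin.last m)) (A.pathAct m (fun i => w i.castSucc) x) := rfl

/-- The conditions on a representation to be a family of indecomposable representations of
dimension vector `(1, …, 1)`. -/
structure IsGood (A : BeilinsonAction R F n d) : Prop where
  finite : Module.Finite R F
  projective : Module.Projective R F
  rankOne : ∀ a ≤ d, Module.IsRankOneOn (A.E a)
  gen : ∀ a < d, Ideal.span {c | ∃ (l : Module.Dual R F) (i : Fin (n + 1)) (x : F),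
    l (A.X i (A.E a x)) = c} = ⊤

/-- The line subbundle of the trivial bundle given by the ratios of the arrows. -/
def line (A : BeilinsonAction R F n d) : Submodule R (Fin (n + 1) → R) where
  carrier := {u | ∀ i j x, u i • A.X j (A.E 0 x) = u j • A.X i (A.E 0 x)}
  add_mem' {u v} hu hv i j x := by simp only [Pi.add_apply, add_smul, hu i j x, hv i j x]
  zero_mem' i j x := by simp
  smul_mem' c u hu i j x := by simp only [Pi.smul_apply, smul_assoc, hu i j x]

variable {A : BeilinsonAction R F n d} {A' : BeilinsonAction R F' n d}

/-- By rank one at `a + 1`, the generator `l (X i (E a x))` times `E (a + 1) y` is a multiple of `X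
i (E a x)`. So each vertex is generated by the previous one, and all by vertex `0`. -/
theorem gen_mem (hA : A.IsGood) {a : ℕ} (ha : a < d) (P : Submodule R F)
    (hP : ∀ i x, A.X i (A.E a x) ∈ P) (y : F) : A.E (a + 1) y ∈ P := by
  refine Submodule.smul_mem_induction (hA.gen a ha) P ?_
  rintro _ ⟨l, i, x, rfl⟩
  rw [A.shift, (hA.rankOne (a + 1) ha).comm, ← A.shift]
  exact P.smul_mem _ (hP i x)

theorem level_induction (hA : A.IsGood) (P : Submodule R F) (h0 : ∀ x, A.E 0 x ∈ P)
    (h1 : ∀ a < d, (∀ x, A.E a x ∈ P) → ∀ i x, A.X i (A.E a x) ∈ P) (x : F) : x ∈ P := by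
  have h : ∀ a, a ≤ d → ∀ x, A.E a x ∈ P := by
    intro a
    induction a with
    | zero => exact fun _ => h0
    | succ a ih => exact fun ha x => gen_mem hA ha P (h1 a ha (ih (Nat.le_of_succ_le ha))) x
  rw [← A.sum x]
  exact P.sum_mem fun a ha => h a (Nat.lt_succ_iff.1 (Finset.mem_range.1 ha)) x

/-- The line is defined by the arrows out of vertex `0` only. Its equations commute with every
variable, and vertex `0` generates, so they hold everywhere. -/
theorem mem_line_iff (hA : A.IsGood) {u : Fin (n + 1) → R} :
    u ∈ A.line ↔ ∀ i j x, u i • A.X j x = u j • A.X i x := by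
  refine ⟨fun hu i j x => ?_, fun hu i j x => hu i j _⟩
  let P : Submodule R F := LinearMap.ker (u i • A.X j - u j • A.X i)
  have hmem : ∀ {y}, y ∈ P ↔ u i • A.X j y = u j • A.X i y := fun {y} => by
    rw [LinearMap.mem_ker, LinearMap.sub_apply, LinearMap.smul_apply, LinearMap.smul_apply,
      sub_eq_zero]
  rw [← hmem]
  refine level_induction hA P (fun x => hmem.2 (hu i j x)) (fun a _ h l y => hmem.2 ?_) x
  rw [A.comm j l, A.comm i l, ← map_smul (A.X l), ← map_smul (A.X l), hmem.1 (h y)]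

theorem eq_zero_of_smul_X (hA : A.IsGood) {a : ℕ} (ha : a < d) {c : R}
    (hc : ∀ i x, c • A.X i (A.E a x) = 0) : c = 0 := by
  refine (hA.rankOne (a + 1) ha).eq_zero_of_smul fun y => ?_
  exact gen_mem hA ha (LinearMap.ker (c • (1 : Module.End R F))) (fun i x => hc i x) y

/-- Applied to `X l (E 0 x)`, both products become `u j * v l` times `X i (E 0 x)`, and the arrows
out of vertex `0` have zero annihilator. -/
theorem line_minors (hd : 1 ≤ d) (hA : A.IsGood) : ∀ u ∈ A.line, ∀ v ∈ A.line, ∀ i j,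
    u i * v j = u j * v i := by
  intro u hu v hv i j
  refine sub_eq_zero.1 (eq_zero_of_smul_X hA hd fun l x => ?_)
  rw [sub_smul, sub_eq_zero, mul_smul, mul_smul, hv j l, smul_comm, hu i j, smul_comm (v l),
    hv i l, smul_comm (u j)]

/-- This exhibits elements of the line. Rank one at `a` moves `x` past `w`, and rank one at `a + 1`
moves the functional from one arrow to the other. -/
theorem functional_comm (hA : A.IsGood) {a : ℕ} (ha : a < d) (l : Module.Dual R F)
    (i j : Fin (n + 1)) (x w : F) :
    l (A.X i (A.E a x)) • A.X j (A.E a w) = l (A.X j (A.E a x)) • A.X i (A.E a w) := by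
  have h1 := (hA.rankOne a ha.le).comm (l ∘ₗ A.X i) x w
  have h2 := congrArg (A.X j) h1
  rw [map_smul, map_smul, LinearMap.comp_apply, LinearMap.comp_apply] at h2
  rw [h2, A.shift i a w, A.shift j a x, (hA.rankOne (a + 1) ha).comm]

theorem functional_zero_mem_line (hd : 1 ≤ d) (hA : A.IsGood) (l : Module.Dual R F) (x : F) :
    (fun i => l (A.X i (A.E 0 x))) ∈ A.line :=
  fun i j w => functional_comm hA hd l i j x w

theorem line_unimodular (hd : 1 ≤ d) (hA : A.IsGood) :
    Ideal.span {c | ∃ u ∈ A.line, ∃ i, u i = c} = ⊤ := by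
  refine top_unique ((hA.gen 0 hd).symm.le.trans (Ideal.span_mono ?_))
  rintro _ ⟨l, i, x, rfl⟩
  exact ⟨_, functional_zero_mem_line hd hA l x, i, rfl⟩

theorem path_mem (hA : A.IsGood) {a : ℕ} (m : ℕ) (ha : a + m ≤ d) (P : Submodule R F)
    (hP : ∀ w x, A.pathAct m w (A.E a x) ∈ P) (y : F) : A.E (a + m) y ∈ P := by
  induction m generalizing P y with
  | zero => exact hP Fin.elim0 y
  | succ m ih =>
    refine gen_mem hA (a := a + m) ha P (fun i x => ?_) y
    refine ih (by omega) (P.comap (A.X i)) (fun w x => ?_) x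
    have := hP (Fin.snoc w i) x
    rw [pathAct_succ] at this
    simpa using this

/-- One letter is exchanged at a time, using that the ratio `u` is valid at every vertex. -/
theorem smul_pathAct (hA : A.IsGood) {u : Fin (n + 1) → R} (hu : u ∈ A.line) (m : ℕ)
    (w w' : Fin m → Fin (n + 1)) (x : F) :
    (∏ i, u (w' i)) • A.pathAct m w x = (∏ i, u (w i)) • A.pathAct m w' x := by
  induction m with
  | zero => simp [pathAct]
  | succ m ih =>
    rw [Fin.prod_univ_castSucc, Fin.prod_univ_castSucc, pathAct_succ, pathAct_succ, mul_comm,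
      mul_smul, ← map_smul (A.X (w (Fin.last m))), ih, map_smul, smul_comm,
      (mem_line_iff hA).1 hu, mul_smul]

section Equations

open MvPolynomial

variable {k : Type u} [Field k] [Algebra k R] {r : ℕ}

/-- The representation satisfies the relations given by the equations. -/
def Satisfies (A : BeilinsonAction R F n d) (f : Fin r → MvPolynomial (Fin (n + 1)) k)
    (deg : Fin r → ℕ) (T : Fin r → Set ℕ) : Prop :=
  ∀ j, ∀ a ∈ T j, a + deg j ≤ d → ∀ c : (Fin (deg j) → Fin (n + 1)) → k,
    BeilinsonQuiver.Represents c (f j) →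
      ∀ x, ∑ w, algebraMap k R (c w) • A.pathAct (deg j) w (A.E a x) = 0

/-- The letters of each monomial are put in some order. -/
theorem exists_represents {m : ℕ} {p : MvPolynomial (Fin (n + 1)) k} (hp : p.IsHomogeneous m) :
    ∃ c : (Fin m → Fin (n + 1)) → k, BeilinsonQuiver.Represents c p := by
  let S : Submodule k (MvPolynomial (Fin (n + 1)) k) := LinearMap.range
    (Fintype.linearCombination k fun w : Fin m → Fin (n + 1) =>
      ∏ i, (MvPolynomial.X (w i) : MvPolynomial (Fin (n + 1)) k))
  suffices h : p ∈ S by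
    obtain ⟨c, hc⟩ := h
    exact ⟨c, hc⟩
  rw [p.as_sum]
  refine S.sum_mem fun s hs => ?_
  have hd : s.degree = m := by
    by_contra hne
    exact (mem_support_iff.1 hs) (hp.coeff_eq_zero hne)
  have h1 : monomial s (coeff s p) = coeff s p • monomial s 1 := by
    rw [smul_monomial, smul_eq_mul, mul_one]
  rw [h1]
  refine S.smul_mem _ ?_
  let L := (Finsupp.toMultiset s).toList
  have hL : L.length = m := by
    rw [Multiset.length_toList, Finsupp.card_toMultiset, ← hd]
    rfl
  subst hL
  refine ⟨Pi.single L.get 1, ?_⟩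
  rw [Fintype.linearCombination_apply_single, one_smul]
  have h2 : ∏ i, (MvPolynomial.X (L.get i) : MvPolynomial (Fin (n + 1)) k) = (L.map MvPolynomial.X).prod := by
    rw [← List.prod_ofFn]
    congr 1
    conv_rhs => rw [← List.ofFn_get L, List.map_ofFn]
    rfl
  rw [h2, ← Multiset.prod_coe, ← Multiset.map_coe, Multiset.coe_toList, Finsupp.toMultiset_apply,
    monomial_eq, C_1, one_mul, Finsupp.sum, ← Multiset.coe_mapAddMonoidHom, map_sum,
    Multiset.prod_sum]
  simp [Multiset.map_nsmul, Multiset.prod_nsmul, Finsupp.prod]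

/-- The value of `f j` at `u` times the path of `w` equals `∏ i, u (w i)` times the relation of `f
j`, which is zero. The paths from `a` generate vertex `a + deg j`, on which scalars act faithfully,
so one starting vertex per equation suffices. -/
theorem line_isZero (hA : A.IsGood) {f : Fin r → MvPolynomial (Fin (n + 1)) k}
    {deg : Fin r → ℕ} (hf : ∀ j, (f j).IsHomogeneous (deg j)) {T : Fin r → Set ℕ}
    (hT : ∀ j, ∃ a ∈ T j, a + deg j ≤ d) (hS : A.Satisfies f deg T) {u : Fin (n + 1) → R}
    (hu : u ∈ A.line) : ProjEquations.IsZero f u := by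
  intro j
  obtain ⟨a, ha, hle⟩ := hT j
  obtain ⟨c, hc⟩ := exists_represents (hf j)
  refine (hA.rankOne (a + deg j) hle).eq_zero_of_smul fun y => ?_
  refine path_mem hA (deg j) hle (LinearMap.ker (aeval u (f j) • (1 : Module.End R F)))
    (fun w x => ?_) y
  change aeval u (f j) • A.pathAct (deg j) w (A.E a x) = 0
  have h1 := congrArg (fun z => (∏ i, u (w i)) • z) (hS j a ha hle c hc x)
  simp only [Finset.smul_sum, smul_zero] at h1
  rw [← h1, ← hc, map_sum, Finset.sum_smul]
  refine Finset.sum_congr rfl fun w' _ => ?_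
  rw [smul_comm, smul_pathAct hA hu, map_smul, map_prod, ← smul_assoc, Algebra.smul_def]
  simp

theorem line_isLine (hd : 1 ≤ d) (hA : A.IsGood) {f : Fin r → MvPolynomial (Fin (n + 1)) k}
    {deg : Fin r → ℕ} (hf : ∀ j, (f j).IsHomogeneous (deg j)) {T : Fin r → Set ℕ}
    (hT : ∀ j, ∃ a ∈ T j, a + deg j ≤ d) (hS : A.Satisfies f deg T) :
    ProjEquations.IsLine f A.line :=
  ⟨line_minors hd hA, line_unimodular hd hA, fun _ hu => line_isZero hA hf hT hS hu⟩

end Equations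

/-- The ratios of the arrows at any vertex `a` are proportional to all elements of the line, and the
line is closed under proportionality because it is unimodular. -/
theorem functional_mem_line (hd : 1 ≤ d) (hA : A.IsGood) (a : ℕ)
    (l : Module.Dual R F) (x : F) : (fun i => l (A.X i (A.E a x))) ∈ A.line := by
  have key : ∀ v ∈ A.line, ∀ i j, l (A.X i (A.E a x)) * v j = l (A.X j (A.E a x)) * v i := by
    intro v hv i j
    have := congrArg l ((mem_line_iff hA).1 hv j i (A.E a x))
    rw [map_smul, map_smul, smul_eq_mul, smul_eq_mul] at this
    rw [mul_comm, this, mul_comm]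
  intro i j y
  refine eq_of_forall_smul_eq (line_unimodular hd hA) ?_
  rintro _ ⟨v, hv, m, rfl⟩
  rw [smul_smul, smul_smul, mul_comm, key v hv i m, mul_comm (v m), key v hv j m, mul_smul, mul_smul,
    (hv i j y)]

/-! ### Homomorphisms -/

/-- The module of homomorphisms between two representations. -/
def hom (A : BeilinsonAction R F n d) (A' : BeilinsonAction R F' n d) :
    Submodule R (F →ₗ[R] F') where
  carrier := {φ | (∀ a x, φ (A.E a x) = A'.E a (φ x)) ∧ ∀ i x, φ (A.X i x) = A'.X i (φ x)}
  add_mem' {φ ψ} hφ hψ :=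
    ⟨fun a x => by simp only [LinearMap.add_apply, hφ.1, hψ.1, map_add],
      fun i x => by simp only [LinearMap.add_apply, hφ.2, hψ.2, map_add]⟩
  zero_mem' := ⟨fun a x => by simp, fun i x => by simp⟩
  smul_mem' c φ hφ :=
    ⟨fun a x => by simp only [LinearMap.smul_apply, hφ.1, map_smul],
      fun i x => by simp only [LinearMap.smul_apply, hφ.2, map_smul]⟩

theorem hom_ext (hA : A.IsGood) {φ ψ : F →ₗ[R] F'} (hφ : φ ∈ hom A A') (hψ : ψ ∈ hom A A')
    (h : ∀ x, φ (A.E 0 x) = ψ (A.E 0 x)) : φ = ψ := by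
  refine LinearMap.ext fun x => ?_
  rw [← sub_eq_zero, ← LinearMap.sub_apply, ← LinearMap.mem_ker]
  have hsub := (hom A A').sub_mem hφ hψ
  refine level_induction hA _ (fun y => ?_) (fun a _ ih i y => ?_) x
  · rw [LinearMap.mem_ker, LinearMap.sub_apply, h, sub_self]
  · rw [LinearMap.mem_ker, hsub.2, ih y, map_zero]

/-- A homomorphism given at `a` has to be continued to `a + 1`. Solvability of this linear problem
is membership in a submodule `P` of a space of functions, so it may be checked after multiplication
with the generators `l (X i (E a z))`, for which there is an explicit solution. -/
theorem exists_extension_step (hd : 1 ≤ d) (hA : A.IsGood) (hA' : A'.IsGood)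
    (hline : A.line ≤ A'.line) (φ : F →ₗ[R] F') {a : ℕ} (ha : a < d) :
    ∃ χ : F →ₗ[R] F', ∀ i x, χ (A.X i (A.E a x)) = A'.X i (φ (A.E a x)) := by
  let P : Submodule R (Fin (n + 1) × F → F') := LinearMap.range
    (LinearMap.pi fun p : Fin (n + 1) × F =>
      (LinearMap.applyₗ (A.X p.1 (A.E a p.2)) : (F →ₗ[R] F') →ₗ[R] F'))
  suffices h : (fun p => A'.X p.1 (φ (A.E a p.2))) ∈ P by
    obtain ⟨χ, hχ⟩ := h
    exact ⟨χ, fun i x => congrFun hχ (i, x)⟩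
  refine Submodule.smul_mem_induction (hA.gen a ha) P ?_
  rintro _ ⟨l, i, z, rfl⟩
  refine ⟨l.smulRight (A'.X i (φ (A.E a z))), funext fun p => ?_⟩
  obtain ⟨j, x⟩ := p
  change l (A.X j (A.E a x)) • A'.X i (φ (A.E a z)) = l (A.X i (A.E a z)) • A'.X j (φ (A.E a x))
  have h1 := (hA.rankOne a ha.le).comm (l ∘ₗ A.X j) x z
  have h2 := congrArg (fun t => A'.X i (φ t)) h1
  simp only [map_smul, LinearMap.comp_apply] at h2
  rw [h2]
  exact (mem_line_iff hA').1 (hline (functional_mem_line hd hA a l z)) j i _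

theorem exists_hom_extending (hd : 1 ≤ d) (hA : A.IsGood) (hA' : A'.IsGood)
    (hline : A.line ≤ A'.line) (ψ : F →ₗ[R] F') :
    ∃ φ ∈ hom A A', ∀ x, φ (A.E 0 x) = A'.E 0 (ψ (A.E 0 x)) := by
  -- The map is built vertex by vertex. At stage `m` it preserves the vertices up to `m` and
  -- commutes with the arrows between them.
  have key : ∀ m ≤ d, ∃ φ : F →ₗ[R] F', (∀ x, φ (A.E 0 x) = A'.E 0 (ψ (A.E 0 x))) ∧
      (∀ a ≤ m, ∀ x, A'.E a (φ (A.E a x)) = φ (A.E a x)) ∧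
      ∀ a < m, ∀ i x, φ (A.X i (A.E a x)) = A'.X i (φ (A.E a x)) := by
    intro m
    induction m with
    | zero =>
      refine fun _ => ⟨A'.E 0 ∘ₗ ψ, fun x => rfl, fun a ha x => ?_, fun a ha => by omega⟩
      obtain rfl : a = 0 := by omega
      exact A'.idem _ _
    | succ m ih =>
      intro hm
      obtain ⟨φ, h0, h1, h2⟩ := ih (by omega)
      obtain ⟨χ, hχ⟩ := exists_extension_step hd hA hA' hline φ (a := m) hm
      -- Only the component at vertex `m + 1` is changed.
      let φ' : F →ₗ[R] F' := φ ∘ₗ (1 - A.E (m + 1)) + A'.E (m + 1) ∘ₗ χ ∘ₗ A.E (m + 1)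
      have e1 : ∀ a ≠ m + 1, ∀ x, φ' (A.E a x) = φ (A.E a x) := fun a ha x => by
        simp [φ', A.orth (m + 1) a ha.symm]
      have e2 : ∀ x, φ' (A.E (m + 1) x) = A'.E (m + 1) (χ (A.E (m + 1) x)) := fun x => by
        simp [φ', A.idem]
      refine ⟨φ', fun x => by rw [e1 0 (by omega), h0], fun a ha x => ?_, fun a ha i x => ?_⟩
      · rcases Nat.lt_or_ge a (m + 1) with h | h
        · rw [e1 a h.ne, h1 a (by omega)]
        · obtain rfl : a = m + 1 := by omega
          rw [e2, A'.idem]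
      · rcases Nat.lt_or_ge a m with h | h
        · rw [e1 a (by omega), A.shift, e1 (a + 1) (by omega), ← A.shift, h2 a h]
        · obtain rfl : a = m := by omega
          rw [e1 a (by omega), A.shift, e2, ← A.shift, hχ, ← h1 a le_rfl, A'.shift, A'.idem]
  obtain ⟨φ, h0, h1, h2⟩ := key d le_rfl
  have hE : ∀ a x, φ (A.E a x) = A'.E a (φ x) := by
    intro a x
    rcases Nat.lt_or_ge d a with h | h
    · rw [A.eq_zero a h, A'.eq_zero a h, LinearMap.zero_apply, LinearMap.zero_apply, map_zero]
    · conv_rhs => rw [← A.sum x, map_sum, map_sum]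
      rw [Finset.sum_eq_single a, h1 a h]
      · intro b hb hba
        rw [← h1 b (Nat.lt_succ_iff.1 (Finset.mem_range.1 hb)), A'.orth a b hba.symm]
      · intro hna
        exact absurd (Finset.mem_range.2 (Nat.lt_succ_iff.2 h)) hna
  refine ⟨φ, ⟨hE, fun i x => ?_⟩, h0⟩
  rw [← A.sum x, map_sum, map_sum, map_sum, map_sum]
  refine Finset.sum_congr rfl fun a ha => ?_
  rcases Nat.lt_or_ge a d with h | h
  · exact h2 a h i x
  · obtain rfl : a = d := by have := Finset.mem_range.1 ha; omega
    rw [hE, A.shift, A'.shift, A.eq_zero _ (Nat.lt_succ_self _), A'.eq_zero _ (Nat.lt_succ_self _)]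
    simp

/-- Homomorphisms are determined at vertex `0`, and there both representations have rank one, so any
two are proportional. -/
theorem hom_functional_comm (hA : A.IsGood) (hA' : A'.IsGood) {φ ψ : F →ₗ[R] F'}
    (hφ : φ ∈ hom A A') (hψ : ψ ∈ hom A A') (m : Module.Dual R F') (v : F) :
    m (φ (A.E 0 v)) • ψ = m (ψ (A.E 0 v)) • φ := by
  refine hom_ext hA ((hom A A').smul_mem _ hψ) ((hom A A').smul_mem _ hφ) fun w => ?_
  have h1 := (hA'.rankOne 0 (Nat.zero_le _)).comm m (φ v) (ψ w)
  have h2 := (hA.rankOne 0 (Nat.zero_le _)).comm (m ∘ₗ ψ) w v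
  have h3 := congrArg φ h2
  rw [map_smul, map_smul, LinearMap.comp_apply, LinearMap.comp_apply] at h3
  rw [LinearMap.smul_apply, LinearMap.smul_apply, hφ.1, hψ.1, h1, ← hψ.1, ← hφ.1, h3]

/-- The products that show that two representations with the same line are locally isomorphic. -/
theorem span_functional_mul (hA : A.IsGood) (hA' : A'.IsGood) :
    Ideal.span {c | ∃ (l : Module.Dual R F) (v : F) (m : Module.Dual R F') (y : F'),
      l (A.E 0 v) * m (A'.E 0 y) = c} = ⊤ := by
  have h := congrArg₂ (· * ·) (hA.rankOne 0 (Nat.zero_le _)).span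
    (hA'.rankOne 0 (Nat.zero_le _)).span
  simp only [Ideal.span_mul_span', Ideal.top_mul] at h
  refine top_unique (h.symm.le.trans (Ideal.span_mono ?_))
  rintro _ ⟨_, ⟨l, v, rfl⟩, _, ⟨m, y, rfl⟩, rfl⟩
  exact ⟨l, v, m, y, rfl⟩

theorem hom_invertible (hd : 1 ≤ d) (hA : A.IsGood) (hA' : A'.IsGood)
    (hline : A.line ≤ A'.line) : Module.Invertible R (hom A A') := by
  refine Module.Invertible.of_functionals
    {l | ∃ (m : Module.Dual R F') (v : F), ∀ φ : hom A A', l φ = m (φ.1 (A.E 0 v))} ?_ ?_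
  · rintro l ⟨m, v, hl⟩ φ ψ
    refine Subtype.ext ?_
    rw [hl, hl]
    exact hom_functional_comm hA hA' φ.2 ψ.2 m v
  · refine top_unique ((span_functional_mul hA hA').symm.le.trans (Ideal.span_mono ?_))
    rintro _ ⟨l, v, m, y, rfl⟩
    obtain ⟨φ, hφ, h⟩ := exists_hom_extending hd hA hA' hline (l.smulRight y)
    refine ⟨m ∘ₗ LinearMap.applyₗ (A.E 0 v) ∘ₗ (hom A A').subtype, ⟨m, v, fun _ => rfl⟩,
      ⟨φ, hφ⟩, ?_⟩
    change m (φ (A.E 0 v)) = _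
    rw [h, LinearMap.smulRight_apply, map_smul, map_smul, smul_eq_mul]

/-- The evaluation of homomorphisms. -/
noncomputable def evalHom (A : BeilinsonAction R F n d) (A' : BeilinsonAction R F' n d) :
    hom A A' ⊗[R] F →ₗ[R] F' := TensorProduct.lift (hom A A').subtype

/-- Vertex `0` is reached by extending rank one maps from there, and the image is closed under the
arrows. -/
theorem evalHom_surjective (hd : 1 ≤ d) (hA : A.IsGood) (hA' : A'.IsGood)
    (hline : A.line ≤ A'.line) : Function.Surjective (evalHom A A') := by
  rw [← LinearMap.range_eq_top]
  refine top_unique fun y _ => ?_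
  refine level_induction hA' _ (fun y => ?_) (fun a _ ih i y => ?_) y
  · refine Submodule.smul_mem_induction (hA.rankOne 0 (Nat.zero_le _)).span _ ?_
    rintro _ ⟨l, v, rfl⟩
    obtain ⟨φ, hφ, h⟩ := exists_hom_extending hd hA hA' hline (l.smulRight y)
    refine ⟨⟨φ, hφ⟩ ⊗ₜ A.E 0 v, ?_⟩
    rw [evalHom, TensorProduct.lift.tmul]
    change φ (A.E 0 v) = _
    rw [h, LinearMap.smulRight_apply, map_smul]
  · obtain ⟨t, ht⟩ := ih y
    rw [← ht]
    clear ht ih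
    induction t with
    | zero => simp
    | add x y hx hy => rw [map_add, map_add]; exact add_mem hx hy
    | tmul φ x =>
      refine ⟨φ ⊗ₜ A.X i x, ?_⟩
      rw [evalHom, TensorProduct.lift.tmul, TensorProduct.lift.tmul]
      exact φ.2.2 i x

theorem evalHom_injective (hd : 1 ≤ d) (hA : A.IsGood) (hA' : A'.IsGood)
    (hline : A.line = A'.line) : Function.Injective (evalHom A A') := by
  rw [injective_iff_map_eq_zero]
  intro t ht
  -- For `ψ` and `χ` going back and forth, the endomorphism `χ ∘ φ` is proportional to the identity
  -- and `φ` to `ψ`. So `l (χ (ψ (E 0 v)))` multiplies `t` to something that depends only on its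
  -- evaluation.
  have key : ∀ (ψ : hom A A') (χ : hom A' A) (l : Module.Dual R F) (v : F),
      l (χ.1 (ψ.1 (A.E 0 v))) • t = l (A.E 0 v) • (ψ ⊗ₜ[R] χ.1 (evalHom A A' t)) := by
    intro ψ χ l v
    clear ht
    induction t with
    | zero => simp
    | add x y hx hy => rw [smul_add, hx, hy, map_add, map_add, TensorProduct.tmul_add, smul_add]
    | tmul φ w =>
      have hcomp : χ.1 ∘ₗ φ.1 ∈ hom A A :=
        ⟨fun a x => by simp [φ.2.1 a, χ.2.1 a], fun i x => by simp [φ.2.2 i, χ.2.2 i]⟩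
      have hid : (LinearMap.id : F →ₗ[R] F) ∈ hom A A := ⟨fun _ _ => rfl, fun _ _ => rfl⟩
      have e1 := DFunLike.congr_fun (hom_functional_comm hA hA hid hcomp l v) w
      simp only [LinearMap.smul_apply, LinearMap.comp_apply, LinearMap.id_apply] at e1
      have e2 : l (χ.1 (φ.1 (A.E 0 v))) • ψ = l (χ.1 (ψ.1 (A.E 0 v))) • φ :=
        Subtype.ext (hom_functional_comm hA hA' φ.2 ψ.2 (l ∘ₗ χ.1) v)
      rw [evalHom, TensorProduct.lift.tmul]
      change _ = l (A.E 0 v) • (ψ ⊗ₜ[R] χ.1 (φ.1 w))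
      rw [← TensorProduct.tmul_smul (l (A.E 0 v)) ψ, e1, TensorProduct.tmul_smul,
        TensorProduct.smul_tmul', TensorProduct.smul_tmul', e2]
  refine eq_of_forall_smul_eq (hA.rankOne 0 (Nat.zero_le _)).span (y := 0) ?_
  rintro _ ⟨l, z, rfl⟩
  refine eq_of_forall_smul_eq (span_functional_mul hA hA') ?_
  rintro _ ⟨l', v, m, y, rfl⟩
  -- With this choice of `ψ` and `χ` the scalar in `key` is the product of the three numbers `l' (E
  -- 0 v)`, `m (E 0 y)` and `l (E 0 z)`, and such products generate the unit ideal.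
  obtain ⟨ψ, hψ, h⟩ := exists_hom_extending hd hA hA' hline.le (l'.smulRight y)
  obtain ⟨χ, hχ, h'⟩ := exists_hom_extending hd hA' hA hline.ge (m.smulRight z)
  have := key ⟨ψ, hψ⟩ ⟨χ, hχ⟩ l v
  rw [ht, map_zero, TensorProduct.tmul_zero, smul_zero] at this
  change l (χ (ψ (A.E 0 v))) • t = 0 at this
  rw [h, LinearMap.smulRight_apply, map_smul, map_smul, h', LinearMap.smulRight_apply, map_smul,
    map_smul, map_smul, smul_smul, mul_smul] at this
  rw [smul_zero, smul_zero, smul_smul]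
  convert this using 2
  rw [smul_eq_mul, smul_eq_mul, mul_assoc]

end BeilinsonAction

namespace BeilinsonAction

variable {R : Type u} [CommRing R] {F F' : Type u} [AddCommGroup F] [Module R F] [AddCommGroup F']
  [Module R F'] {n d : ℕ} {A : BeilinsonAction R F n d} {A' : BeilinsonAction R F' n d}

theorem line_le_of_twist (hA : A.IsGood) {L : Type u} [AddCommGroup L] [Module R L]
    (φ : (L ⊗[R] F) ≃ₗ[R] F') (hφ : ∀ i t, φ ((A.X i).lTensor L t) = A'.X i (φ t)) :
    A.line ≤ A'.line := by
  intro u hu i j x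
  obtain ⟨t, ht⟩ := φ.surjective (A'.E 0 x)
  rw [← ht, ← hφ, ← hφ, ← map_smul φ, ← map_smul φ]
  congr 1
  clear ht
  induction t with
  | zero => simp
  | add y z hy hz => simp only [map_add, smul_add, hy, hz]
  | tmul l y =>
    rw [LinearMap.lTensor_tmul, LinearMap.lTensor_tmul, ← TensorProduct.tmul_smul,
      ← TensorProduct.tmul_smul, (mem_line_iff hA).1 hu]

/-! ### Base change -/

/-- The base change of a representation. -/
noncomputable def baseChange (A : BeilinsonAction R F n d) (R' : Type u) [CommRing R']
    [Algebra R R'] : BeilinsonAction R' (R' ⊗[R] F) n d where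
  E a := (A.E a).baseChange R'
  X i := (A.X i).baseChange R'
  idem a x := by
    rw [← LinearMap.comp_apply, ← LinearMap.baseChange_comp]
    congr 2
    exact LinearMap.ext (A.idem a)
  orth a b h x := by
    rw [← LinearMap.comp_apply, ← LinearMap.baseChange_comp,
      show A.E a ∘ₗ A.E b = 0 from LinearMap.ext (A.orth a b h), LinearMap.baseChange_zero,
      LinearMap.zero_apply]
  eq_zero a h := by rw [A.eq_zero a h, LinearMap.baseChange_zero]
  sum x := by
    induction x with
    | zero => simp
    | add x y hx hy => simp only [map_add, Finset.sum_add_distrib, hx, hy]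
    | tmul c x => simp only [LinearMap.baseChange_tmul, ← TensorProduct.tmul_sum, A.sum]
  shift i a x := by
    rw [← LinearMap.comp_apply, ← LinearMap.comp_apply, ← LinearMap.baseChange_comp,
      ← LinearMap.baseChange_comp]
    congr 2
    exact LinearMap.ext (A.shift i a)
  comm i j x := by
    rw [← LinearMap.comp_apply, ← LinearMap.comp_apply, ← LinearMap.baseChange_comp,
      ← LinearMap.baseChange_comp]
    congr 2
    exact LinearMap.ext (A.comm i j)

theorem IsGood.baseChange (hA : A.IsGood) (R' : Type u) [CommRing R'] [Algebra R R'] :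
    (A.baseChange R').IsGood where
  finite := by
    have := hA.finite
    infer_instance
  projective := by
    have := hA.projective
    infer_instance
  rankOne a ha := (hA.rankOne a ha).baseChange (LinearMap.ext (A.idem a)) R'
  gen a ha := by
    have h := congrArg (Ideal.map (algebraMap R R')) (hA.gen a ha)
    rw [Ideal.map_span, Ideal.map_top] at h
    refine top_unique (h.symm.le.trans (Ideal.span_mono ?_))
    rintro _ ⟨_, ⟨l, i, x, rfl⟩, rfl⟩
    refine ⟨Module.Dual.baseChange R' l, i, 1 ⊗ₜ x, ?_⟩
    change Module.Dual.baseChange R' l (1 ⊗ₜ A.X i (A.E a x)) = _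
    rw [Module.Dual.baseChange_apply_tmul, Algebra.algebraMap_eq_smul_one]

theorem algebraMap_mem_line (R' : Type u) [CommRing R'] [Algebra R R'] {u : Fin (n + 1) → R}
    (hu : u ∈ A.line) : (fun i => algebraMap R R' (u i)) ∈ (A.baseChange R').line := by
  intro i j t
  induction t with
  | zero => simp
  | add x y hx hy => simp only [map_add, smul_add, hx, hy]
  | tmul c x =>
    change algebraMap R R' (u i) • (c ⊗ₜ[R] A.X j (A.E 0 x)) =
      algebraMap R R' (u j) • (c ⊗ₜ[R] A.X i (A.E 0 x))
    rw [algebraMap_smul, algebraMap_smul, ← TensorProduct.tmul_smul, ← TensorProduct.tmul_smul, hu]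

/-! ### Indecomposable representations -/

/-- Stability of a submodule under a representation. -/
def IsStable (A : BeilinsonAction R F n d) (P : Submodule R F) : Prop :=
  (∀ a, ∀ x ∈ P, A.E a x ∈ P) ∧ ∀ i, ∀ x ∈ P, A.X i x ∈ P

/-- Nonzero, and not the direct sum of two nonzero subrepresentations. -/
def IsIndecomposable (A : BeilinsonAction R F n d) : Prop :=
  Nontrivial F ∧ ∀ P Q : Submodule R F, A.IsStable P → A.IsStable Q → IsCompl P Q → P = ⊥ ∨ Q = ⊥

/-- The part of a representation that is supported on the vertices in a set. -/
def support (A : BeilinsonAction R F n d) (S : Set ℕ) : Submodule R F where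
  carrier := {x | ∀ b ∉ S, A.E b x = 0}
  add_mem' hx hy b hb := by rw [map_add, hx b hb, hy b hb, add_zero]
  zero_mem' b _ := map_zero _
  smul_mem' c x hx b hb := by rw [map_smul, hx b hb, smul_zero]

theorem E_mem_support (S : Set ℕ) {a : ℕ} (ha : a ∈ S) (x : F) : A.E a x ∈ A.support S :=
  fun b hb => A.orth b a (fun h => hb (h ▸ ha)) x

theorem E_zero_X (i : Fin (n + 1)) (x : F) : A.E 0 (A.X i x) = 0 := by
  conv_lhs => rw [← A.sum x, map_sum, map_sum]
  exact Finset.sum_eq_zero fun a _ => by rw [A.shift, A.orth 0 (a + 1) (Nat.succ_ne_zero a).symm]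

theorem support_isStable (S : Set ℕ) (hS : ∀ a ∈ S, a + 1 ∉ S → ∀ i x, A.X i (A.E a x) = 0) :
    A.IsStable (A.support S) := by
  refine ⟨fun a x hx b hb => ?_, fun i x hx b hb => ?_⟩
  · rcases eq_or_ne b a with rfl | h
    · rw [A.idem, hx b hb]
    · exact A.orth b a h x
  · rcases b with _ | c
    · exact E_zero_X i x
    · rw [← A.shift]
      by_cases hc : c ∈ S
      · exact hS c hc hb i x
      · rw [hx c hc, map_zero]

theorem support_isCompl (S : Set ℕ) : IsCompl (A.support S) (A.support Sᶜ) := by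
  classical
  refine IsCompl.of_eq ?_ ?_
  · refine (Submodule.eq_bot_iff _).2 fun x hx => ?_
    rw [← A.sum x]
    refine Finset.sum_eq_zero fun a _ => ?_
    by_cases ha : a ∈ S
    · exact hx.2 a fun h => h ha
    · exact hx.1 a ha
  · refine top_unique fun x _ => ?_
    rw [← A.sum x]
    refine Submodule.sum_mem _ fun a _ => ?_
    by_cases ha : a ∈ S
    · exact Submodule.mem_sup_left (E_mem_support S ha x)
    · exact Submodule.mem_sup_right (E_mem_support Sᶜ ha x)

/-- If all arrows out of `a` vanished, the parts on the vertices `≤ a` and `> a` would be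
complementary subrepresentations, both nonzero. -/
theorem IsIndecomposable.exists_ne_zero (h : A.IsIndecomposable)
    (hne : ∀ a ≤ d, ∃ x, A.E a x ≠ 0) {a : ℕ} (ha : a < d) : ∃ i x, A.X i (A.E a x) ≠ 0 := by
  by_contra hcon
  push Not at hcon
  have h1 : A.IsStable (A.support (Set.Iic a)) := support_isStable _ fun b hb hb' => by
    obtain rfl : b = a := by simp only [Set.mem_Iic] at hb hb'; omega
    exact hcon
  have h2 : A.IsStable (A.support (Set.Iic a)ᶜ) := support_isStable _ fun b hb hb' => by
    simp only [Set.mem_compl_iff, Set.mem_Iic] at hb hb'; omega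
  obtain ⟨x, hx⟩ := hne a ha.le
  obtain ⟨y, hy⟩ := hne (a + 1) ha
  rcases h.2 _ _ h1 h2 (support_isCompl _) with h | h
  · exact hx ((Submodule.mem_bot R).1 (h ▸ E_mem_support _ (Set.mem_Iic.2 le_rfl) x))
  · refine hy ((Submodule.mem_bot R).1 (h ▸ E_mem_support _ ?_ y))
    simp

theorem range_E_le {a : ℕ} (hA : A.IsGood) {b : ℕ} (hab : a ≤ b) (hb : b ≤ d) {P : Submodule R F}
    (hP : A.IsStable P) (h : ∀ x, A.E a x ∈ P) (x : F) : A.E b x ∈ P := by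
  induction b, hab using Nat.le_induction generalizing x with
  | base => exact h x
  | succ b _ ih => exact gen_mem hA hb P (fun i x => hP.2 i _ (ih (by omega) x)) x

section Field

variable {K : Type u} [Field K] {V : Type u} [AddCommGroup V] [Module K V]
  {B : BeilinsonAction K V n d}

theorem IsStable.E_mem_of_ne_zero {a : ℕ} (h : Module.IsRankOneOn (B.E a)) {P : Submodule K V}
    (hP : B.IsStable P) {p : V} (hp : p ∈ P) (h0 : B.E a p ≠ 0) (x : V) : B.E a x ∈ P := by
  obtain ⟨l, hl⟩ := not_forall.1 (mt (Module.forall_dual_apply_eq_zero_iff K _).1 h0)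
  rw [← one_smul K (B.E a x), ← inv_mul_cancel₀ hl, mul_smul, h.comm]
  exact P.smul_mem _ (P.smul_mem _ (hP.1 a p hp))

theorem gen_iff_exists_ne_zero {a : ℕ} :
    Ideal.span {c | ∃ (l : Module.Dual K V) (i : Fin (n + 1)) (x : V), l (B.X i (B.E a x)) = c} = ⊤
      ↔ ∃ i x, B.X i (B.E a x) ≠ 0 := by
  constructor
  · intro h
    by_contra hcon
    push Not at hcon
    refine top_ne_bot (h.symm.trans (Ideal.span_eq_bot.2 ?_))
    rintro _ ⟨l, i, x, rfl⟩
    rw [hcon, map_zero]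
  · rintro ⟨i, x, h⟩
    obtain ⟨l, hl⟩ := not_forall.1 (mt (Module.forall_dual_apply_eq_zero_iff K _).1 h)
    exact Ideal.eq_top_of_isUnit_mem _ (Ideal.subset_span ⟨l, i, x, rfl⟩) (isUnit_iff_ne_zero.2 hl)

theorem exists_E_ne_zero {a : ℕ} (h : Module.IsRankOneOn (B.E a)) : ∃ x, B.E a x ≠ 0 := by
  by_contra hcon
  push Not at hcon
  exact one_ne_zero (h.eq_zero_of_smul (c := 1) fun x => by rw [hcon, smul_zero])

theorem eq_top_of_E_zero_ne_zero (hB : B.IsGood) {P : Submodule K V} (hP : B.IsStable P) {p : V}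
    (hp : p ∈ P) (h0 : B.E 0 p ≠ 0) : P = ⊤ :=
  top_unique fun x _ => level_induction hB P
    (hP.E_mem_of_ne_zero (hB.rankOne 0 (Nat.zero_le _)) hp h0)
    (fun _ _ h i x => hP.2 i _ (h x)) x

/-- One of two complementary submodules has a nonzero component at vertex `0`; it contains that
whole one-dimensional space, which generates everything. -/
theorem IsGood.isIndecomposable (hB : B.IsGood) : B.IsIndecomposable := by
  obtain ⟨x, hx⟩ := exists_E_ne_zero (hB.rankOne 0 (Nat.zero_le _))
  refine ⟨⟨_, _, hx⟩, fun P Q hP hQ hPQ => ?_⟩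
  obtain ⟨p, hp, q, hq, rfl⟩ := Submodule.mem_sup.1 (hPQ.sup_eq_top ▸ Submodule.mem_top : x ∈ P ⊔ Q)
  by_cases h0 : B.E 0 p = 0
  · rw [map_add, h0, zero_add] at hx
    left
    rw [← inf_top_eq P, ← eq_top_of_E_zero_ne_zero hB hQ hq hx, hPQ.inf_eq_bot]
  · right
    rw [← top_inf_eq Q, ← eq_top_of_E_zero_ne_zero hB hP hp h0, hPQ.inf_eq_bot]

theorem isGood_iff_isIndecomposable [Module.Finite K V]
    (h : ∀ a ≤ d, Module.IsRankOneOn (B.E a)) : B.IsGood ↔ B.IsIndecomposable :=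
  ⟨IsGood.isIndecomposable, fun hB => ⟨inferInstance, inferInstance, h, fun _ ha =>
    gen_iff_exists_ne_zero.2 (hB.exists_ne_zero (fun a ha => exists_E_ne_zero (h a ha)) ha)⟩⟩

end Field

/-- If the entries of the arrows out of `a` lay in a maximal ideal, all these arrows would vanish
over an algebraic closure of its residue field, and that fibre would decompose. -/
theorem isGood_iff_geometric [Module.Finite R F] [Module.Projective R F]
    (h : ∀ a ≤ d, Module.IsRankOneOn (A.E a)) :
    A.IsGood ↔ ∀ (K : Type u) [Field K] [IsAlgClosed K] [Algebra R K],
      (A.baseChange K).IsIndecomposable := by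
  refine ⟨fun hA K _ _ _ => (hA.baseChange K).isIndecomposable, fun hK =>
    ⟨inferInstance, inferInstance, h, fun a ha => ?_⟩⟩
  by_contra hne
  obtain ⟨m, hm, hle⟩ := Ideal.exists_le_maximal _ hne
  let := Ideal.Quotient.field m
  let K := AlgebraicClosure (R ⧸ m)
  have hr : ∀ a ≤ d, Module.IsRankOneOn ((A.baseChange K).E a) :=
    fun a ha => (h a ha).baseChange (LinearMap.ext (A.idem a)) K
  obtain ⟨i, t, ht⟩ := (hK K).exists_ne_zero (fun a ha => exists_E_ne_zero (hr a ha)) ha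
  refine ht ?_
  clear ht
  induction t with
  | zero => simp
  | add x y hx hy => rw [map_add, map_add, hx, hy, add_zero]
  | tmul c x =>
    change c ⊗ₜ[R] A.X i (A.E a x) = 0
    obtain ⟨s, l, b, hb⟩ := Module.exists_dual_basis (R := R) (L := F)
    rw [← hb (A.X i (A.E a x)), TensorProduct.tmul_sum]
    refine Finset.sum_eq_zero fun j _ => ?_
    have h0 : algebraMap R K (l j (A.X i (A.E a x))) = 0 := by
      rw [IsScalarTower.algebraMap_apply R (R ⧸ m) K, Ideal.Quotient.algebraMap_eq,
        Ideal.Quotient.eq_zero_iff_mem.2 (hle (Ideal.subset_span ⟨l j, i, x, rfl⟩)), map_zero]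
    rw [TensorProduct.tmul_smul, TensorProduct.smul_tmul', Algebra.smul_def, h0, zero_mul,
      TensorProduct.zero_tmul]

end BeilinsonAction

/-! ### Actions of the path algebra as representations -/

namespace BeilinsonQuiver

variable {k : Type u} [Field k] {n d : ℕ}

theorem pathAlgebra_induction {C : PathAlgebra k (BeilinsonQuiver n d) → Prop}
    (algebraMap : ∀ c : k, C (algebraMap k _ c))
    (vertex : ∀ a h, C (PathAlgebra.e k (vertex n a h))) (arrow : ∀ i a h, C (x k i a h))
    (add : ∀ y z, C y → C z → C (y + z)) (mul : ∀ y z, C y → C z → C (y * z))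
    (y : PathAlgebra k (BeilinsonQuiver n d)) : C y := by
  obtain ⟨y, rfl⟩ := RingQuot.mkAlgHom_surjective k _ y
  induction y using FreeAlgebra.induction with
  | grade0 c => rw [AlgHom.commutes]; exact algebraMap c
  | grade1 g =>
    cases g with
    | vertex v => exact vertex v.level v.level_le
    | @arrow a b h =>
      obtain ⟨b, hb⟩ := b
      obtain ⟨i, hi⟩ := h
      obtain rfl : b = a.level + 1 := hi
      exact arrow i a.level (Nat.lt_succ_iff.1 hb)
  | mul y z hy hz => rw [map_mul]; exact mul _ _ hy hz
  | add y z hy hz => rw [map_add]; exact add _ _ hy hz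

end BeilinsonQuiver

namespace PathAlgebra

variable (k : Type u) [Field k] {V : Type} [Quiver.{0} V] [Fintype V]

theorem e_mul_e (v : V) : e k v * e k v = e k v := by
  rw [e, ← map_mul]
  exact RingQuot.mkAlgHom_rel k (Rel.idem v)

theorem e_mul_e_of_ne {v w : V} (h : v ≠ w) : e k v * e k w = 0 := by
  rw [e, e, ← map_mul, RingQuot.mkAlgHom_rel k (Rel.orth v w h), map_zero]

theorem sum_e : ∑ v : V, e k v = 1 := by
  simp only [e]
  rw [← map_sum, RingQuot.mkAlgHom_rel k Rel.one, map_one]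

theorem e_mul_arrow {a b : V} (h : a ⟶ b) : e k b * arrow k h = arrow k h := by
  rw [e, arrow, ← map_mul]
  exact RingQuot.mkAlgHom_rel k (Rel.target h)

theorem arrow_mul_e {a b : V} (h : a ⟶ b) : arrow k h * e k a = arrow k h := by
  rw [e, arrow, ← map_mul]
  exact RingQuot.mkAlgHom_rel k (Rel.source h)

end PathAlgebra

namespace BeilinsonAction

open BeilinsonQuiver

variable {k : Type u} [Field k] {R : Type u} [CommRing R] {F : Type u} [AddCommGroup F]
  [Module R F] {n d : ℕ} (φ : PathAlgebra k (BeilinsonQuiver n d) →+* Module.End R F)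

/-- The projection to a vertex. -/
noncomputable def vertexAct (a : ℕ) : Module.End R F :=
  if h : a ≤ d then φ (PathAlgebra.e k (vertex n a h)) else 0

/-- The total action of a variable. -/
noncomputable def varAct (i : Fin (n + 1)) : Module.End R F := ∑ a : Fin d, φ (x k i a a.2)

theorem vertexAct_of_le {a : ℕ} (h : a ≤ d) :
    vertexAct φ a = φ (PathAlgebra.e k (vertex n a h)) := dif_pos h

theorem vertexAct_of_lt {a : ℕ} (h : d < a) : vertexAct φ a = 0 := dif_neg h.not_ge

theorem vertexAct_mul_self (a : ℕ) : vertexAct φ a * vertexAct φ a = vertexAct φ a := by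
  rcases Nat.lt_or_ge d a with h | h
  · rw [vertexAct_of_lt φ h, mul_zero]
  · rw [vertexAct_of_le φ h, ← map_mul, PathAlgebra.e_mul_e]

theorem vertexAct_mul_of_ne {a b : ℕ} (hab : a ≠ b) : vertexAct φ a * vertexAct φ b = 0 := by
  rcases Nat.lt_or_ge d a with h | h
  · rw [vertexAct_of_lt φ h, zero_mul]
  rcases Nat.lt_or_ge d b with h' | h'
  · rw [vertexAct_of_lt φ h', mul_zero]
  rw [vertexAct_of_le φ h, vertexAct_of_le φ h', ← map_mul, PathAlgebra.e_mul_e_of_ne, map_zero]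
  exact fun h => hab (congrArg level h)

theorem sum_vertexAct : ∑ a ∈ Finset.range (d + 1), vertexAct φ a = 1 := by
  rw [← map_one φ, ← PathAlgebra.sum_e, map_sum, Finset.sum_range]
  exact Finset.sum_congr rfl fun a _ => vertexAct_of_le φ (Nat.lt_succ_iff.1 a.2)

theorem map_x_mul_vertexAct (i : Fin (n + 1)) {a : ℕ} (h : a + 1 ≤ d) :
    φ (x k i a h) * vertexAct φ a = φ (x k i a h) := by
  rw [vertexAct_of_le φ (Nat.le_of_succ_le h), ← map_mul, x, PathAlgebra.arrow_mul_e]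

theorem vertexAct_mul_map_x (i : Fin (n + 1)) {a : ℕ} (h : a + 1 ≤ d) :
    vertexAct φ (a + 1) * φ (x k i a h) = φ (x k i a h) := by
  rw [vertexAct_of_le φ h, ← map_mul, x, PathAlgebra.e_mul_arrow]

theorem varAct_mul_vertexAct (i : Fin (n + 1)) {a : ℕ} (h : a + 1 ≤ d) :
    varAct φ i * vertexAct φ a = φ (x k i a h) := by
  rw [varAct, Finset.sum_mul, Finset.sum_eq_single ⟨a, h⟩]
  · exact map_x_mul_vertexAct φ i h
  · intro b _ hb
    rw [← map_x_mul_vertexAct φ i b.2, mul_assoc, vertexAct_mul_of_ne, mul_zero]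
    exact fun h => hb (Fin.ext h)
  · simp

theorem vertexAct_mul_varAct (i : Fin (n + 1)) {a : ℕ} (h : a + 1 ≤ d) :
    vertexAct φ (a + 1) * varAct φ i = φ (x k i a h) := by
  rw [varAct, Finset.mul_sum, Finset.sum_eq_single ⟨a, h⟩]
  · exact vertexAct_mul_map_x φ i h
  · intro b _ hb
    rw [← vertexAct_mul_map_x φ i b.2, ← mul_assoc, vertexAct_mul_of_ne, zero_mul]
    exact fun h => hb (Fin.ext (Nat.succ_injective h).symm)
  · simp

theorem varAct_mul_vertexAct_eq (i : Fin (n + 1)) (a : ℕ) :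
    varAct φ i * vertexAct φ a = vertexAct φ (a + 1) * varAct φ i := by
  rcases Nat.lt_or_ge a d with h | h
  · rw [varAct_mul_vertexAct φ i h, vertexAct_mul_varAct φ i h]
  · rw [vertexAct_of_lt φ (Nat.lt_succ_iff.2 h), zero_mul, varAct, Finset.sum_mul]
    refine Finset.sum_eq_zero fun b _ => ?_
    have : (b : ℕ) ≠ a := fun h' => absurd b.2 (by omega)
    rw [← map_x_mul_vertexAct φ i b.2, mul_assoc, vertexAct_mul_of_ne φ this, mul_zero]

theorem varAct_mul_map_x (i : Fin (n + 1)) (j : Fin (n + 1)) {a : ℕ} (h : a + 1 ≤ d) :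
    varAct φ i * φ (x k j a h) =
      if h' : a + 1 + 1 ≤ d then φ (x k i (a + 1) h' * x k j a h) else 0 := by
  rw [← vertexAct_mul_map_x φ j h, ← mul_assoc]
  split_ifs with h'
  · rw [varAct_mul_vertexAct φ i h', map_mul]
  · rw [varAct_mul_vertexAct_eq, vertexAct_of_lt φ (by omega), zero_mul, zero_mul]

/-- The representation that belongs to an action of the path algebra that satisfies the
commutativity relations. -/
noncomputable def ofHom (hφ : ∀ i j a (h : a + 1 + 1 ≤ d),
    φ (x k j (a + 1) h * x k i a (Nat.le_of_succ_le h)) =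
      φ (x k i (a + 1) h * x k j a (Nat.le_of_succ_le h))) : BeilinsonAction R F n d where
  E := vertexAct φ
  X := varAct φ
  idem a := DFunLike.congr_fun (vertexAct_mul_self φ a)
  orth _ _ h := DFunLike.congr_fun (vertexAct_mul_of_ne φ h)
  eq_zero _ := vertexAct_of_lt φ
  sum y := by
    rw [← LinearMap.sum_apply, sum_vertexAct, Module.End.one_apply]
  shift i a := DFunLike.congr_fun (varAct_mul_vertexAct_eq φ i a)
  comm i j := DFunLike.congr_fun (show varAct φ i * varAct φ j = varAct φ j * varAct φ i by
    rw [varAct.eq_def φ j, Finset.mul_sum, varAct.eq_def φ i, Finset.mul_sum, ← varAct, ← varAct]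
    refine Finset.sum_congr rfl fun a _ => ?_
    rw [varAct_mul_map_x, varAct_mul_map_x]
    split_ifs with h
    · exact hφ j i a h
    · rfl)

section

variable {φ} (hφ : ∀ i j a (h : a + 1 + 1 ≤ d),
    φ (x k j (a + 1) h * x k i a (Nat.le_of_succ_le h)) =
      φ (x k i (a + 1) h * x k j a (Nat.le_of_succ_le h)))

theorem ofHom_E {a : ℕ} (h : a ≤ d) : (ofHom φ hφ).E a = φ (PathAlgebra.e k (vertex n a h)) :=
  vertexAct_of_le φ h

theorem ofHom_X_mul_E (i : Fin (n + 1)) {a : ℕ} (h : a + 1 ≤ d) :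
    (ofHom φ hφ).X i * (ofHom φ hφ).E a = φ (x k i a h) :=
  varAct_mul_vertexAct φ i h

theorem map_path (a m : ℕ) (w : Fin m → Fin (n + 1)) (h : a + m ≤ d) :
    φ (path k a m w h) = (ofHom φ hφ).pathAct m w * (ofHom φ hφ).E a := by
  induction m with
  | zero => rw [path, pathAct, one_mul, ofHom_E hφ]
  | succ m ih =>
    have hsh : ∀ m w, (ofHom φ hφ).pathAct m w * (ofHom φ hφ).E a =
        (ofHom φ hφ).E (a + m) * (ofHom φ hφ).pathAct m w := by
      intro m w
      refine LinearMap.ext fun y => ?_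
      induction m with
      | zero => rfl
      | succ m ih =>
        have := ih fun i => w i.castSucc
        rw [Module.End.mul_apply, Module.End.mul_apply] at this
        rw [Module.End.mul_apply, Module.End.mul_apply, pathAct_succ, pathAct_succ, this, shift]
        rfl
    rw [path, map_mul, ih, ← ofHom_X_mul_E hφ, mul_assoc, hsh, ← mul_assoc (E _ _),
      show (ofHom φ hφ).E (a + m) * (ofHom φ hφ).E (a + m) = (ofHom φ hφ).E (a + m) from
        LinearMap.ext ((ofHom φ hφ).idem (a + m)), ← hsh]
    rfl

theorem ofHom_baseChange (R' : Type u) [CommRing R'] [Algebra R R']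
    {φ' : PathAlgebra k (BeilinsonQuiver n d) →+* Module.End R' (R' ⊗[R] F)}
    (hφ' : ∀ i j a (h : a + 1 + 1 ≤ d),
      φ' (x k j (a + 1) h * x k i a (Nat.le_of_succ_le h)) =
        φ' (x k i (a + 1) h * x k j a (Nat.le_of_succ_le h)))
    (h : ∀ y, φ' y = (φ y).baseChange R') : ofHom φ' hφ' = (ofHom φ hφ).baseChange R' := by
  refine BeilinsonAction.ext (funext fun a => ?_) (funext fun i => ?_)
  · rcases Nat.lt_or_ge d a with ha | ha
    · rw [eq_zero _ a ha, eq_zero _ a ha]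
    · rw [ofHom_E hφ' ha, h, ← ofHom_E hφ ha]
      rfl
  · refine TensorProduct.AlgebraTensorModule.ext fun c y => ?_
    change (∑ a : Fin d, φ' (x k i a a.2)) (c ⊗ₜ y) = c ⊗ₜ (∑ a : Fin d, φ (x k i a a.2)) y
    simp only [LinearMap.sum_apply, TensorProduct.tmul_sum, h, LinearMap.baseChange_tmul]

theorem ofHom_isStable_iff [Algebra k R]
    (hk : ∀ c, φ (algebraMap k _ c) = algebraMap R (Module.End R F) (algebraMap k R c))
    (P : Submodule R F) :
    (ofHom φ hφ).IsStable P ↔ ∀ y, ∀ z ∈ P, φ y z ∈ P := by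
  constructor
  · intro h y
    induction y using pathAlgebra_induction with
    | algebraMap c =>
      intro z hz
      rw [hk, Module.algebraMap_end_apply]
      exact P.smul_mem _ hz
    | vertex a ha =>
      rw [← ofHom_E hφ ha]
      exact h.1 a
    | arrow i a ha =>
      rw [← ofHom_X_mul_E hφ]
      exact fun z hz => h.2 i _ (h.1 a z hz)
    | add y z hy hz =>
      intro p hp
      rw [map_add]
      exact P.add_mem (hy p hp) (hz p hp)
    | mul y z hy hz =>
      intro p hp
      rw [map_mul]
      exact hy _ (hz p hp)
  · intro h
    refine ⟨fun a z hz => ?_, fun i z hz => ?_⟩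
    · rcases Nat.lt_or_ge d a with ha | ha
      · rw [eq_zero _ a ha]
        exact P.zero_mem
      · rw [ofHom_E hφ ha]
        exact h _ z hz
    · change varAct φ i z ∈ P
      rw [varAct, LinearMap.sum_apply]
      exact P.sum_mem fun a _ => h _ z hz

end

end BeilinsonAction

/-! ### Families of modules over the quotient algebra -/

namespace ModuleFamily

open BeilinsonQuiver

variable {k : Type u} [Field k] {R : Type u} [CommRing R] [Algebra k R] {n d r : ℕ}
  {f : Fin r → MvPolynomial (Fin (n + 1)) k} {deg : Fin r → ℕ} {T : Fin r → Set ℕ}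

/-- The action of the path algebra on a family of modules over the quotient by the relations. -/
noncomputable def pathHom (F : ModuleFamily k (QuotAlgebra d f deg T) R) :
    PathAlgebra k (BeilinsonQuiver n d) →+* Module.End R F.carrier :=
  F.act.comp (Ideal.Quotient.mk _)

theorem pathHom_eq_zero (F : ModuleFamily k (QuotAlgebra d f deg T) R)
    {y : PathAlgebra k (BeilinsonQuiver n d)} (hy : IsRelation d f deg T y) : F.pathHom y = 0 := by
  have h : Ideal.Quotient.mk (relationIdeal d f deg T) y = 0 :=
    Ideal.Quotient.eq_zero_iff_mem.2 (TwoSidedIdeal.subset_span hy)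
  rw [pathHom, RingHom.comp_apply, h, map_zero]

theorem pathHom_comm (F : ModuleFamily k (QuotAlgebra d f deg T) R) (i j : Fin (n + 1)) (a : ℕ)
    (h : a + 1 + 1 ≤ d) : F.pathHom (x k j (a + 1) h * x k i a (Nat.le_of_succ_le h)) =
      F.pathHom (x k i (a + 1) h * x k j a (Nat.le_of_succ_le h)) := by
  rw [← sub_eq_zero, ← map_sub]
  exact F.pathHom_eq_zero (.comm i j a h)

/-- The representation of the Beilinson quiver that belongs to a family of modules. -/
noncomputable def toBeilinson (F : ModuleFamily k (QuotAlgebra d f deg T) R) :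
    BeilinsonAction R F.carrier n d :=
  BeilinsonAction.ofHom F.pathHom F.pathHom_comm

variable (F F' : ModuleFamily k (QuotAlgebra d f deg T) R)

theorem toBeilinson_E {a : ℕ} (h : a ≤ d) :
    F.toBeilinson.E a = F.act (idem d f deg T (vertex n a h)) :=
  BeilinsonAction.ofHom_E F.pathHom_comm h

theorem isStable_iff (P : Submodule R F.carrier) : F.IsStable P ↔ F.toBeilinson.IsStable P := by
  rw [toBeilinson, BeilinsonAction.ofHom_isStable_iff F.pathHom_comm F.act_algebraMap]
  exact (Ideal.Quotient.mk_surjective (I := relationIdeal d f deg T)).forall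

theorem isIndecomposable_iff : F.IsIndecomposable ↔ F.toBeilinson.IsIndecomposable := by
  simp only [IsIndecomposable, BeilinsonAction.IsIndecomposable, isStable_iff]

theorem satisfies : F.toBeilinson.Satisfies f deg T := by
  intro j a ha h c hc y
  have := DFunLike.congr_fun (F.pathHom_eq_zero (.equation j a ha h c hc)) y
  rw [map_sum, LinearMap.sum_apply, LinearMap.zero_apply] at this
  rw [← this]
  refine Finset.sum_congr rfl fun w _ => ?_
  rw [Algebra.smul_def, map_mul, BeilinsonAction.map_path F.pathHom_comm]
  exact (DFunLike.congr_fun (F.act_algebraMap (c w)) _).symm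

theorem baseChange_toBeilinson (R' : Type u) [CommRing R'] [Algebra k R'] [Algebra R R']
    [IsScalarTower k R R'] : (F.baseChange R').toBeilinson = F.toBeilinson.baseChange R' :=
  BeilinsonAction.ofHom_baseChange _ R' _ fun _ => rfl

theorem baseChange_isIndecomposable_iff (R' : Type u) [CommRing R'] [Algebra k R'] [Algebra R R']
    [IsScalarTower k R R'] :
    (F.baseChange R').IsIndecomposable ↔ (F.toBeilinson.baseChange R').IsIndecomposable := by
  rw [isIndecomposable_iff]
  exact iff_of_eq (congrArg _ (F.baseChange_toBeilinson R'))

theorem hasDimVector_iff : F.HasDimVector (idem d f deg T) (fun _ => 1) ↔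
    Module.Finite R F.carrier ∧ Module.Projective R F.carrier ∧
      ∀ a ≤ d, Module.IsRankOneOn (F.toBeilinson.E a) := by
  refine and_congr_right fun _ => and_congr_right fun _ => ?_
  have h : ∀ a ≤ d, (Module.IsRankOneOn (F.toBeilinson.E a) ↔
      ∀ p, Module.rankAtStalk (LinearMap.range (F.toBeilinson.E a)) p = 1) := fun a _ =>
    Module.isRankOneOn_iff_rankAtStalk (LinearMap.ext (F.toBeilinson.idem a))
  constructor
  · intro h' a ha
    rw [h a ha, toBeilinson_E F ha]
    exact h' _
  · intro h' v
    have := (h v.level v.level_le).1 (h' v.level v.level_le)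
    rw [toBeilinson_E F v.level_le] at this
    exact this

theorem isIndecomposableFamily_iff :
    F.IsIndecomposableFamily (idem d f deg T) (fun _ => 1) ↔ F.toBeilinson.IsGood := by
  constructor
  · intro h
    have h1 := (F.hasDimVector_iff).1 h.1
    have := h1.1
    have := h1.2.1
    refine (BeilinsonAction.isGood_iff_geometric h1.2.2).2 fun K _ _ _ => ?_
    let : Algebra k K := ((algebraMap R K).comp (algebraMap k R)).toAlgebra
    have : IsScalarTower k R K := .of_algebraMap_eq' rfl
    exact (F.baseChange_isIndecomposable_iff K).1 (h.2 K)
  · intro h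
    refine ⟨(F.hasDimVector_iff).2 ⟨h.finite, h.projective, h.rankOne⟩, fun K _ _ _ _ _ => ?_⟩
    exact (F.baseChange_isIndecomposable_iff K).2 (h.baseChange K).isIndecomposable

variable {F F'} in
theorem hom_map_pathHom {ψ : F.carrier →ₗ[R] F'.carrier}
    (hψ : ψ ∈ BeilinsonAction.hom F.toBeilinson F'.toBeilinson)
    (y : PathAlgebra k (BeilinsonQuiver n d)) (z : F.carrier) :
    ψ (F.pathHom y z) = F'.pathHom y (ψ z) := by
  induction y using pathAlgebra_induction generalizing z with
  | algebraMap c =>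
    change ψ (F.act (algebraMap k _ c) z) = F'.act (algebraMap k _ c) (ψ z)
    rw [F.act_algebraMap, F'.act_algebraMap, Module.algebraMap_end_apply,
      Module.algebraMap_end_apply, map_smul]
  | vertex a h =>
    have := hψ.1 a z
    rwa [toBeilinson_E _ h, toBeilinson_E _ h] at this
  | arrow i a h =>
    rw [← BeilinsonAction.ofHom_X_mul_E F.pathHom_comm, ← BeilinsonAction.ofHom_X_mul_E
      F'.pathHom_comm]
    change ψ (F.toBeilinson.X i (F.toBeilinson.E a z)) = _
    rw [hψ.2, hψ.1]
    rfl
  | add y y' hy hy' => simp only [map_add, LinearMap.add_apply, hy, hy']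
  | mul y y' hy hy' => rw [map_mul, map_mul, Module.End.mul_apply, Module.End.mul_apply, hy, hy']

/-- Tensoring with a line bundle does not change the ratios of the arrows. Conversely, the twisting
line bundle is the module of homomorphisms and the isomorphism is evaluation. -/
theorem isEquivalent_iff (hd : 1 ≤ d) (hf : ∀ j, (f j).IsHomogeneous (deg j))
    (hT : ∀ j, ∃ a ∈ T j, a + deg j ≤ d) (h : F.toBeilinson.IsGood) (h' : F'.toBeilinson.IsGood) :
    F.IsEquivalent F' ↔ F.toBeilinson.line = F'.toBeilinson.line := by
  constructor
  · rintro ⟨L, _, _, _, φ, hφ⟩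
    refine (BeilinsonAction.line_isLine hd h hf hT F.satisfies).eq_of_le
      (BeilinsonAction.line_isLine hd h' hf hT F'.satisfies)
      (BeilinsonAction.line_le_of_twist h φ fun i t => ?_)
    change φ (LinearMap.lTensor L (BeilinsonAction.varAct _ i) t) = BeilinsonAction.varAct _ i _
    rw [BeilinsonAction.varAct, BeilinsonAction.varAct, LinearMap.sum_apply,
      ← LinearMap.coe_lTensorHom, map_sum, LinearMap.sum_apply, map_sum]
    exact Finset.sum_congr rfl fun a _ => hφ _ t
  · intro hl
    have hbij : Function.Bijective (BeilinsonAction.evalHom F.toBeilinson F'.toBeilinson) :=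
      ⟨BeilinsonAction.evalHom_injective hd h h' hl,
        BeilinsonAction.evalHom_surjective hd h h' hl.le⟩
    refine ⟨BeilinsonAction.hom F.toBeilinson F'.toBeilinson, inferInstance, inferInstance,
      BeilinsonAction.hom_invertible hd h h' hl.le, LinearEquiv.ofBijective _ hbij, fun y t => ?_⟩
    obtain ⟨y, rfl⟩ := Ideal.Quotient.mk_surjective y
    change BeilinsonAction.evalHom _ _ _ = F'.act _ (BeilinsonAction.evalHom _ _ t)
    induction t with
    | zero => simp
    | add s t hs ht => simp only [map_add, hs, ht]
    | tmul ψ z =>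
      rw [LinearMap.lTensor_tmul, BeilinsonAction.evalHom, TensorProduct.lift.tmul,
        TensorProduct.lift.tmul]
      exact hom_map_pathHom ψ.2 y z

end ModuleFamily

/-! ### The module `M` through its pairings with the coordinate ring -/

namespace BeilinsonQuiver

open MvPolynomial ProjEquations BeilinsonAction

variable {k : Type u} [Field k] {n r d : ℕ} (f : Fin r → MvPolynomial (Fin (n + 1)) k)

/-- The module `M`. -/
noncomputable abbrev dualModule (d : ℕ) (f : Fin r → MvPolynomial (Fin (n + 1)) k) :
    ModuleFamily k (PathAlgebra k (BeilinsonQuiver n d)) k :=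
  (dualRep d f).toModule

variable {f}

/-- The value of an element of `M` at an element of the homogeneous coordinate ring. -/
noncomputable def dualEval {a : ℕ} (h : a ≤ d) {b : CoordRing f} (hb : b ∈ piece f (d - a)) :
    Module.Dual k (dualModule d f).carrier :=
  LinearMap.applyₗ (⟨b, hb⟩ : piece f (d - a)) ∘ₗ
    LinearMap.proj (φ := (dualRep d f).space) (vertex n a h)

theorem dualEval_single_same {a : ℕ} (h : a ≤ d) {b : CoordRing f} (hb : b ∈ piece f (d - a))
    (s : Module.Dual k (piece f (d - a))) :
    dualEval h hb (Pi.single (M := (dualRep d f).space) (vertex n a h) s) = s ⟨b, hb⟩ :=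
  congrArg (fun s : Module.Dual k (piece f (d - a)) => s ⟨b, hb⟩)
    (Pi.single_eq_same (M := (dualRep d f).space) (vertex n a h) s)

theorem dualEval_single_of_ne {a : ℕ} (h : a ≤ d) {b : CoordRing f} (hb : b ∈ piece f (d - a))
    {v : BeilinsonQuiver n d} (hv : vertex n a h ≠ v) (s : (dualRep d f).space v) :
    dualEval h hb (Pi.single (M := (dualRep d f).space) v s) = 0 :=
  congrArg (fun s : Module.Dual k (piece f (d - a)) => s ⟨b, hb⟩)
    (Pi.single_eq_of_ne (M := (dualRep d f).space) hv s)

/-- Identities in `M` are proved through these pairings. Their second argument is an element of the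
whole coordinate ring with a proof of its degree, so degrees that are only provably equal cause no
transport. -/
theorem dual_ext {s t : (dualModule d f).carrier}
    (h : ∀ a (h : a ≤ d) (b : CoordRing f) (hb : b ∈ piece f (d - a)),
      dualEval h hb s = dualEval h hb t) : s = t := by
  refine funext fun v => LinearMap.ext fun b => ?_
  exact h v.level v.level_le b.1 b.2

theorem act_e (v : BeilinsonQuiver n d) (t : ∀ v, (dualRep d f).space v) :
    (dualModule d f).act (PathAlgebra.e k v) t = Pi.single v (t v) := by
  change (dualRep d f).algAct (RingQuot.mkAlgHom _ _ _) t = _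
  rw [QuiverRep.algAct, RingQuot.liftAlgHom_mkAlgHom_apply, FreeAlgebra.lift_ι_apply]
  rfl

theorem act_arrow {v w : BeilinsonQuiver n d} (h : v ⟶ w) (t : ∀ v, (dualRep d f).space v) :
    (dualModule d f).act (PathAlgebra.arrow k h) t = Pi.single w ((dualRep d f).map h (t v)) := by
  change (dualRep d f).algAct (RingQuot.mkAlgHom _ _ _) t = _
  rw [QuiverRep.algAct, RingQuot.liftAlgHom_mkAlgHom_apply, FreeAlgebra.lift_ι_apply]
  rfl

theorem vertex_ne {a b : ℕ} (hab : a ≠ b) (ha : a ≤ d) (hb : b ≤ d) :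
    vertex n a ha ≠ vertex n b hb := fun h => hab (congrArg level h)

theorem dualEval_e {a : ℕ} (h : a ≤ d) {b : CoordRing f} (hb : b ∈ piece f (d - a))
    (t : (dualModule d f).carrier) :
    dualEval h hb ((dualModule d f).act (PathAlgebra.e k (vertex n a h)) t) = dualEval h hb t := by
  exact (congrArg (dualEval h hb) (act_e (vertex n a h) t)).trans (dualEval_single_same h hb _)

theorem coord_mul_mem (i : Fin (n + 1)) {a : ℕ} (h : a + 1 ≤ d) {b : CoordRing f}
    (hb : b ∈ piece f (d - (a + 1))) : coord f i * b ∈ piece f (d - a) := by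
  have := SetLike.mul_mem_graded (coord_mem f i) hb
  rwa [show 1 + (d - (a + 1)) = d - a by omega] at this

theorem dualEval_x (i : Fin (n + 1)) {a : ℕ} (h : a + 1 ≤ d) {b : CoordRing f}
    (hb : b ∈ piece f (d - (a + 1))) (t : (dualModule d f).carrier) :
    dualEval h hb ((dualModule d f).act (x k i a h) t) =
      dualEval (Nat.le_of_succ_le h) (coord_mul_mem i h hb) t := by
  exact (congrArg (dualEval h hb) (act_arrow _ t)).trans (dualEval_single_same h hb _)

theorem dualEval_x_of_ne (i : Fin (n + 1)) {a c : ℕ} (hc : c + 1 ≤ d) (h : a ≤ d)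
    (hne : a ≠ c + 1) {b : CoordRing f} (hb : b ∈ piece f (d - a))
    (t : (dualModule d f).carrier) : dualEval h hb ((dualModule d f).act (x k i c hc) t) = 0 := by
  exact (congrArg (dualEval h hb) (act_arrow _ t)).trans
    (dualEval_single_of_ne h hb (vertex_ne hne h hc) _)

theorem dualModule_comm (i j : Fin (n + 1)) (a : ℕ) (h : a + 1 + 1 ≤ d) :
    (dualModule d f).act (x k j (a + 1) h * x k i a (Nat.le_of_succ_le h)) =
      (dualModule d f).act (x k i (a + 1) h * x k j a (Nat.le_of_succ_le h)) := by
  refine LinearMap.ext fun t => dual_ext fun c hc b hb => ?_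
  rw [map_mul, map_mul, Module.End.mul_apply, Module.End.mul_apply]
  by_cases hne : c = a + 1 + 1
  · subst hne
    rw [dualEval_x, dualEval_x, dualEval_x, dualEval_x]
    congr 2
    exact mul_left_comm _ _ _
  · rw [dualEval_x_of_ne _ _ _ hne, dualEval_x_of_ne _ _ _ hne]

/-- `M` as a representation of the Beilinson quiver. -/
noncomputable def dualAct (d : ℕ) (f : Fin r → MvPolynomial (Fin (n + 1)) k) :
    BeilinsonAction k (dualModule d f).carrier n d :=
  ofHom (dualModule d f).act dualModule_comm

theorem dualEval_E {a : ℕ} (h : a ≤ d) {b : CoordRing f} (hb : b ∈ piece f (d - a))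
    (t : (dualModule d f).carrier) : dualEval h hb ((dualAct d f).E a t) = dualEval h hb t := by
  rw [dualAct, ofHom_E dualModule_comm h, dualEval_e]

theorem dualEval_X (i : Fin (n + 1)) {a : ℕ} (h : a + 1 ≤ d) {b : CoordRing f}
    (hb : b ∈ piece f (d - (a + 1))) (t : (dualModule d f).carrier) :
    dualEval h hb ((dualAct d f).X i t) =
      dualEval (Nat.le_of_succ_le h) (coord_mul_mem i h hb) t := by
  rw [← dualEval_E, ← shift, ← dualEval_x]
  exact congrArg _ (DFunLike.congr_fun (ofHom_X_mul_E dualModule_comm i h) t)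

end BeilinsonQuiver

/-! ### The action of polynomials and of the coordinate ring -/

namespace BeilinsonAction

open MvPolynomial

variable {k : Type u} [Field k] {V V' : Type u} [AddCommGroup V] [Module k V] [AddCommGroup V']
  [Module k V'] {n d : ℕ}

open scoped IsMulCommutative in
/-- The action of polynomials on a representation. -/
noncomputable def polyAct (A : BeilinsonAction k V n d) :
    MvPolynomial (Fin (n + 1)) k →ₐ[k] Module.End k V :=
  haveI := Algebra.isMulCommutative_adjoin k (s := Set.range A.X) (by
    rintro _ ⟨i, rfl⟩ _ ⟨j, rfl⟩
    exact LinearMap.ext (A.comm i j))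
  (Algebra.adjoin k (Set.range A.X)).val.comp
    (aeval fun i => ⟨A.X i, Algebra.subset_adjoin ⟨i, rfl⟩⟩)

variable {A : BeilinsonAction k V n d} {A' : BeilinsonAction k V' n d}

theorem polyAct_X (i : Fin (n + 1)) : A.polyAct (MvPolynomial.X i) = A.X i := by
  simp [polyAct]

theorem polyAct_prod (m : ℕ) (w : Fin m → Fin (n + 1)) :
    A.polyAct (∏ i, MvPolynomial.X (w i)) = A.pathAct m w := by
  induction m with
  | zero => rw [Fin.prod_univ_zero, map_one]; rfl
  | succ m ih => rw [Fin.prod_univ_castSucc, mul_comm, map_mul, ih, polyAct_X]; rfl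

theorem pathAct_E (m : ℕ) (w : Fin m → Fin (n + 1)) (a : ℕ) (y : V) :
    A.pathAct m w (A.E a y) = A.E (a + m) (A.pathAct m w y) := by
  induction m with
  | zero => rfl
  | succ m ih => rw [pathAct_succ, pathAct_succ, ih, shift]; rfl

theorem polyAct_of_represents {m : ℕ} {c : (Fin m → Fin (n + 1)) → k}
    {p : MvPolynomial (Fin (n + 1)) k} (hc : BeilinsonQuiver.Represents c p) (y : V) :
    A.polyAct p y = ∑ w, c w • A.pathAct m w y := by
  rw [← hc, map_sum, LinearMap.sum_apply]
  refine Finset.sum_congr rfl fun w _ => ?_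
  rw [map_smul, polyAct_prod, LinearMap.smul_apply]

theorem polyAct_E {m : ℕ} {p : MvPolynomial (Fin (n + 1)) k} (hp : p.IsHomogeneous m) (a : ℕ)
    (y : V) : A.polyAct p (A.E a y) = A.E (a + m) (A.polyAct p y) := by
  obtain ⟨c, hc⟩ := exists_represents hp
  rw [polyAct_of_represents hc, polyAct_of_represents hc, map_sum]
  exact Finset.sum_congr rfl fun w _ => by rw [pathAct_E, map_smul]

theorem map_polyAct {ψ : V →ₗ[k] V'} (hψ : ψ ∈ hom A A') (p : MvPolynomial (Fin (n + 1)) k)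
    (y : V) : ψ (A.polyAct p y) = A'.polyAct p (ψ y) := by
  induction p using MvPolynomial.induction_on generalizing y with
  | C c =>
    rw [← algebraMap_eq, AlgHom.commutes, AlgHom.commutes, Module.algebraMap_end_apply,
      Module.algebraMap_end_apply, map_smul]
  | add p q hp hq => simp only [map_add, LinearMap.add_apply, hp, hq]
  | mul_X p i hp =>
    rw [map_mul, map_mul, Module.End.mul_apply, Module.End.mul_apply, hp, polyAct_X, polyAct_X,
      hψ.2]

theorem polyAct_mem {P : Submodule k V} (hP : A.IsStable P) (p : MvPolynomial (Fin (n + 1)) k)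
    {y : V} (hy : y ∈ P) : A.polyAct p y ∈ P := by
  induction p using MvPolynomial.induction_on generalizing y with
  | C c =>
    rw [← algebraMap_eq, AlgHom.commutes, Module.algebraMap_end_apply]
    exact P.smul_mem _ hy
  | add p q hp hq =>
    rw [map_add]
    exact P.add_mem (hp hy) (hq hy)
  | mul_X p i hp =>
    rw [map_mul, polyAct_X]
    exact hp (hP.2 i y hy)

variable {r : ℕ} {f : Fin r → MvPolynomial (Fin (n + 1)) k} {deg : Fin r → ℕ}

/-- At a vertex `a` with `a + deg j ≤ d` this is one of the relations; beyond that, `f j` leads past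
the last vertex. -/
theorem polyAct_eq_zero (hf : ∀ j, (f j).IsHomogeneous (deg j))
    (hA : A.Satisfies f deg fun _ => Set.univ) {p : MvPolynomial (Fin (n + 1)) k}
    (hp : p ∈ ProjEquations.ideal f) : A.polyAct p = 0 := by
  have : ProjEquations.ideal f ≤ RingHom.ker A.polyAct := by
    refine Ideal.span_le.2 ?_
    rintro _ ⟨j, rfl⟩
    refine LinearMap.ext fun y => ?_
    rw [← A.sum y, map_sum, LinearMap.zero_apply]
    refine Finset.sum_eq_zero fun a _ => ?_
    rcases Nat.lt_or_ge d (a + deg j) with h | h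
    · rw [polyAct_E (hf j), A.eq_zero _ h, LinearMap.zero_apply]
    · obtain ⟨c, hc⟩ := exists_represents (hf j)
      rw [polyAct_of_represents hc]
      exact hA j a trivial h c hc y
  exact this hp

/-- The action of the homogeneous coordinate ring on a representation that satisfies all
relations. -/
noncomputable def ringAct (A : BeilinsonAction k V n d) (hf : ∀ j, (f j).IsHomogeneous (deg j))
    (hA : A.Satisfies f deg fun _ => Set.univ) : ProjEquations.CoordRing f →ₐ[k] Module.End k V :=
  Ideal.Quotient.liftₐ (ProjEquations.ideal f) A.polyAct fun _ hp => polyAct_eq_zero hf hA hp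

theorem ringAct_coord (hf : ∀ j, (f j).IsHomogeneous (deg j))
    (hA : A.Satisfies f deg fun _ => Set.univ) (i : Fin (n + 1)) :
    A.ringAct hf hA (ProjEquations.coord f i) = A.X i := polyAct_X i

end BeilinsonAction

/-! ### `M` satisfies the relations -/

namespace BeilinsonQuiver

open MvPolynomial ProjEquations BeilinsonAction

variable {k : Type u} [Field k] {n r d : ℕ} {f : Fin r → MvPolynomial (Fin (n + 1)) k}

theorem dualEval_E_of_ne {a c : ℕ} (h : a ≤ d) (hne : a ≠ c) {b : CoordRing f}
    (hb : b ∈ piece f (d - a)) (t : (dualModule d f).carrier) :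
    dualEval h hb ((dualAct d f).E c t) = 0 := by
  rw [← dualEval_E, orth _ a c hne, map_zero]

theorem dualEval_zero_X (i : Fin (n + 1)) {b : CoordRing f} (hb : b ∈ piece f (d - 0))
    (t : (dualModule d f).carrier) : dualEval (Nat.zero_le d) hb ((dualAct d f).X i t) = 0 := by
  rw [← dualEval_E, E_zero_X, map_zero]

theorem mul_mem_piece {a m : ℕ} (h : a + m ≤ d) {b c : CoordRing f} (hb : b ∈ piece f m)
    (hc : c ∈ piece f (d - (a + m))) : b * c ∈ piece f (d - a) := by
  have := SetLike.mul_mem_graded hb hc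
  rwa [show m + (d - (a + m)) = d - a by omega] at this

theorem mk_prod_mem (m : ℕ) (w : Fin m → Fin (n + 1)) :
    Ideal.Quotient.mkₐ k (ideal f) (∏ i, MvPolynomial.X (w i)) ∈ piece f m := by
  refine mk_mem_piece f ?_
  have := IsHomogeneous.prod Finset.univ
    (fun i => (MvPolynomial.X (w i) : MvPolynomial (Fin (n + 1)) k)) (fun _ => 1)
    fun i _ => isHomogeneous_X k (w i)
  simpa using this

theorem dualEval_pathAct (m : ℕ) (w : Fin m → Fin (n + 1)) {a : ℕ} (h : a + m ≤ d)
    {b : CoordRing f} (hb : b ∈ piece f (d - (a + m))) (t : (dualModule d f).carrier) :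
    dualEval h hb ((dualAct d f).pathAct m w t) =
      dualEval (Nat.le_of_add_right_le h) (mul_mem_piece h (mk_prod_mem m w) hb) t := by
  induction m generalizing b with
  | zero =>
    change dualEval _ hb t = _
    congr 2
    simp
  | succ m ih =>
    rw [pathAct_succ]
    refine (dualEval_X _ h hb _).trans ?_
    rw [ih]
    congr 2
    rw [Fin.prod_univ_castSucc, map_mul, mul_assoc]
    rfl

theorem dualEval_sum {ι : Type*} [Fintype ι] (c : ι → k) (p : ι → CoordRing f) {a : ℕ} (h : a ≤ d)
    (hp : ∀ i, p i ∈ piece f (d - a)) {b : CoordRing f} (hb : b ∈ piece f (d - a))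
    (hsum : ∑ i, c i • p i = b) (t : (dualModule d f).carrier) :
    dualEval h hb t = ∑ i, c i * dualEval h (hp i) t := by
  have h1 : (⟨b, hb⟩ : piece f (d - a)) = ∑ i, c i • ⟨p i, hp i⟩ := Subtype.ext (by
    simp [← hsum])
  let l : Module.Dual k (piece f (d - a)) := t (vertex n a h)
  change l ⟨b, hb⟩ = ∑ i, c i * l ⟨p i, hp i⟩
  rw [h1, map_sum]
  exact Finset.sum_congr rfl fun i _ => by rw [map_smul, smul_eq_mul]

theorem dualEval_zero {a : ℕ} (h : a ≤ d) {b : CoordRing f} (hb : b ∈ piece f (d - a))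
    (h0 : b = 0) (t : (dualModule d f).carrier) : dualEval h hb t = 0 := by
  rw [dualEval_sum (ι := Fin 0) 0 0 h (fun i => i.elim0) hb (by simp [h0]), Finset.sum_of_isEmpty]

theorem dualEval_polyAct {m : ℕ} {p : MvPolynomial (Fin (n + 1)) k} (hp : p.IsHomogeneous m)
    {a : ℕ} (h : a + m ≤ d) {b : CoordRing f} (hb : b ∈ piece f (d - (a + m)))
    (t : (dualModule d f).carrier) : dualEval h hb ((dualAct d f).polyAct p t) =
      dualEval (Nat.le_of_add_right_le h) (mul_mem_piece h (mk_mem_piece f hp) hb) t := by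
  obtain ⟨c, hc⟩ := exists_represents hp
  rw [polyAct_of_represents hc, map_sum]
  rw [dualEval_sum c _ _ (fun w => mul_mem_piece h (mk_prod_mem m w) hb) (mul_mem_piece h (mk_mem_piece f hp) hb)]
  · exact Finset.sum_congr rfl fun w _ => by rw [map_smul, dualEval_pathAct, smul_eq_mul]
  · rw [Represents] at hc
    simp only [← hc, map_sum, Finset.sum_mul, map_smul, smul_mul_assoc]

theorem dualAct_satisfies (deg : Fin r → ℕ) (hf : ∀ j, (f j).IsHomogeneous (deg j))
    (T : Fin r → Set ℕ) : (dualAct d f).Satisfies f deg T := by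
  intro j a _ h c hc t
  refine (polyAct_of_represents hc _).symm.trans ?_
  rw [polyAct_E (hf j)]
  refine dual_ext fun a' ha' b hb => ?_
  rw [map_zero]
  by_cases hne : a' = a + deg j
  · subst hne
    rw [dualEval_E, dualEval_polyAct (hf j)]
    refine dualEval_zero _ _ ?_ t
    have hmem : f j ∈ ideal f := Ideal.subset_span ⟨j, rfl⟩
    rw [Ideal.Quotient.mkₐ_eq_mk, Ideal.Quotient.eq_zero_iff_mem.2 hmem, zero_mul]
  · rw [dualEval_E_of_ne ha' hne]

theorem act_eq_zero (deg : Fin r → ℕ) (hf : ∀ j, (f j).IsHomogeneous (deg j)) (T : Fin r → Set ℕ)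
    (y : PathAlgebra k (BeilinsonQuiver n d)) (hy : y ∈ relationIdeal d f deg T) :
    (dualModule d f).act y = 0 := by
  have hle : TwoSidedIdeal.span {y | IsRelation d f deg T y} ≤
      TwoSidedIdeal.ker (dualModule d f).act := by
    refine TwoSidedIdeal.span_le.2 ?_
    rintro _ (⟨i, j, a, h⟩ | ⟨j, a, ha, h, c, hc⟩)
    · rw [SetLike.mem_coe, TwoSidedIdeal.mem_ker, map_sub, dualModule_comm, sub_self]
    · rw [SetLike.mem_coe, TwoSidedIdeal.mem_ker]
      refine LinearMap.ext fun t => ?_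
      rw [LinearMap.zero_apply, ← dualAct_satisfies deg hf T j a ha h c hc t, map_sum,
        LinearMap.sum_apply]
      refine Finset.sum_congr rfl fun w _ => ?_
      rw [Algebra.smul_def, map_mul, map_path dualModule_comm, (dualModule d f).act_algebraMap]
      rfl
  exact (TwoSidedIdeal.mem_ker _).1 (hle hy)

/-! ### Injectivity of `M` -/

section Dual

variable {V : Type u} [AddCommGroup V] [Module k V] (A : BeilinsonAction k V n d) {deg : Fin r → ℕ}
  (hf : ∀ j, (f j).IsHomogeneous (deg j)) (hA : A.Satisfies f deg fun _ => Set.univ)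

/-- The homomorphism to `M` given by a linear form. -/
noncomputable def toDual (l : Module.Dual k V) : V →ₗ[k] (dualModule d f).carrier :=
  LinearMap.pi (φ := (dualRep d f).space) fun v =>
    (LinearMap.flip ((l.compRight k (M := V)) ∘ₗ (A.ringAct hf hA).toLinearMap ∘ₗ
      (piece f (d - v.level)).subtype)) ∘ₗ A.E v.level

variable {A hf hA}

theorem dualEval_toDual (l : Module.Dual k V) {a : ℕ} (h : a ≤ d) {b : CoordRing f}
    (hb : b ∈ piece f (d - a)) (y : V) :
    dualEval h hb (toDual A hf hA l y) = l (A.ringAct hf hA b (A.E a y)) := rfl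

theorem toDual_mem_hom (l : Module.Dual k V) : toDual A hf hA l ∈ hom A (dualAct d f) := by
  refine ⟨fun c y => dual_ext fun a h b hb => ?_, fun i y => dual_ext fun a h b hb => ?_⟩
  · rw [dualEval_toDual]
    rcases eq_or_ne a c with rfl | hne
    · rw [A.idem, dualEval_E, dualEval_toDual]
    · rw [A.orth a c hne, map_zero, map_zero, dualEval_E_of_ne h hne]
  · rw [dualEval_toDual]
    rcases a with _ | a
    · rw [E_zero_X, map_zero, map_zero, dualEval_zero_X]
    · rw [dualEval_X, dualEval_toDual, ← A.shift, mul_comm (coord f i), map_mul, ringAct_coord]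
      rfl

theorem one_mem_piece : (1 : CoordRing f) ∈ piece f (d - d) := by
  rw [Nat.sub_self]
  exact SetLike.one_mem_graded (piece f)

/-- An element of `M` is recovered from the pairing with `1` at vertex `d`, applied to its
translates by the coordinate ring. This is why homomorphisms to `M` correspond to linear forms at
vertex `d`. -/
theorem dualEval_eq_one (hM : (dualAct d f).Satisfies f deg fun _ => Set.univ) {a : ℕ} (h : a ≤ d)
    {b : CoordRing f} (hb : b ∈ piece f (d - a)) (t : (dualModule d f).carrier) :
    dualEval h hb t = dualEval le_rfl one_mem_piece ((dualAct d f).ringAct hf hM b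
      ((dualAct d f).E a t)) := by
  obtain ⟨p, hp, rfl⟩ := id hb
  have hp := (mem_homogeneousSubmodule _ _).1 hp
  change _ = dualEval le_rfl one_mem_piece ((dualAct d f).polyAct p ((dualAct d f).E a t))
  rw [← dualEval_E]
  -- The vertex `d` is replaced by a variable `e`, so that `e = a + (d - a)` can be substituted.
  have key : ∀ e (he : e ≤ d) (h1 : (1 : CoordRing f) ∈ piece f (d - e)), e = a + (d - a) →
      dualEval h hb ((dualAct d f).E a t) =
        dualEval he h1 ((dualAct d f).polyAct p ((dualAct d f).E a t)) := by
    rintro e he h1 rfl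
    rw [dualEval_polyAct hp]
    congr 2
    exact (mul_one _).symm
  exact key d le_rfl one_mem_piece (by omega)

end Dual

end BeilinsonQuiver

namespace BeilinsonQuiver

open MvPolynomial ProjEquations BeilinsonAction

variable {k : Type u} [Field k] {n r d : ℕ} {f : Fin r → MvPolynomial (Fin (n + 1)) k}
  {deg : Fin r → ℕ}

theorem isHom_iff {T : Fin r → Set ℕ} (N N' : ModuleFamily k (QuotAlgebra d f deg T) k)
    (g : N.carrier →ₗ[k] N'.carrier) :
    ModuleFamily.IsHom N N' g ↔ g ∈ hom N.toBeilinson N'.toBeilinson := by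
  constructor
  · intro h
    refine ⟨fun a y => ?_, fun i y => ?_⟩
    · rcases Nat.lt_or_ge d a with ha | ha
      · rw [eq_zero _ a ha, eq_zero _ a ha, LinearMap.zero_apply, LinearMap.zero_apply, map_zero]
      · rw [N.toBeilinson_E ha, N'.toBeilinson_E ha, h]
    · change g (varAct N.pathHom i y) = varAct N'.pathHom i (g y)
      rw [varAct, varAct, LinearMap.sum_apply, LinearMap.sum_apply, map_sum]
      exact Finset.sum_congr rfl fun a _ => h _ y
  · intro h y z
    obtain ⟨y, rfl⟩ := Ideal.Quotient.mk_surjective y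
    exact ModuleFamily.hom_map_pathHom h y z

variable (hM : ∀ a ∈ relationIdeal d f deg (fun _ => Set.univ), (dualModule d f).act a = 0)

theorem descend_toBeilinson :
    ((dualModule d f).descend _ hM).toBeilinson = dualAct d f := by
  have h : ((dualModule d f).descend _ hM).pathHom = (dualModule d f).act := RingHom.ext fun _ => rfl
  refine BeilinsonAction.ext ?_ ?_
  · change vertexAct ((dualModule d f).descend _ hM).pathHom = _
    rw [h]
    rfl
  · change varAct ((dualModule d f).descend _ hM).pathHom = _
    rw [h]
    rfl

theorem isHom_descend_iff (N : ModuleFamily k (QuotAlgebra d f deg fun _ => Set.univ) k)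
    (g : N.carrier →ₗ[k] (dualModule d f).carrier) :
    ModuleFamily.IsHom N ((dualModule d f).descend _ hM) g ↔
      g ∈ hom N.toBeilinson (dualAct d f) := by
  refine (isHom_iff N ((dualModule d f).descend _ hM) g).trans ?_
  exact iff_of_eq (congrArg (fun B => g ∈ hom N.toBeilinson B) (descend_toBeilinson hM))

theorem map_ringAct {V V' : Type u} [AddCommGroup V] [Module k V] [AddCommGroup V'] [Module k V']
    {A : BeilinsonAction k V n d} {A' : BeilinsonAction k V' n d}
    (hf : ∀ j, (f j).IsHomogeneous (deg j)) (hA : A.Satisfies f deg fun _ => Set.univ)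
    (hA' : A'.Satisfies f deg fun _ => Set.univ) {ψ : V →ₗ[k] V'} (hψ : ψ ∈ hom A A')
    (b : CoordRing f) (y : V) : ψ (A.ringAct hf hA b y) = A'.ringAct hf hA' b (ψ y) := by
  obtain ⟨p, rfl⟩ := Ideal.Quotient.mk_surjective b
  exact map_polyAct hψ p y

section

variable {V V' : Type u} [AddCommGroup V] [Module k V] [AddCommGroup V'] [Module k V']
  {A : BeilinsonAction k V n d} {A' : BeilinsonAction k V' n d}

/-- A `k`-linear retraction of `i` extends the linear form that corresponds to `g`, and the extended
form defines the homomorphism. -/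
theorem exists_hom_extension (hf : ∀ j, (f j).IsHomogeneous (deg j))
    (hA : A.Satisfies f deg fun _ => Set.univ) (hA' : A'.Satisfies f deg fun _ => Set.univ)
    {i : V →ₗ[k] V'} (hi : i ∈ hom A A') (hinj : Function.Injective i)
    {g : V →ₗ[k] (dualModule d f).carrier} (hg : g ∈ hom A (dualAct d f)) :
    ∃ h ∈ hom A' (dualAct d f), h ∘ₗ i = g := by
  obtain ⟨p, hp⟩ := LinearMap.exists_leftInverse_of_injective i (LinearMap.ker_eq_bot.2 hinj)
  refine ⟨toDual A' hf hA' (dualEval le_rfl one_mem_piece ∘ₗ g ∘ₗ p), toDual_mem_hom _,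
    LinearMap.ext fun y => dual_ext fun a h b hb => ?_⟩
  rw [LinearMap.comp_apply, dualEval_toDual, ← hi.1, ← map_ringAct hf hA hA' hi]
  change dualEval _ _ (g ((p ∘ₗ i) _)) = _
  rw [hp, LinearMap.id_apply, map_ringAct hf hA (dualAct_satisfies deg hf _) hg, hg.1]
  exact (dualEval_eq_one _ h hb _).symm

theorem ringAct_mem (hf : ∀ j, (f j).IsHomogeneous (deg j)) (hA : A.Satisfies f deg fun _ => Set.univ)
    {P : Submodule k V} (hP : A.IsStable P) (b : CoordRing f) {y : V} (hy : y ∈ P) :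
    A.ringAct hf hA b y ∈ P := by
  obtain ⟨p, rfl⟩ := Ideal.Quotient.mk_surjective b
  exact polyAct_mem hP p hy

/-- At vertex `d` the elements are linear forms on the degree zero part, which is spanned by `1`; so
this space is at most one-dimensional. -/
theorem eq_smul_of_mem_range_E (s t : (dualModule d f).carrier) (ht : (dualAct d f).E d t = t)
    (hs : (dualAct d f).E d s = s) :
    dualEval le_rfl one_mem_piece s • t = dualEval le_rfl one_mem_piece t • s := by
  refine dual_ext fun a h b hb => ?_
  rcases eq_or_ne a d with rfl | hne
  · obtain ⟨p, hp, rfl⟩ := id hb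
    have hp : p.IsHomogeneous 0 := by
      rw [← Nat.sub_self a]
      exact (mem_homogeneousSubmodule _ _).1 hp
    obtain ⟨c, hc⟩ := exists_represents hp
    have key : ∀ t : (dualModule a f).carrier,
        dualEval h hb t = c Fin.elim0 * dualEval h one_mem_piece t := by
      intro t
      rw [dualEval_sum (fun _ : Fin 1 => c Fin.elim0) (fun _ => 1) h (fun _ => one_mem_piece) hb,
        Fin.sum_univ_one]
      rw [Fin.sum_univ_one, ← hc, Fintype.sum_unique, map_smul, Fin.prod_univ_zero,
        AlgHom.toLinearMap_apply, map_one]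
      congr 2
    rw [map_smul, map_smul, smul_eq_mul, smul_eq_mul, key t, key s]
    ring
  · rw [← ht, ← hs, map_smul, map_smul, dualEval_E_of_ne h hne, dualEval_E_of_ne h hne, smul_zero,
      smul_zero]

/-- A linear form that is nonzero at vertex `d` is used. A nonzero kernel would contain all of
vertex `d`, which is reached from every vertex. A stable submodule with a nonzero pairing contains,
by `dualEval_eq_one`, a nonzero element of `M` at vertex `d`, and by one-dimensionality this lies in
the image. -/
theorem exists_essential_hom (hf : ∀ j, (f j).IsHomogeneous (deg j)) (hA : A.IsGood)
    (hS : A.Satisfies f deg fun _ => Set.univ) :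
    ∃ i ∈ hom A (dualAct d f), Function.Injective i ∧
      ∀ P : Submodule k (dualModule d f).carrier, (dualAct d f).IsStable P →
        P ⊓ LinearMap.range i = ⊥ → P = ⊥ := by
  obtain ⟨v, hv⟩ := exists_E_ne_zero (hA.rankOne d le_rfl)
  obtain ⟨l, hl⟩ := not_forall.1 (mt (Module.forall_dual_apply_eq_zero_iff k _).1 hv)
  have hM' := dualAct_satisfies (d := d) (f := f) deg hf fun _ => Set.univ
  have hom := toDual_mem_hom (hf := hf) (hA := hS) l
  have h1 : dualEval le_rfl one_mem_piece (toDual A hf hS l (A.E d v)) ≠ 0 := by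
    rw [dualEval_toDual, map_one, A.idem]
    exact hl
  refine ⟨toDual A hf hS l, hom, ?_, fun P hPs hdisj => ?_⟩
  · refine (injective_iff_map_eq_zero _).2 fun y hy => ?_
    rw [← A.sum y]
    refine Finset.sum_eq_zero fun a ha => ?_
    have had : a ≤ d := Nat.lt_succ_iff.1 (Finset.mem_range.1 ha)
    by_contra hne
    let P := LinearMap.ker (toDual A hf hS l)
    have hP : A.IsStable P := by
      refine ⟨fun a z hz => ?_, fun i z hz => ?_⟩
      · rw [LinearMap.mem_ker, hom.1, LinearMap.mem_ker.1 hz, map_zero]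
      · rw [LinearMap.mem_ker, hom.2, LinearMap.mem_ker.1 hz, map_zero]
    have hmem := range_E_le hA had le_rfl hP (hP.E_mem_of_ne_zero (hA.rankOne a had) hy hne) v
    exact h1 (by rw [LinearMap.mem_ker.1 hmem, map_zero])
  · refine (Submodule.eq_bot_iff P).2 fun p hp => dual_ext fun a h b hb => ?_
    rw [map_zero, dualEval_eq_one (hf := hf) hM' h hb, ← dualEval_E]
    set q := (dualAct d f).E d ((dualAct d f).ringAct hf hM' b ((dualAct d f).E a p)) with hq
    have hqP : q ∈ P := hPs.1 _ _ (ringAct_mem hf hM' hPs b (hPs.1 _ _ hp))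
    set w := toDual A hf hS l (A.E d v) with hw
    have hqE : (dualAct d f).E d q = q := (dualAct d f).idem _ _
    have hwE : (dualAct d f).E d w = w := by rw [hw, ← hom.1, A.idem]
    have hqw := eq_smul_of_mem_range_E w q hqE hwE
    have hmem : dualEval le_rfl one_mem_piece w • q ∈
        P ⊓ LinearMap.range (toDual A hf hS l) :=
      ⟨P.smul_mem _ hqP, by rw [hqw]; exact Submodule.smul_mem _ _ ⟨_, rfl⟩⟩
    rw [hdisj, Submodule.mem_bot] at hmem
    rw [(smul_eq_zero.1 hmem).resolve_left h1, map_zero]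

end

theorem descend_isInjective (hf : ∀ j, (f j).IsHomogeneous (deg j)) :
    ((dualModule d f).descend _ hM).IsInjective := by
  intro N N' i g hi hinj hg
  obtain ⟨h, hh, hhi⟩ := exists_hom_extension hf N.satisfies N'.satisfies
    ((isHom_iff N N' i).1 hi) hinj ((isHom_descend_iff hM N g).1 hg)
  exact ⟨h, (isHom_descend_iff hM N' h).2 hh, hhi⟩

theorem isInjectiveHull (hf : ∀ j, (f j).IsHomogeneous (deg j))
    (N : ModuleFamily k (QuotAlgebra d f deg fun _ => Set.univ) k)
    (hN : N.toBeilinson.IsGood) : N.IsInjectiveHull ((dualModule d f).descend _ hM) := by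
  obtain ⟨i, hi, hinj, hess⟩ := exists_essential_hom hf hN N.satisfies
  refine ⟨descend_isInjective hM hf, i, (isHom_descend_iff hM N i).2 hi, hinj, fun P hP hdisj =>
    hess P ?_ hdisj⟩
  have := (ModuleFamily.isStable_iff ((dualModule d f).descend _ hM) P).1 hP
  rwa [descend_toBeilinson hM] at this

end BeilinsonQuiver

/-! ### Stability -/

namespace BeilinsonAction

variable {K : Type u} [Field K] {V : Type u} [AddCommGroup V] [Module K V] {n d : ℕ}
  {B : BeilinsonAction K V n d}

theorem map_E_eq_bot {a : ℕ} {P : Submodule K V} (h : ∀ p ∈ P, B.E a p = 0) :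
    P.map (B.E a) = ⊥ := by
  refine (Submodule.eq_bot_iff _).2 ?_
  rintro _ ⟨p, hp, rfl⟩
  exact h p hp

end BeilinsonAction

namespace ModuleFamily

open BeilinsonQuiver BeilinsonAction

variable {k : Type u} [Field k] {n d r : ℕ}
  {f : Fin r → MvPolynomial (Fin (n + 1)) k} {deg : Fin r → ℕ} {T : Fin r → Set ℕ}
  {N : ModuleFamily k (QuotAlgebra d f deg T) k}

/-- The weight for which stability is indecomposability: `-1` at the source and `1` at the sink. -/
def beilinsonWeight (n d : ℕ) (v : BeilinsonQuiver n d) : ℤ :=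
  (if v = vertex n d le_rfl then 1 else 0) - if v = vertex n 0 (Nat.zero_le d) then 1 else 0

theorem weight_eq (P : Submodule k N.carrier) :
    N.weight (idem d f deg T) (beilinsonWeight n d) P =
      (Module.finrank k (P.map (N.toBeilinson.E d)) : ℤ) -
        Module.finrank k (P.map (N.toBeilinson.E 0)) := by
  rw [weight, toBeilinson_E N le_rfl, toBeilinson_E N (Nat.zero_le d)]
  simp only [beilinsonWeight, sub_mul, Finset.sum_sub_distrib, ite_mul, one_mul, zero_mul,
    Finset.sum_ite_eq', Finset.mem_univ, if_true]

theorem finrank_range_E (h : N.HasDimVector (idem d f deg T) (fun _ => 1)) {a : ℕ} (ha : a ≤ d) :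
    Module.finrank k (LinearMap.range (N.toBeilinson.E a)) = 1 := by
  have := h.2.2 (vertex n a ha) ⟨⊥, Ideal.isPrime_bot⟩
  rw [toBeilinson_E N ha]
  rwa [Module.rankAtStalk_eq_finrank_of_free] at this

theorem weight_top (h : N.HasDimVector (idem d f deg T) (fun _ => 1)) :
    N.weight (idem d f deg T) (beilinsonWeight n d) ⊤ = 0 := by
  rw [weight_eq, Submodule.map_top, Submodule.map_top, finrank_range_E h le_rfl,
    finrank_range_E h (Nat.zero_le d), sub_self]

theorem isGood_iff (h : N.HasDimVector (idem d f deg T) (fun _ => 1)) :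
    N.toBeilinson.IsGood ↔ N.IsIndecomposable := by
  have h' := (hasDimVector_iff N).1 h
  have := h'.1
  rw [isIndecomposable_iff, isGood_iff_isIndecomposable h'.2.2]

/-- A proper submodule has no component at the source, which generates, and a nonzero one contains
the sink; so its weight is `1 - 0`. -/
theorem IsIndecomposable.isThetaStable (h : N.HasDimVector (idem d f deg T) (fun _ => 1))
    (hN : N.IsIndecomposable) :
    N.IsThetaStable (idem d f deg T) (beilinsonWeight n d) := by
  refine ⟨hN.1, weight_top h, fun P hP hbot htop => ?_⟩
  have hg := (isGood_iff h).2 hN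
  rw [isStable_iff] at hP
  obtain ⟨p, hp, hp0⟩ := (Submodule.ne_bot_iff P).1 hbot
  have h0 : ∀ p ∈ P, N.toBeilinson.E 0 p = 0 := by
    intro p hp
    by_contra hne
    exact htop (eq_top_of_E_zero_ne_zero hg hP hp hne)
  obtain ⟨a, ha, hne⟩ : ∃ a ≤ d, N.toBeilinson.E a p ≠ 0 := by
    by_contra hcon
    push Not at hcon
    refine hp0 ?_
    rw [← N.toBeilinson.sum p]
    exact Finset.sum_eq_zero fun a ha => hcon a (Nat.lt_succ_iff.1 (Finset.mem_range.1 ha))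
  have hd := range_E_le hg ha le_rfl hP (hP.E_mem_of_ne_zero (hg.rankOne a ha) hp hne)
  have hmap : P.map (N.toBeilinson.E d) = LinearMap.range (N.toBeilinson.E d) := by
    refine le_antisymm LinearMap.map_le_range ?_
    rintro _ ⟨y, rfl⟩
    exact ⟨_, hd y, N.toBeilinson.idem d y⟩
  rw [weight_eq, map_E_eq_bot h0, hmap, finrank_range_E h le_rfl, finrank_bot]
  norm_num

/-- If all arrows out of `a` vanished, the part on the vertices `≤ a` would be a submodule of weight
`0 - 1`. -/
theorem IsSemistable.isIndecomposable (h : N.HasDimVector (idem d f deg T) (fun _ => 1))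
    (hN : N.IsSemistable (idem d f deg T) (beilinsonWeight n d)) : N.IsIndecomposable := by
  have h' := (hasDimVector_iff N).1 h
  have := h'.1
  rw [← isGood_iff h]
  refine ⟨inferInstance, inferInstance, h'.2.2, fun a ha => gen_iff_exists_ne_zero.2 ?_⟩
  by_contra hcon
  push Not at hcon
  have hst : N.toBeilinson.IsStable (N.toBeilinson.support (Set.Iic a)) :=
    support_isStable _ fun b hb hb' => by
      obtain rfl : b = a := by simp only [Set.mem_Iic] at hb hb'; omega
      exact hcon
  have hw := hN.2 _ ((isStable_iff N _).2 hst)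
  have hmap : (N.toBeilinson.support (Set.Iic a)).map (N.toBeilinson.E 0) =
      LinearMap.range (N.toBeilinson.E 0) := by
    refine le_antisymm LinearMap.map_le_range ?_
    rintro _ ⟨y, rfl⟩
    exact ⟨_, E_mem_support _ (Set.mem_Iic.2 (Nat.zero_le a)) y, N.toBeilinson.idem 0 y⟩
  have h0 : ∀ p ∈ N.toBeilinson.support (Set.Iic a), N.toBeilinson.E d p = 0 :=
    fun p hp => hp d (by simpa using ha)
  rw [weight_eq, map_E_eq_bot h0, hmap,
    finrank_range_E h (Nat.zero_le d), finrank_bot] at hw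
  norm_num at hw

theorem IsThetaStable.isSemistable {θ : BeilinsonQuiver n d → ℤ}
    (hN : N.IsThetaStable (idem d f deg T) θ) : N.IsSemistable (idem d f deg T) θ := by
  refine ⟨hN.2.1, fun P hP => ?_⟩
  rcases eq_or_ne P ⊥ with rfl | hbot
  · refine (Finset.sum_eq_zero fun v _ => ?_).ge
    rw [(Submodule.eq_bot_iff (Submodule.map (N.act (idem d f deg T v)) ⊥)).2, finrank_bot,
      Nat.cast_zero, mul_zero]
    rintro _ ⟨p, hp, rfl⟩
    rw [(Submodule.mem_bot k).1 hp, map_zero]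
  rcases eq_or_ne P ⊤ with rfl | htop
  · exact hN.2.1.ge
  · exact (hN.2.2 P hP hbot htop).le

theorem exists_weight : ∃ θ : BeilinsonQuiver n d → ℤ,
    ∀ N : ModuleFamily k (QuotAlgebra d f deg T) k,
      N.HasDimVector (idem d f deg T) (fun _ => 1) →
        (N.IsIndecomposable ↔ N.IsSemistable (idem d f deg T) θ) ∧
        (N.IsIndecomposable ↔ N.IsThetaStable (idem d f deg T) θ) :=
  ⟨beilinsonWeight n d, fun _ h =>
    ⟨⟨fun hN => (hN.isThetaStable h).isSemistable, fun hN => hN.isIndecomposable h⟩,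
      fun hN => hN.isThetaStable h, fun hN => hN.isSemistable.isIndecomposable h⟩⟩

end ModuleFamily

/-! ### A criterion for rank one, and subrepresentations -/

theorem Module.IsRankOneOn.of_smul_eq {R F : Type*} [CommRing R] [AddCommGroup F] [Module R F]
    {E : Module.End R F} {S : Set R} (hS : Ideal.span S = ⊤)
    (h : ∀ c ∈ S, ∃ (τ : F → R) (ε : F), ∀ t, c • E t = τ t • ε)
    (hspan : Ideal.span {c | ∃ (l : Module.Dual R F) (x : F), l (E x) = c} = ⊤) :
    Module.IsRankOneOn E := by
  refine ⟨fun l x y => ?_, hspan⟩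
  -- The square is needed because one factor `c` is spent on `E x` and one on `E y`.
  refine eq_of_forall_smul_eq (Ideal.span_pow_eq_top S hS 2) ?_
  rintro _ ⟨c, hc, rfl⟩
  obtain ⟨τ, ε, hτ⟩ := h c hc
  have key : ∀ x y, c ^ 2 • l (E x) • E y = (τ x * τ y * l ε) • ε := fun x y => by
    rw [pow_two, mul_smul, smul_comm c (l (E x)), hτ, smul_smul c, ← smul_eq_mul c, ← map_smul, hτ,
      map_smul, smul_smul, smul_eq_mul]
    congr 1
    ring
  simp only [key, mul_comm (τ x)]

namespace BeilinsonAction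

variable {R : Type u} [CommRing R] {F : Type u} [AddCommGroup F] [Module R F] {n d : ℕ}

/-- A subrepresentation. -/
def restrict (A : BeilinsonAction R F n d) {P : Submodule R F} (hP : A.IsStable P) :
    BeilinsonAction R P n d where
  E a := (A.E a).restrict (hP.1 a)
  X i := (A.X i).restrict (hP.2 i)
  idem a y := Subtype.ext (A.idem a y)
  orth a b h y := Subtype.ext (A.orth a b h y)
  eq_zero a h := LinearMap.ext fun y => Subtype.ext (DFunLike.congr_fun (A.eq_zero a h) y.1)
  sum y := Subtype.ext (by
    rw [AddSubmonoidClass.coe_finsetSum]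
    exact A.sum y)
  shift i a y := Subtype.ext (A.shift i a y)
  comm i j y := Subtype.ext (A.comm i j y)

variable {A : BeilinsonAction R F n d} {P : Submodule R F} (hP : A.IsStable P)

theorem coe_restrict_E (a : ℕ) (y : P) : ((A.restrict hP).E a y : F) = A.E a y := rfl

theorem coe_restrict_X (i : Fin (n + 1)) (y : P) : ((A.restrict hP).X i y : F) = A.X i y := rfl

theorem rankAtStalk_restrict_E (a : ℕ) (p : PrimeSpectrum R) :
    Module.rankAtStalk (LinearMap.range ((A.restrict hP).E a)) p =
      Module.rankAtStalk (P.map (A.E a)) p := by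
  have h : (LinearMap.range ((A.restrict hP).E a)).map P.subtype = P.map (A.E a) := by
    ext t
    constructor
    · rintro ⟨_, ⟨p, rfl⟩, rfl⟩
      exact ⟨p.1, p.2, rfl⟩
    · rintro ⟨p, hp, rfl⟩
      exact ⟨_, ⟨⟨p, hp⟩, rfl⟩, rfl⟩
  rw [← h, Module.rankAtStalk_eq_of_equiv
    (Submodule.equivMapOfInjective P.subtype P.injective_subtype _)]

theorem coe_restrict_pathAct (m : ℕ) (w : Fin m → Fin (n + 1)) (y : P) :
    ((A.restrict hP).pathAct m w y : F) = A.pathAct m w y := by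
  induction m with
  | zero => rfl
  | succ m ih => rw [pathAct_succ, pathAct_succ, coe_restrict_X, ih]

theorem pathAct_baseChange (R' : Type u) [CommRing R'] [Algebra R R'] (m : ℕ)
    (w : Fin m → Fin (n + 1)) (c : R') (y : F) :
    (A.baseChange R').pathAct m w (c ⊗ₜ y) = c ⊗ₜ A.pathAct m w y := by
  induction m with
  | zero => rfl
  | succ m ih => rw [pathAct_succ, pathAct_succ, ih]; rfl

section

variable {k : Type u} [Field k] [Algebra k R] {r : ℕ} {f : Fin r → MvPolynomial (Fin (n + 1)) k}
  {deg : Fin r → ℕ} {T : Fin r → Set ℕ}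

theorem Satisfies.restrict (h : A.Satisfies f deg T) : (A.restrict hP).Satisfies f deg T := by
  intro j a ha hle c hc y
  refine Subtype.ext ?_
  rw [AddSubmonoidClass.coe_finsetSum, Submodule.coe_zero, ← h j a ha hle c hc y]
  exact Finset.sum_congr rfl fun w _ => congrArg _ (coe_restrict_pathAct hP _ _ _)

theorem Satisfies.baseChange (h : A.Satisfies f deg T) (R' : Type u) [CommRing R'] [Algebra k R']
    [Algebra R R'] [IsScalarTower k R R'] : (A.baseChange R').Satisfies f deg T := by
  intro j a ha hle c hc t
  induction t with
  | zero => simp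
  | add s t hs ht => simp only [map_add, smul_add, Finset.sum_add_distrib, hs, ht, add_zero]
  | tmul b y =>
    have h1 := congrArg (TensorProduct.mk R R' F b) (h j a ha hle c hc y)
    rw [map_sum, map_zero] at h1
    rw [← h1]
    refine Finset.sum_congr rfl fun w _ => ?_
    change _ • (A.baseChange R').pathAct _ _ (b ⊗ₜ A.E a y) = _
    rw [pathAct_baseChange, map_smul, IsScalarTower.algebraMap_apply k R R', algebraMap_smul]
    rfl

end

end BeilinsonAction

/-! ### The module `M` over a `k`-algebra -/

namespace BeilinsonQuiver

open MvPolynomial ProjEquations BeilinsonAction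

variable {k : Type u} [Field k] {n r d : ℕ} {f : Fin r → MvPolynomial (Fin (n + 1)) k}
  {R : Type u} [CommRing R] [Algebra k R]

instance piece_finite (m : ℕ) : Module.Finite k (piece f m) := by
  have h : homogeneousSubmodule (Fin (n + 1)) k m ≤ LinearMap.range
      (Fintype.linearCombination k fun w : Fin m → Fin (n + 1) =>
        ∏ i, (MvPolynomial.X (w i) : MvPolynomial (Fin (n + 1)) k)) := fun p hp =>
    exists_represents ((mem_homogeneousSubmodule m p).1 hp)
  have := Submodule.finiteDimensional_of_le h
  exact Module.Finite.map _ _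

instance dualModule_finite : Module.Finite k (dualModule d f).carrier := by
  have (v : BeilinsonQuiver n d) : Module.Finite k ((dualRep d f).space v) :=
    inferInstanceAs (Module.Finite k (Module.Dual k (piece f (d - v.level))))
  exact Module.Finite.pi

/-- `M` over a `k`-algebra `R`. -/
noncomputable def dualActOver (R : Type u) [CommRing R] [Algebra k R] (d : ℕ)
    (f : Fin r → MvPolynomial (Fin (n + 1)) k) :
    BeilinsonAction R (R ⊗[k] (dualModule d f).carrier) n d :=
  (dualAct d f).baseChange R

/-- The value of an element of `M` over `R` at an element of the coordinate ring. -/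
noncomputable def dualEvalOver (R : Type u) [CommRing R] [Algebra k R] {a : ℕ} (h : a ≤ d)
    {b : CoordRing f} (hb : b ∈ piece f (d - a)) :
    Module.Dual R (R ⊗[k] (dualModule d f).carrier) :=
  Module.Dual.baseChange R (dualEval h hb)

theorem dualEvalOver_tmul {a : ℕ} (h : a ≤ d) {b : CoordRing f} (hb : b ∈ piece f (d - a)) (c : R)
    (t : (dualModule d f).carrier) : dualEvalOver R h hb (c ⊗ₜ t) = dualEval h hb t • c :=
  Module.Dual.baseChange_apply_tmul R _ c t

theorem dualEvalOver_E {a : ℕ} (h : a ≤ d) {b : CoordRing f} (hb : b ∈ piece f (d - a))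
    (t : R ⊗[k] (dualModule d f).carrier) :
    dualEvalOver R h hb ((dualActOver R d f).E a t) = dualEvalOver R h hb t := by
  induction t with
  | zero => simp
  | add s t hs ht => simp only [map_add, hs, ht]
  | tmul c t =>
    change dualEvalOver R h hb (c ⊗ₜ (dualAct d f).E a t) = _
    rw [dualEvalOver_tmul, dualEvalOver_tmul, dualEval_E]

theorem dualEvalOver_E_of_ne {a c : ℕ} (h : a ≤ d) (hne : a ≠ c) {b : CoordRing f}
    (hb : b ∈ piece f (d - a)) (t : R ⊗[k] (dualModule d f).carrier) :
    dualEvalOver R h hb ((dualActOver R d f).E c t) = 0 := by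
  rw [← dualEvalOver_E, orth _ a c hne, map_zero]

theorem dualEvalOver_X (i : Fin (n + 1)) {a : ℕ} (h : a + 1 ≤ d) {b : CoordRing f}
    (hb : b ∈ piece f (d - (a + 1))) (t : R ⊗[k] (dualModule d f).carrier) :
    dualEvalOver R h hb ((dualActOver R d f).X i t) =
      dualEvalOver R (Nat.le_of_succ_le h) (coord_mul_mem i h hb) t := by
  induction t with
  | zero => simp
  | add s t hs ht => simp only [map_add, hs, ht]
  | tmul c t =>
    change dualEvalOver R h hb (c ⊗ₜ (dualAct d f).X i t) = _
    rw [dualEvalOver_tmul, dualEvalOver_tmul, dualEval_X]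

theorem dualEvalOver_sum {ι : Type*} [Fintype ι] (c : ι → k) (p : ι → CoordRing f) {a : ℕ}
    (h : a ≤ d) (hp : ∀ i, p i ∈ piece f (d - a)) {b : CoordRing f} (hb : b ∈ piece f (d - a))
    (hsum : ∑ i, c i • p i = b) (t : R ⊗[k] (dualModule d f).carrier) :
    dualEvalOver R h hb t = ∑ i, c i • dualEvalOver R h (hp i) t := by
  induction t with
  | zero => simp
  | add s t hs ht => simp only [map_add, smul_add, Finset.sum_add_distrib, hs, ht]
  | tmul z t =>
    simp only [dualEvalOver_tmul]
    rw [dualEval_sum c p h hp hb hsum, Finset.sum_smul]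
    exact Finset.sum_congr rfl fun i _ => mul_smul _ _ _

/-- The elements of a basis of `M` that is dual to bases of the components of the coordinate
ring. -/
noncomputable def dualBasis (v : BeilinsonQuiver n d)
    (i : Fin (Module.finrank k (piece f (d - v.level)))) : (dualModule d f).carrier :=
  Pi.single (M := (dualRep d f).space) v ((Module.finBasis k (piece f (d - v.level))).coord i)

theorem sum_finBasis {m : ℕ} {b : CoordRing f} (hb : b ∈ piece f m) :
    ∑ i, (Module.finBasis k (piece f m)).repr ⟨b, hb⟩ i • (Module.finBasis k (piece f m) i).1 =
      b := by
  have := congrArg Subtype.val ((Module.finBasis k (piece f m)).sum_repr ⟨b, hb⟩)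
  rwa [AddSubmonoidClass.coe_finsetSum] at this

theorem dualEval_dualBasis {a : ℕ} (h : a ≤ d) {b : CoordRing f} (hb : b ∈ piece f (d - a))
    (i : Fin (Module.finrank k (piece f (d - a)))) :
    dualEval h hb (dualBasis (vertex n a h) i) =
      (Module.finBasis k (piece f (d - a))).repr ⟨b, hb⟩ i :=
  dualEval_single_same h hb _

theorem sum_dualBasis (t : R ⊗[k] (dualModule d f).carrier) :
    ∑ v : BeilinsonQuiver n d, ∑ i, dualEvalOver R v.level_le
      (Module.finBasis k (piece f (d - v.level)) i).2 t • (1 : R) ⊗ₜ[k] dualBasis v i = t := by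
  induction t with
  | zero => simp
  | add s t hs ht => simp only [map_add, add_smul, Finset.sum_add_distrib, hs, ht]
  | tmul c t =>
    have h1 : ∑ v : BeilinsonQuiver n d, ∑ i, dualEval v.level_le
        (Module.finBasis k (piece f (d - v.level)) i).2 t • dualBasis v i = t := by
      refine dual_ext fun a h b hb => ?_
      rw [map_sum, Finset.sum_eq_single (vertex n a h)]
      · rw [map_sum, dualEval_sum _ _ h (fun i => Subtype.prop _) hb (sum_finBasis hb)]
        refine Finset.sum_congr rfl fun i _ => ?_
        rw [map_smul, smul_eq_mul, mul_comm]
        exact congrArg (· * _) (dualEval_dualBasis h hb i)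
      · intro v _ hv
        rw [map_sum]
        refine Finset.sum_eq_zero fun i _ => ?_
        rw [map_smul]
        refine (congrArg _ (dualEval_single_of_ne h hb hv.symm _)).trans (smul_zero _)
      · simp
    conv_rhs => rw [← h1]
    rw [TensorProduct.tmul_sum]
    refine Finset.sum_congr rfl fun v _ => ?_
    rw [TensorProduct.tmul_sum]
    refine Finset.sum_congr rfl fun i _ => ?_
    rw [dualEvalOver_tmul, TensorProduct.smul_tmul', TensorProduct.tmul_smul,
      TensorProduct.smul_tmul', smul_eq_mul, mul_one]

theorem dualOver_ext {s t : R ⊗[k] (dualModule d f).carrier}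
    (h : ∀ a (h : a ≤ d) (b : CoordRing f) (hb : b ∈ piece f (d - a)),
      dualEvalOver R h hb s = dualEvalOver R h hb t) : s = t := by
  rw [← sum_dualBasis s, ← sum_dualBasis t]
  exact Finset.sum_congr rfl fun v _ => Finset.sum_congr rfl fun i _ => by rw [h]

/-- The element of `M` over `R` at a vertex given by a linear form on the coordinate ring. -/
noncomputable def ofForm {a : ℕ} (h : a ≤ d) (g : CoordRing f →ₗ[k] R) :
    R ⊗[k] (dualModule d f).carrier :=
  ∑ i, g (Module.finBasis k (piece f (d - a)) i).1 ⊗ₜ[k] dualBasis (vertex n a h) i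

theorem dualEvalOver_ofForm {a : ℕ} (h : a ≤ d) (g : CoordRing f →ₗ[k] R) {b : CoordRing f}
    (hb : b ∈ piece f (d - a)) : dualEvalOver R h hb (ofForm h g) = g b := by
  conv_rhs => rw [← sum_finBasis hb]
  rw [ofForm, map_sum, map_sum]
  refine Finset.sum_congr rfl fun i _ => ?_
  rw [dualEvalOver_tmul, dualEval_dualBasis, map_smul]

theorem dualEvalOver_ofForm_of_ne {a c : ℕ} (h : a ≤ d) (hc : c ≤ d) (hne : c ≠ a)
    (g : CoordRing f →ₗ[k] R) {b : CoordRing f} (hb : b ∈ piece f (d - c)) :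
    dualEvalOver R hc hb (ofForm h g) = 0 := by
  rw [ofForm, map_sum]
  refine Finset.sum_eq_zero fun i _ => ?_
  rw [dualEvalOver_tmul]
  exact (congrArg (· • _) (dualEval_single_of_ne hc hb (vertex_ne hne hc h) _)).trans (zero_smul _ _)

end BeilinsonQuiver

/-! ### The submodule of `M` that belongs to a line -/

namespace BeilinsonQuiver

open MvPolynomial ProjEquations BeilinsonAction

variable {k : Type u} [Field k] {n r d : ℕ} {f : Fin r → MvPolynomial (Fin (n + 1)) k}
  {R : Type u} [CommRing R] [Algebra k R] {N : Submodule R (Fin (n + 1) → R)}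

/-- The submodule of `M` over `R` on which the variables act with given ratios. -/
noncomputable def gr (d : ℕ) (f : Fin r → MvPolynomial (Fin (n + 1)) k)
    (N : Submodule R (Fin (n + 1) → R)) : Submodule R (R ⊗[k] (dualModule d f).carrier) where
  carrier := {t | ∀ u ∈ N, ∀ i j,
    u i • (dualActOver R d f).X j t = u j • (dualActOver R d f).X i t}
  add_mem' hs ht u hu i j := by rw [map_add, map_add, smul_add, smul_add, hs u hu, ht u hu]
  zero_mem' u hu i j := by simp
  smul_mem' c t ht u hu i j := by
    rw [map_smul, map_smul, smul_comm, ht u hu, smul_comm]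

theorem gr_isStable : (dualActOver R d f).IsStable (gr d f N) := by
  refine ⟨fun a t ht u hu i j => ?_, fun l t ht u hu i j => ?_⟩
  · rw [shift, shift, ← map_smul, ht u hu, map_smul]
  · rw [comm _ j l, comm _ i l, ← map_smul ((dualActOver R d f).X l), ht u hu, map_smul]

theorem coord_pow_mem (j : Fin (n + 1)) (m : ℕ) : coord f j ^ m ∈ piece f m := by
  have := SetLike.pow_mem_graded m (coord_mem f j)
  rwa [smul_eq_mul, mul_one] at this

theorem smul_dualEvalOver_coord {u : Fin (n + 1) → R} (hu : u ∈ N)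
    {t : R ⊗[k] (dualModule d f).carrier} (ht : t ∈ gr d f N) (i j : Fin (n + 1)) {a : ℕ}
    (h : a + 1 ≤ d) {b : CoordRing f} (hb : b ∈ piece f (d - (a + 1))) :
    u i * dualEvalOver R (Nat.le_of_succ_le h) (coord_mul_mem j h hb) t =
      u j * dualEvalOver R (Nat.le_of_succ_le h) (coord_mul_mem i h hb) t := by
  have := congrArg (dualEvalOver R h hb) (ht u hu i j)
  rwa [map_smul, map_smul, dualEvalOver_X, dualEvalOver_X] at this

theorem dualEvalOver_congr {a : ℕ} {h : a ≤ d} {b c : CoordRing f} {hb : b ∈ piece f (d - a)}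
    {hc : c ∈ piece f (d - a)} (hbc : b = c) (t : R ⊗[k] (dualModule d f).carrier) :
    dualEvalOver R h hb t = dualEvalOver R h hc t := by
  subst hbc
  rfl

/-- Each step exchanges one variable `x_i` for `x_j`, at the cost of replacing a factor `u j` by `u
i`. -/
theorem pow_mul_dualEvalOver_prod {u : Fin (n + 1) → R} (hu : u ∈ N) (j : Fin (n + 1)) {a : ℕ}
    {t : R ⊗[k] (dualModule d f).carrier} (ht : t ∈ gr d f N) (m : ℕ) (w : Fin m → Fin (n + 1))
    (h : a + m ≤ d) {b : CoordRing f} (hb : b ∈ piece f (d - (a + m))) :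
    u j ^ m * dualEvalOver R (Nat.le_of_add_right_le h)
      (mul_mem_piece h (mk_prod_mem m w) hb) t =
      (∏ i, u (w i)) * dualEvalOver R (Nat.le_of_add_right_le h)
        (mul_mem_piece h (coord_pow_mem j m) hb) t := by
  induction m generalizing b with
  | zero =>
    refine congrArg₂ _ (by simp) (dualEvalOver_congr ?_ t)
    simp
  | succ m ih =>
    let i := w (Fin.last m)
    let q := Ideal.Quotient.mkₐ k (ideal f) (∏ i : Fin m, MvPolynomial.X (w i.castSucc))
    have hle : a + 1 ≤ d := by omega
    have hq : ∀ q : CoordRing f, q ∈ piece f m → q * b ∈ piece f (d - (a + 1)) := fun q hq =>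
      mul_mem_piece (by omega) hq (by rwa [show a + 1 + m = a + (m + 1) by omega])
    have hb' : ∀ l, coord f l * b ∈ piece f (d - (a + m)) := fun l => coord_mul_mem l h hb
    have e1 : dualEvalOver R (Nat.le_of_add_right_le h) (mul_mem_piece h (mk_prod_mem _ w) hb) t =
        dualEvalOver R (Nat.le_of_succ_le hle) (coord_mul_mem i hle (hq q (mk_prod_mem m _))) t := by
      refine dualEvalOver_congr ?_ t
      rw [Fin.prod_univ_castSucc, map_mul, mul_comm (Ideal.Quotient.mkₐ k _ _), mul_assoc]
      rfl
    have e2 := smul_dualEvalOver_coord hu ht j i hle (hq q (mk_prod_mem m _))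
    have e3 : dualEvalOver R (Nat.le_of_succ_le hle) (coord_mul_mem j hle
        (hq q (mk_prod_mem m _))) t = dualEvalOver R (Nat.le_of_add_right_le h)
          (mul_mem_piece (Nat.le_of_succ_le h) (mk_prod_mem m _) (hb' j)) t :=
      dualEvalOver_congr (mul_left_comm _ _ _) t
    have e4 := ih (fun i => w i.castSucc) (Nat.le_of_succ_le h) (hb' j)
    rw [e1, pow_succ, mul_assoc, e2, e3, mul_left_comm, e4, Fin.prod_univ_castSucc]
    rw [mul_comm (∏ i : Fin m, _) (u (w (Fin.last m))), mul_assoc]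
    refine congrArg _ (congrArg _ (dualEvalOver_congr ?_ t))
    rw [pow_succ, mul_assoc]

theorem pow_mul_dualEvalOver {u : Fin (n + 1) → R} (hu : u ∈ N) (hz : IsZero f u)
    (j : Fin (n + 1)) {t : R ⊗[k] (dualModule d f).carrier} (ht : t ∈ gr d f N) {a : ℕ}
    (h : a ≤ d) {b : CoordRing f} (hb : b ∈ piece f (d - a)) :
    u j ^ (d - a) * dualEvalOver R h hb t =
      evalAt hz b * dualEvalOver R h (coord_pow_mem j (d - a)) t := by
  obtain ⟨p, hp, rfl⟩ := id hb
  have hp := (mem_homogeneousSubmodule _ _).1 hp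
  obtain ⟨c, hc⟩ := exists_represents hp
  have hle : a + (d - a) ≤ d := by omega
  have h1 : (1 : CoordRing f) ∈ piece f (d - (a + (d - a))) := by
    rw [show d - (a + (d - a)) = 0 by omega]
    exact SetLike.one_mem_graded _
  have key : dualEvalOver R h hb t =
      ∑ w, c w • dualEvalOver R h (mul_mem_piece hle (mk_prod_mem (d - a) w) h1) t := by
    refine dualEvalOver_sum c _ h _ hb ?_ t
    rw [Represents] at hc
    simp only [← hc, mul_one, map_sum, map_smul]
    rfl
  have h2 : dualEvalOver R h (coord_pow_mem j (d - a)) t =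
      dualEvalOver R h (mul_mem_piece hle (coord_pow_mem j (d - a)) h1) t :=
    dualEvalOver_congr (mul_one _).symm t
  rw [key, h2, Finset.mul_sum]
  change _ = aeval u p * _
  rw [← hc, map_sum, Finset.sum_mul]
  refine Finset.sum_congr rfl fun w _ => ?_
  rw [mul_smul_comm, pow_mul_dualEvalOver_prod hu j ht (d - a) w hle h1, map_smul, map_prod, smul_mul_assoc]
  simp only [aeval_X]

/-- An element of degree `d - a` can be traded for `x_j ^ (d - a)`, so the form `t` is determined by
its value there. Up to `u j ^ (d - a)`, vertex `a` is thus generated by evaluation at `u`. -/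
theorem pow_smul_E {u : Fin (n + 1) → R} (hu : u ∈ N) (hz : IsZero f u) (j : Fin (n + 1))
    {t : R ⊗[k] (dualModule d f).carrier} (ht : t ∈ gr d f N) {a : ℕ} (h : a ≤ d) :
    u j ^ (d - a) • (dualActOver R d f).E a t =
      dualEvalOver R h (coord_pow_mem j (d - a)) t • ofForm h (evalAt hz).toLinearMap := by
  refine dualOver_ext fun c hc b hb => ?_
  rw [map_smul, map_smul, smul_eq_mul, smul_eq_mul]
  rcases eq_or_ne c a with rfl | hne
  · rw [dualEvalOver_E, pow_mul_dualEvalOver hu hz j ht, dualEvalOver_ofForm, mul_comm]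
    rfl
  · rw [dualEvalOver_E_of_ne hc hne, dualEvalOver_ofForm_of_ne h hc hne, mul_zero, mul_zero]

theorem E_ofForm {a : ℕ} (h : a ≤ d) (g : CoordRing f →ₗ[k] R) :
    (dualActOver R d f).E a (ofForm h g) = ofForm h g := by
  refine dualOver_ext fun c hc b hb => ?_
  rcases eq_or_ne c a with rfl | hne
  · rw [dualEvalOver_E]
  · rw [dualEvalOver_E_of_ne hc hne, dualEvalOver_ofForm_of_ne h hc hne]

theorem ofForm_mem_gr (hN : IsLine f N) {u : Fin (n + 1) → R} (hu : u ∈ N) (hz : IsZero f u)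
    {a : ℕ} (h : a ≤ d) : ofForm h (evalAt hz).toLinearMap ∈ gr d f N := by
  intro v hv i j
  refine dualOver_ext fun c hc b hb => ?_
  rw [map_smul, map_smul, smul_eq_mul, smul_eq_mul]
  rcases c with _ | c
  · rw [← dualEvalOver_E, E_zero_X, map_zero, ← dualEvalOver_E, E_zero_X, map_zero, mul_zero,
      mul_zero]
  · rw [dualEvalOver_X, dualEvalOver_X]
    rcases eq_or_ne c a with rfl | hne
    · rw [dualEvalOver_ofForm, dualEvalOver_ofForm, AlgHom.toLinearMap_apply,
        AlgHom.toLinearMap_apply, map_mul, map_mul, evalAt_coord, evalAt_coord, ← mul_assoc,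
        ← mul_assoc, hN.minors v hv u hu]
    · rw [dualEvalOver_ofForm_of_ne _ _ hne, dualEvalOver_ofForm_of_ne _ _ hne, mul_zero, mul_zero]

theorem span_pow_eq_top (hN : IsLine f N) (m : ℕ) :
    Ideal.span {c | ∃ u ∈ N, ∃ i, u i ^ m = c} = ⊤ := by
  refine top_unique ((Ideal.span_pow_eq_top _ hN.unimodular m).symm.le.trans (Ideal.span_mono ?_))
  rintro _ ⟨_, ⟨u, hu, i, rfl⟩, rfl⟩
  exact ⟨u, hu, i, rfl⟩

theorem exists_vertex_projection (hN : IsLine f N) {a : ℕ} (h : a ≤ d) :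
    ∃ π : (R ⊗[k] (dualModule d f).carrier) →ₗ[R] gr d f N,
      ∀ t : gr d f N, (π t.1 : R ⊗[k] (dualModule d f).carrier) = (dualActOver R d f).E a t.1 := by
  suffices hc : ∀ c ∈ Ideal.span {c | ∃ u ∈ N, ∃ i, u i ^ (d - a) = c},
      ∃ π : (R ⊗[k] (dualModule d f).carrier) →ₗ[R] gr d f N, ∀ t : gr d f N,
        (π t.1 : R ⊗[k] (dualModule d f).carrier) = c • (dualActOver R d f).E a t.1 by
    simpa using hc 1 (span_pow_eq_top hN (d - a) ▸ Submodule.mem_top)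
  intro c hc
  induction hc using Submodule.span_induction with
  | mem c hc =>
    obtain ⟨u, hu, j, rfl⟩ := hc
    refine ⟨(dualEvalOver R h (coord_pow_mem j (d - a))).smulRight
      ⟨_, ofForm_mem_gr hN hu (hN.isZero u hu) h⟩, fun t => ?_⟩
    exact (pow_smul_E hu (hN.isZero u hu) j t.2 h).symm
  | zero => exact ⟨0, fun t => by simp⟩
  | add x y _ _ hx hy =>
    obtain ⟨π, hπ⟩ := hx
    obtain ⟨ρ, hρ⟩ := hy
    exact ⟨π + ρ, fun t => by rw [LinearMap.add_apply, Submodule.coe_add, hπ, hρ, add_smul]⟩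
  | smul b x _ hx =>
    obtain ⟨π, hπ⟩ := hx
    exact ⟨b • π, fun t => by rw [LinearMap.smul_apply, Submodule.coe_smul, hπ, smul_assoc]⟩

theorem exists_gr_projection (hN : IsLine f N) :
    ∃ π : (R ⊗[k] (dualModule d f).carrier) →ₗ[R] gr d f N, ∀ t : gr d f N, π t.1 = t := by
  choose π hπ using fun a : Fin (d + 1) =>
    exists_vertex_projection (d := d) hN (Nat.lt_succ_iff.1 a.2)
  refine ⟨∑ a, π a, fun t => Subtype.ext ?_⟩
  rw [LinearMap.sum_apply, AddSubmonoidClass.coe_finsetSum]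
  conv_rhs => rw [← (dualActOver R d f).sum t.1, Finset.sum_range]
  exact Finset.sum_congr rfl fun a _ => hπ a t

theorem gr_isGood (hN : IsLine f N) :
    ((dualActOver R d f).restrict (gr_isStable (d := d) (f := f) (N := N))).IsGood := by
  obtain ⟨π, hπ⟩ := exists_gr_projection (d := d) hN
  have hcomp : π ∘ₗ (gr d f N).subtype = LinearMap.id := LinearMap.ext hπ
  have hgen : ∀ (a) (h : a ≤ d) (u) (hu : u ∈ N) (j),
      dualEvalOver R h (coord_pow_mem j (d - a)) (ofForm h (evalAt (hN.isZero u hu)).toLinearMap) =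
        u j ^ (d - a) := by
    intro a h u hu j
    rw [dualEvalOver_ofForm, AlgHom.toLinearMap_apply, map_pow, evalAt_coord]
  refine ⟨Module.Finite.of_surjective π fun t => ⟨t, hπ t⟩, Module.Projective.of_split _ π hcomp,
    fun a h => Module.IsRankOneOn.of_smul_eq (span_pow_eq_top hN (d - a)) ?_ ?_, fun a h => ?_⟩
  · rintro _ ⟨u, hu, j, rfl⟩
    exact ⟨fun t => dualEvalOver R h (coord_pow_mem j (d - a)) t.1,
      ⟨_, ofForm_mem_gr hN hu (hN.isZero u hu) h⟩, fun t => Subtype.ext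
        (pow_smul_E hu (hN.isZero u hu) j t.2 h)⟩
  · refine top_unique ((span_pow_eq_top hN (d - a)).symm.le.trans (Ideal.span_mono ?_))
    rintro _ ⟨u, hu, j, rfl⟩
    refine ⟨dualEvalOver R h (coord_pow_mem j (d - a)) ∘ₗ (gr d f N).subtype,
      ⟨_, ofForm_mem_gr hN hu (hN.isZero u hu) h⟩, ?_⟩
    change dualEvalOver R h _ ((dualActOver R d f).E a (ofForm h _)) = _
    rw [E_ofForm]
    exact hgen a h u hu j
  · refine top_unique ((span_pow_eq_top hN (d - a)).symm.le.trans (Ideal.span_mono ?_))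
    rintro _ ⟨u, hu, j, rfl⟩
    -- Pairing with `x_j ^ (d - a - 1)` after the arrow `x_j` is pairing with `x_j ^ (d - a)` before
    -- it, and the value of that power at `u` is `u j ^ (d - a)`.
    refine ⟨dualEvalOver R h (coord_pow_mem j (d - (a + 1))) ∘ₗ (gr d f N).subtype, j,
      ⟨_, ofForm_mem_gr hN hu (hN.isZero u hu) h.le⟩, ?_⟩
    change dualEvalOver R h _ ((dualActOver R d f).X j
      ((dualActOver R d f).E a (ofForm h.le _))) = _
    rw [E_ofForm, ← hgen a h.le u hu j]
    refine (dualEvalOver_X j h _ _).trans (dualEvalOver_congr ?_ _)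
    rw [← pow_succ', show d - (a + 1) + 1 = d - a by omega]

theorem le_line_gr : N ≤ ((dualActOver R d f).restrict (gr_isStable (d := d) (f := f)
    (N := N))).line :=
  fun u hu i j t => Subtype.ext (gr_isStable.1 0 _ t.2 u hu i j)

end BeilinsonQuiver

/-! ### Submodules of `M` with rank one vertices -/

namespace BeilinsonQuiver

open MvPolynomial ProjEquations BeilinsonAction

variable {k : Type u} [Field k] {n r d : ℕ} {f : Fin r → MvPolynomial (Fin (n + 1)) k}
  {R : Type u} [CommRing R] [Algebra k R]

/-- For `a < d` the degree `d - a` is positive, so `b` is a sum of products `x_i * b'`, and pairing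
with such a product is pairing `X i t` with `b'`. For `I = 0` it says that an element at such a
vertex is zero if all arrows kill it. -/
theorem dualEvalOver_mem_of_X_mem {I : Ideal R} {t : R ⊗[k] (dualModule d f).carrier} {a : ℕ}
    (h : a + 1 ≤ d) (hI : ∀ i (b : CoordRing f) (hb : b ∈ piece f (d - (a + 1))),
      dualEvalOver R h hb ((dualActOver R d f).X i t) ∈ I) {b : CoordRing f}
    (hb : b ∈ piece f (d - a)) : dualEvalOver R (Nat.le_of_succ_le h) hb t ∈ I := by
  obtain ⟨p, hp, rfl⟩ := id hb
  obtain ⟨m, hm⟩ : ∃ m, d - a = m + 1 := ⟨d - (a + 1), by omega⟩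
  have hp : p.IsHomogeneous (m + 1) := hm ▸ (mem_homogeneousSubmodule _ _).1 hp
  obtain ⟨c, hc⟩ := exists_represents hp
  have hw : ∀ w : Fin (m + 1) → Fin (n + 1),
      Ideal.Quotient.mkₐ k (ideal f) (∏ i, MvPolynomial.X (w i)) ∈ piece f (d - a) :=
    fun w => by
      rw [hm]
      exact mk_prod_mem (m + 1) w
  rw [dualEvalOver_sum c _ _ hw hb (by
    rw [Represents] at hc
    simp only [← hc, map_sum, map_smul]
    rfl)]
  refine Submodule.sum_mem _ fun w _ => ?_
  rw [← algebraMap_smul R]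
  refine Ideal.mul_mem_left _ _ ?_
  have hb' : Ideal.Quotient.mkₐ k (ideal f) (∏ i : Fin m, MvPolynomial.X (w i.castSucc)) ∈
      piece f (d - (a + 1)) := by
    rw [show d - (a + 1) = m by omega]
    exact mk_prod_mem m _
  have := hI (w (Fin.last m)) _ hb'
  rw [dualEvalOver_X] at this
  convert this using 1
  refine dualEvalOver_congr ?_ t
  rw [Fin.prod_univ_castSucc, map_mul, mul_comm]
  rfl

variable {P : Submodule R (R ⊗[k] (dualModule d f).carrier)}

/-- Nonvanishing of the arrows is automatic: through `π`, a functional on `P` is a combination of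
pairings, and at vertex `a < d` these lie in the ideal of entries of the arrows. -/
theorem restrict_isGood (hP : (dualActOver R d f).IsStable P)
    {π : (R ⊗[k] (dualModule d f).carrier) →ₗ[R] P} (hπ : ∀ t : P, π t.1 = t)
    (hrank : ∀ a ≤ d, Module.IsRankOneOn (((dualActOver R d f).restrict hP).E a)) :
    ((dualActOver R d f).restrict hP).IsGood := by
  refine ⟨Module.Finite.of_surjective π fun t => ⟨t, hπ t⟩,
    Module.Projective.of_split P.subtype π (LinearMap.ext hπ), hrank, fun a h => ?_⟩
  refine top_unique ((hrank a h.le).span.symm.le.trans (Ideal.span_le.2 ?_))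
  rintro _ ⟨l, p, rfl⟩
  set I := Ideal.span {c | ∃ (l : Module.Dual R P) (i : Fin (n + 1)) (x : P),
    l (((dualActOver R d f).restrict hP).X i (((dualActOver R d f).restrict hP).E a x)) = c} with hI
  have hmem : ∀ (b : CoordRing f) (hb : b ∈ piece f (d - a)), dualEvalOver R h.le hb
      ((dualActOver R d f).E a p.1) ∈ I := by
    intro b hb
    refine dualEvalOver_mem_of_X_mem h (fun i c hc => ?_) hb
    exact Ideal.subset_span ⟨dualEvalOver R h hc ∘ₗ P.subtype, i, p, rfl⟩
  have h1 : l (((dualActOver R d f).restrict hP).E a p) =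
      (l ∘ₗ π) ((dualActOver R d f).E a p.1) := by
    rw [LinearMap.comp_apply, ← coe_restrict_E hP, hπ]
  rw [h1, ← sum_dualBasis ((dualActOver R d f).E a p.1), map_sum]
  refine Submodule.sum_mem _ fun v _ => ?_
  rw [map_sum]
  refine Submodule.sum_mem _ fun i _ => ?_
  rw [map_smul]
  refine Ideal.mul_mem_right _ _ ?_
  by_cases hv : v.level = a
  · subst hv
    exact hmem _ _
  · rw [dualEvalOver_E_of_ne v.level_le hv]
    exact I.zero_mem

/-- The inclusion in the `gr` of the line is clear from the definition of ratios. For equality, rank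
one of the larger module makes `l (E a p) • E a t` a multiple of `E a p ∈ P`, and the scalars `l (E
a p)` generate the unit ideal. -/
theorem eq_gr_line (hP : (dualActOver R d f).IsStable P)
    {π : (R ⊗[k] (dualModule d f).carrier) →ₗ[R] P} (hπ : ∀ t : P, π t.1 = t)
    (hgood : ((dualActOver R d f).restrict hP).IsGood)
    (hline : IsLine f ((dualActOver R d f).restrict hP).line) :
    P = gr d f ((dualActOver R d f).restrict hP).line := by
  have hle : P ≤ gr d f ((dualActOver R d f).restrict hP).line := fun t ht u hu i j =>
    congrArg Subtype.val ((mem_line_iff hgood).1 hu i j ⟨t, ht⟩)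
  refine hle.antisymm fun t ht => ?_
  rw [← (dualActOver R d f).sum t]
  refine P.sum_mem fun a ha => ?_
  have had : a ≤ d := Nat.lt_succ_iff.1 (Finset.mem_range.1 ha)
  refine Submodule.smul_mem_induction (hgood.rankOne a had).span P ?_
  rintro _ ⟨l, p, rfl⟩
  have h := congrArg Subtype.val (((gr_isGood hline).rankOne a had).comm
    (l ∘ₗ π ∘ₗ (gr d f _).subtype) ⟨p.1, hle p.2⟩ ⟨t, ht⟩)
  have h1 : l (((dualActOver R d f).restrict hP).E a p) =
      l (π ((dualActOver R d f).E a p.1)) := by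
    rw [← coe_restrict_E hP, hπ]
  change l (π ((dualActOver R d f).E a p.1)) • (dualActOver R d f).E a t =
    _ • (dualActOver R d f).E a p.1 at h
  rw [h1, h]
  exact P.smul_mem _ (hP.1 a _ p.2)

/-- The action of the path algebra on `M` over `R`. -/
noncomputable def dualHom (R : Type u) [CommRing R] [Algebra k R] (d : ℕ)
    (f : Fin r → MvPolynomial (Fin (n + 1)) k) :
    PathAlgebra k (BeilinsonQuiver n d) →+*
      Module.End R (R ⊗[k] (dualModule d f).carrier) :=
  ((dualModule d f).baseChange R).act

theorem dualHom_apply (y : PathAlgebra k (BeilinsonQuiver n d)) :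
    dualHom R d f y = ((dualModule d f).act y).baseChange R := rfl

theorem dualHom_comm (i j : Fin (n + 1)) (a : ℕ) (h : a + 1 + 1 ≤ d) :
    dualHom R d f (x k j (a + 1) h * x k i a (Nat.le_of_succ_le h)) =
      dualHom R d f (x k i (a + 1) h * x k j a (Nat.le_of_succ_le h)) :=
  congrArg (LinearMap.baseChange R) (dualModule_comm i j a h)

theorem ofHom_dualHom : ofHom (dualHom R d f) dualHom_comm = dualActOver R d f :=
  ofHom_baseChange dualModule_comm R dualHom_comm dualHom_apply

theorem dualActOver_E {a : ℕ} (h : a ≤ d) : (dualActOver R d f).E a =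
    ((dualModule d f).act (PathAlgebra.e k (vertex n a h))).baseChange R := by
  rw [← ofHom_dualHom, ofHom_E (φ := dualHom R d f) dualHom_comm h]
  rfl

theorem isStable_iff_dualHom :
    (dualActOver R d f).IsStable P ↔ ∀ y, ∀ t ∈ P, dualHom R d f y t ∈ P := by
  rw [← ofHom_dualHom, ofHom_isStable_iff (φ := dualHom R d f) dualHom_comm
    ((dualModule d f).baseChange R).act_algebraMap]

end BeilinsonQuiver

/-! ### The bijection between points and lines -/

namespace ProjEquations

open MvPolynomial

variable {k : Type u} [Field k] {n r : ℕ} {f : Fin r → MvPolynomial (Fin (n + 1)) k}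
  {R : Type u} [CommRing R] [Algebra k R] {deg : Fin r → ℕ}
  (hf : ∀ j, (f j).IsHomogeneous (deg j)) {N N' : Submodule R (Fin (n + 1) → R)}

/-- The point of the projective scheme with homogeneous coordinates in a line. -/
noncomputable def classify (hN : IsLine f N) : AlgPoint (structureMap f hf) R :=
  (exists_classifies hf hN).choose

theorem classify_spec (hN : IsLine f N) : Classifies hf (classify hf hN) N :=
  (exists_classifies hf hN).choose_spec

theorem classify_eq_iff (hN : IsLine f N) (hN' : IsLine f N') :
    classify hf hN = classify hf hN' ↔ N = N' := by
  constructor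
  · intro h
    exact (classify_spec hf hN).line_unique hf hN hN' (h ▸ classify_spec hf hN')
  · rintro rfl
    rfl

theorem exists_classify_eq (g : AlgPoint (structureMap f hf) R) :
    ∃ (N : Submodule R (Fin (n + 1) → R)) (hN : IsLine f N), classify hf hN = g := by
  obtain ⟨N, hN, hg⟩ := exists_line hf g
  exact ⟨N, hN, (classify_spec hf hN).unique hf hN hg⟩

/-- The base change of a line. -/
abbrev lineBaseChange (N : Submodule R (Fin (n + 1) → R)) (R' : Type u) [CommRing R']
    [Algebra R R'] : Submodule R' (Fin (n + 1) → R') :=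
  Submodule.span R' {v | ∃ u ∈ N, v = fun i => algebraMap R R' (u i)}

variable (R' : Type u) [CommRing R'] [Algebra k R'] [Algebra R R'] [IsScalarTower k R R']

theorem IsLine.lineBaseChange {deg : Fin r → ℕ} (hf : ∀ j, (f j).IsHomogeneous (deg j))
    (hN : IsLine f N) : IsLine f (lineBaseChange N R') :=
  hN.baseChange hf (IsScalarTower.toAlgHom k R R')

theorem classify_baseChange (hN : IsLine f N) (hN' : IsLine f (lineBaseChange N R')) :
    (classify hf hN).baseChange R' = classify hf hN' :=
  ((classify_spec hf hN).map hf hN (IsScalarTower.toAlgHom k R R')).unique hf hN'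
    (classify_spec hf hN')

end ProjEquations

namespace BeilinsonQuiver

open MvPolynomial ProjEquations BeilinsonAction

variable {k : Type u} [Field k] {n r d : ℕ} {f : Fin r → MvPolynomial (Fin (n + 1)) k}
  {deg : Fin r → ℕ} {R : Type u} [CommRing R] [Algebra k R]

/-! ### The moduli space of indecomposable modules -/

/-- The action of the path algebra on the submodule that belongs to a line. -/
noncomputable def grHom (d : ℕ) (f : Fin r → MvPolynomial (Fin (n + 1)) k)
    (N : Submodule R (Fin (n + 1) → R)) :
    PathAlgebra k (BeilinsonQuiver n d) →+* Module.End R (gr d f N) where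
  toFun y := (dualHom R d f y).restrict (isStable_iff_dualHom.1 gr_isStable y)
  map_one' := LinearMap.ext fun t => Subtype.ext (by
    rw [LinearMap.coe_restrict_apply, map_one]
    rfl)
  map_mul' y z := LinearMap.ext fun t => Subtype.ext (by
    rw [LinearMap.coe_restrict_apply, map_mul]
    rfl)
  map_zero' := LinearMap.ext fun t => Subtype.ext (by
    rw [LinearMap.coe_restrict_apply, map_zero]
    rfl)
  map_add' y z := LinearMap.ext fun t => Subtype.ext (by
    rw [LinearMap.coe_restrict_apply, map_add]
    rfl)

theorem coe_grHom (N : Submodule R (Fin (n + 1) → R)) (y : PathAlgebra k (BeilinsonQuiver n d))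
    (t : gr d f N) : (grHom d f N y t : R ⊗[k] (dualModule d f).carrier) = dualHom R d f y t.1 :=
  rfl

/-- The family of modules that belongs to a line. -/
noncomputable def grFamily (d : ℕ) (hf : ∀ j, (f j).IsHomogeneous (deg j)) (T : Fin r → Set ℕ)
    (N : Submodule R (Fin (n + 1) → R)) : ModuleFamily k (QuotAlgebra d f deg T) R where
  carrier := gr d f N
  act := Ideal.Quotient.lift (relationIdeal d f deg T) (grHom d f N) fun y hy => by
    refine LinearMap.ext fun t => Subtype.ext ?_
    rw [coe_grHom, dualHom_apply, act_eq_zero deg hf T y hy, LinearMap.baseChange_zero,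
      LinearMap.zero_apply, LinearMap.zero_apply, Submodule.coe_zero]
  act_algebraMap c := by
    refine LinearMap.ext fun t => Subtype.ext ?_
    exact DFunLike.congr_fun (((dualModule d f).baseChange R).act_algebraMap c) t.1

theorem grFamily_toBeilinson (hf : ∀ j, (f j).IsHomogeneous (deg j)) (T : Fin r → Set ℕ)
    (N : Submodule R (Fin (n + 1) → R)) :
    (grFamily d hf T N).toBeilinson = (dualActOver R d f).restrict gr_isStable := by
  refine BeilinsonAction.ext (funext fun a => ?_) (funext fun i => ?_)
  · rcases Nat.lt_or_ge d a with h | h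
    · exact (BeilinsonAction.eq_zero _ a h).trans (BeilinsonAction.eq_zero _ a h).symm
    · refine ((grFamily d hf T N).toBeilinson_E h).trans (LinearMap.ext fun t => Subtype.ext ?_)
      exact (DFunLike.congr_fun (dualActOver_E h) t.1).symm
  · refine LinearMap.ext fun t => Subtype.ext ?_
    change ((∑ a : Fin d, (grFamily d hf T N).pathHom (x k i a a.2)) t).1 =
      (dualActOver R d f).X i t.1
    rw [← ofHom_dualHom, LinearMap.sum_apply]
    refine (AddSubmonoidClass.coe_finsetSum _ _).trans ?_
    change _ = (∑ a : Fin d, dualHom R d f (x k i a a.2)) t.1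
    rw [LinearMap.sum_apply]
    rfl

theorem isModuliOfIndecomposables (hd : 1 ≤ d) (hf : ∀ j, (f j).IsHomogeneous (deg j))
    (T : Fin r → Set ℕ) (hT : ∀ j, ∃ a ∈ T j, a + deg j ≤ d) :
    IsModuliOfIndecomposables (QuotAlgebra d f deg T) (idem d f deg T) (fun _ => 1)
      (structureMap f hf) := by
  have good : ∀ {R : Type u} [CommRing R] [Algebra k R]
      {F : ModuleFamily k (QuotAlgebra d f deg T) R},
      F.IsIndecomposableFamily (idem d f deg T) (fun _ => 1) → F.toBeilinson.IsGood :=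
    fun {_ _ _ F} hF => (F.isIndecomposableFamily_iff).1 hF
  have hline : ∀ {R : Type u} [CommRing R] [Algebra k R]
      {F : ModuleFamily k (QuotAlgebra d f deg T) R}, F.toBeilinson.IsGood →
        IsLine f F.toBeilinson.line :=
    fun {_ _ _ F} hF => line_isLine hd hF hf hT F.satisfies
  refine ⟨fun R _ _ F hF => classify hf (hline (good hF)), ?_, ?_, ?_⟩
  · intro R _ _ g
    obtain ⟨N, hN, rfl⟩ := exists_classify_eq hf g
    have hgood : (grFamily d hf T N).toBeilinson.IsGood := by
      have := gr_isGood (d := d) hN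
      rwa [← grFamily_toBeilinson hf T N] at this
    -- The variables act on `gr` with the ratios in `N` by construction, so `N` is contained in the
    -- line of the family; between lines this is equality.
    refine ⟨grFamily d hf T N, ((grFamily d hf T N).isIndecomposableFamily_iff).2 hgood,
      (classify_eq_iff hf _ hN).2 (hN.eq_of_le (hline hgood) ?_).symm⟩
    have := le_line_gr (d := d) (f := f) (N := N)
    rwa [← grFamily_toBeilinson hf T N] at this
  · intro R _ _ F F' hF hF'
    rw [classify_eq_iff, F.isEquivalent_iff F' hd hf hT (good hF) (good hF')]
  · intro R R' _ _ _ _ _ _ F hF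
    have hgood : (F.baseChange R').toBeilinson.IsGood := by
      rw [F.baseChange_toBeilinson R']
      exact (good hF).baseChange R'
    refine ⟨((F.baseChange R').isIndecomposableFamily_iff).2 hgood, ?_⟩
    have hN' := IsLine.lineBaseChange R' hf (hline (good hF))
    rw [classify_baseChange hf R' (hline (good hF)) hN', classify_eq_iff]
    refine (hN'.eq_of_le (hline hgood) (Submodule.span_le.2 ?_)).symm
    rintro _ ⟨u, hu, rfl⟩
    have := algebraMap_mem_line R' hu
    rwa [← F.baseChange_toBeilinson R'] at this

end BeilinsonQuiver

namespace BeilinsonQuiver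

open MvPolynomial ProjEquations BeilinsonAction

variable {k : Type u} [Field k] {n r d : ℕ} {f : Fin r → MvPolynomial (Fin (n + 1)) k}
  {deg : Fin r → ℕ} {R : Type u} [CommRing R] [Algebra k R]

/-! ### The quiver grassmannian -/

variable (d f) in
/-- The points of the grassmannian of submodules of `M` of dimension vector `(1, …, 1)`. -/
abbrev Gr (R : Type u) [CommRing R] [Algebra k R] :=
  SubmoduleGrassmannian (PathAlgebra.e k) (fun _ => 1) (dualRep d f).toModule R

theorem Gr.ext {G G' : Gr d f R} (h : G.toSubmodule = G'.toSubmodule) : G = G' := by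
  cases G
  cases G'
  cases h
  rfl

theorem Gr.isStable (G : Gr d f R) : (dualActOver R d f).IsStable G.toSubmodule :=
  isStable_iff_dualHom.2 G.stable

theorem Gr.exists_projection (G : Gr d f R) :
    ∃ π : (R ⊗[k] (dualModule d f).carrier) →ₗ[R] G.toSubmodule, ∀ t : G.toSubmodule,
      π t.1 = t := by
  have := G.projective
  obtain ⟨s, hs⟩ := Module.projective_lifting_property G.toSubmodule.mkQ LinearMap.id
    G.toSubmodule.mkQ_surjective
  let ρ : (R ⊗[k] (dualModule d f).carrier) →ₗ[R] R ⊗[k] (dualModule d f).carrier :=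
    LinearMap.id - s ∘ₗ G.toSubmodule.mkQ
  have hmem : ∀ t, ρ t ∈ G.toSubmodule := fun t => by
    rw [← Submodule.Quotient.mk_eq_zero, ← Submodule.mkQ_apply, LinearMap.sub_apply, map_sub,
      sub_eq_zero]
    exact (DFunLike.congr_fun hs (G.toSubmodule.mkQ t)).symm
  refine ⟨ρ.codRestrict G.toSubmodule hmem, fun t => Subtype.ext ?_⟩
  change t.1 - s (G.toSubmodule.mkQ t.1) = t.1
  rw [Submodule.mkQ_apply, (Submodule.Quotient.mk_eq_zero _).2 t.2, map_zero, sub_zero]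

theorem Gr.isGood (G : Gr d f R) : ((dualActOver R d f).restrict G.isStable).IsGood := by
  obtain ⟨π, hπ⟩ := G.exists_projection
  refine restrict_isGood G.isStable hπ fun a h => ?_
  have : Module.Finite R G.toSubmodule := Module.Finite.of_surjective π fun t => ⟨t, hπ t⟩
  have : Module.Projective R G.toSubmodule :=
    Module.Projective.of_split G.toSubmodule.subtype π (LinearMap.ext hπ)
  refine (Module.isRankOneOn_iff_rankAtStalk (LinearMap.ext (BeilinsonAction.idem _ a))).2 fun p => ?_
  rw [rankAtStalk_restrict_E, dualActOver_E h]
  exact G.rank_eq (vertex n a h) p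

/-- The ratios of the arrows on a point of the grassmannian. -/
noncomputable def Gr.line (G : Gr d f R) : Submodule R (Fin (n + 1) → R) :=
  ((dualActOver R d f).restrict G.isStable).line

theorem Gr.isLine (G : Gr d f R) (hd : 1 ≤ d) (hf : ∀ j, (f j).IsHomogeneous (deg j))
    (hdeg : ∀ j, deg j ≤ d) : IsLine f G.line :=
  line_isLine hd G.isGood hf (T := fun _ => Set.univ) (fun j => ⟨0, trivial, by simpa using hdeg j⟩)
    (((dualAct_satisfies deg hf _).baseChange R).restrict G.isStable)

theorem Gr.toSubmodule_eq (G : Gr d f R) (hG : IsLine f G.line) :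
    G.toSubmodule = gr d f G.line := by
  obtain ⟨π, hπ⟩ := G.exists_projection
  exact eq_gr_line G.isStable hπ G.isGood hG

/-- The point of the grassmannian that belongs to a line. -/
noncomputable def grPoint (d : ℕ) {N : Submodule R (Fin (n + 1) → R)} (hN : IsLine f N) :
    Gr d f R where
  toSubmodule := gr d f N
  stable := isStable_iff_dualHom.1 gr_isStable
  finite := Module.Finite.of_surjective (gr d f N).mkQ (gr d f N).mkQ_surjective
  projective := by
    obtain ⟨π, hπ⟩ := exists_gr_projection (d := d) hN
    refine Module.Projective.of_split
      ((gr d f N).liftQ (LinearMap.id - (gr d f N).subtype ∘ₗ π) fun t ht => ?_) (gr d f N).mkQ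
      (Submodule.linearMap_qext _ (LinearMap.ext fun t => ?_))
    · rw [LinearMap.mem_ker, LinearMap.sub_apply, LinearMap.comp_apply, hπ ⟨t, ht⟩]
      exact sub_self t
    · change (gr d f N).mkQ (t - (π t).1) = (gr d f N).mkQ t
      rw [map_sub, sub_eq_self]
      exact (Submodule.Quotient.mk_eq_zero _).2 (π t).2
  rank_eq v p := by
    have hg := gr_isGood (d := d) hN
    have := hg.finite
    have := hg.projective
    have h := (Module.isRankOneOn_iff_rankAtStalk (LinearMap.ext
      (((dualActOver R d f).restrict gr_isStable).idem v.level))).1 (hg.rankOne v.level v.level_le) p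
    rw [rankAtStalk_restrict_E, dualActOver_E v.level_le] at h
    exact h

theorem grPoint_line {N : Submodule R (Fin (n + 1) → R)} (hN : IsLine f N)
    (h : IsLine f (grPoint d hN).line) : (grPoint d hN).line = N :=
  (hN.eq_of_le h le_line_gr).symm

section BaseChange

variable (R' : Type u) [CommRing R'] [Algebra k R'] [Algebra R R'] [IsScalarTower k R R']

/-- The map from `M` over `R` to `M` over `R'`. -/
noncomputable abbrev dualMap (d : ℕ) (f : Fin r → MvPolynomial (Fin (n + 1)) k) :
    (R ⊗[k] (dualModule d f).carrier) →ₗ[k] (R' ⊗[k] (dualModule d f).carrier) :=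
  (IsScalarTower.toAlgHom k R R').toLinearMap.rTensor (dualModule d f).carrier

theorem X_dualMap (i : Fin (n + 1)) (t : R ⊗[k] (dualModule d f).carrier) :
    (dualActOver R' d f).X i (dualMap R' d f t) = dualMap R' d f ((dualActOver R d f).X i t) := by
  induction t with
  | zero => simp
  | add s t hs ht => simp only [map_add, hs, ht]
  | tmul c t => rfl

theorem dualMap_smul (c : R) (t : R ⊗[k] (dualModule d f).carrier) :
    dualMap R' d f (c • t) = algebraMap R R' c • dualMap R' d f t := by
  induction t with
  | zero => simp
  | add s t hs ht => simp only [map_add, smul_add, hs, ht]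
  | tmul b t =>
    rw [TensorProduct.smul_tmul', LinearMap.rTensor_tmul, LinearMap.rTensor_tmul,
      TensorProduct.smul_tmul', smul_eq_mul, smul_eq_mul]
    exact congrArg (· ⊗ₜ t) (map_mul (algebraMap R R') c b)

theorem dualMap_ofForm {a : ℕ} (h : a ≤ d) (g : CoordRing f →ₗ[k] R) :
    dualMap R' d f (ofForm h g) =
      ofForm h ((IsScalarTower.toAlgHom k R R').toLinearMap ∘ₗ g) := by
  rw [ofForm, ofForm, map_sum]
  rfl

/-- Over `R'`, vertex `a` is generated up to the factors `u j ^ (d - a)` by evaluation at the image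
of `u`, and this is the image of evaluation at `u`. The other inclusion holds because the defining
equations are preserved. -/
theorem gr_lineBaseChange {N : Submodule R (Fin (n + 1) → R)} (hN : IsLine f N)
    (hN' : IsLine f (lineBaseChange N R')) :
    gr d f (lineBaseChange N R') =
      Submodule.span R' (dualMap R' d f '' (gr d f N : Set (R ⊗[k] (dualModule d f).carrier))) := by
  refine le_antisymm (fun t ht => ?_) (Submodule.span_le.2 ?_)
  · rw [← (dualActOver R' d f).sum t]
    refine Submodule.sum_mem _ fun a ha => ?_
    have h : a ≤ d := Nat.lt_succ_iff.1 (Finset.mem_range.1 ha)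
    have hspan := congrArg (Ideal.map (algebraMap R R')) (span_pow_eq_top hN (d - a))
    rw [Ideal.map_span, Ideal.map_top] at hspan
    refine Submodule.smul_mem_induction hspan _ ?_
    rintro _ ⟨_, ⟨u, hu, j, rfl⟩, rfl⟩
    have hz := hN.isZero u hu
    have hu' : (fun i => algebraMap R R' (u i)) ∈ lineBaseChange N R' :=
      Submodule.subset_span ⟨u, hu, rfl⟩
    rw [map_pow, pow_smul_E hu' (hN'.isZero _ hu') j ht h]
    refine Submodule.smul_mem _ _ (Submodule.subset_span ⟨_, ofForm_mem_gr hN hu hz h, ?_⟩)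
    rw [dualMap_ofForm]
    congr 1
    exact congrArg AlgHom.toLinearMap (map_comp_evalAt hz (IsScalarTower.toAlgHom k R R'))
  · rintro _ ⟨t, ht, rfl⟩ v hv i j
    induction hv using Submodule.span_induction with
    | mem v hv =>
      obtain ⟨u, hu, rfl⟩ := hv
      rw [X_dualMap, X_dualMap, ← dualMap_smul, ht u hu, dualMap_smul]
    | zero => simp
    | add v w _ _ hv hw => rw [Pi.add_apply, Pi.add_apply, add_smul, add_smul, hv, hw]
    | smul c v _ hv => rw [Pi.smul_apply, Pi.smul_apply, smul_assoc, smul_assoc, hv]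

end BaseChange

theorem isQuiverGrassmannian (hd : 1 ≤ d) (hf : ∀ j, (f j).IsHomogeneous (deg j))
    (hdeg : ∀ j, deg j ≤ d) :
    IsQuiverGrassmannian (PathAlgebra.e k) (fun _ => 1) (dualRep d f).toModule
      (structureMap f hf) := by
  have hline : ∀ {R : Type u} [CommRing R] [Algebra k R] (G : Gr d f R), IsLine f G.line :=
    fun G => G.isLine hd hf hdeg
  refine ⟨fun R _ _ => Equiv.ofBijective (fun G : Gr d f R => classify hf (hline G))
    ⟨fun G G' h => Gr.ext ?_, fun g => ?_⟩, fun R R' _ _ _ _ _ _ G => ?_⟩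
  · rw [Gr.toSubmodule_eq G (hline G), Gr.toSubmodule_eq G' (hline G'), (classify_eq_iff hf _ _).1 h]
  · obtain ⟨N, hN, rfl⟩ := exists_classify_eq hf g
    exact ⟨grPoint d hN, (classify_eq_iff hf _ _).2 (grPoint_line hN (hline _))⟩
  · have hN' := IsLine.lineBaseChange R' hf (hline G)
    refine ⟨grPoint d hN', ?_, ?_⟩
    · refine (gr_lineBaseChange R' (hline G) hN').trans ?_
      rw [← Gr.toSubmodule_eq G (hline G)]
    · refine Eq.trans ?_ (classify_baseChange hf R' (hline G) hN').symm
      exact (classify_eq_iff hf (hline _) hN').2 (grPoint_line hN' (hline _))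

end BeilinsonQuiver

/-! ### The theorem -/

theorem theorem1 {k : Type u} [Field k] [IsAlgClosed k] (n r d : ℕ) (hd : 1 ≤ d)
    (f : Fin r → MvPolynomial (Fin (n + 1)) k) (deg : Fin r → ℕ)
    (hf : ∀ j, (f j).IsHomogeneous (deg j))
    (T : Fin r → Set ℕ) (hT : ∀ j, ∃ a ∈ T j, a + deg j ≤ d) :
    IsModuliOfIndecomposables (BeilinsonQuiver.QuotAlgebra d f deg T)
      (BeilinsonQuiver.idem d f deg T) (fun _ => 1) (ProjEquations.structureMap f hf) ∧
    (∃ θ : BeilinsonQuiver n d → ℤ, ∀ N : ModuleFamily k (BeilinsonQuiver.QuotAlgebra d f deg T) k,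
      N.HasDimVector (BeilinsonQuiver.idem d f deg T) (fun _ => 1) →
        (N.IsIndecomposable ↔ N.IsSemistable (BeilinsonQuiver.idem d f deg T) θ) ∧
        (N.IsIndecomposable ↔ N.IsThetaStable (BeilinsonQuiver.idem d f deg T) θ)) ∧
    IsQuiverGrassmannian (PathAlgebra.e k) (fun _ => 1) (BeilinsonQuiver.dualRep d f).toModule
      (ProjEquations.structureMap f hf) ∧
    ∃ hM : ∀ a ∈ BeilinsonQuiver.relationIdeal d f deg (fun _ => Set.univ),
        (BeilinsonQuiver.dualRep d f).toModule.act a = 0,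
      ((BeilinsonQuiver.dualRep d f).toModule.descend _ hM).IsInjective ∧
      ∀ N : ModuleFamily k (BeilinsonQuiver.QuotAlgebra d f deg (fun _ => Set.univ)) k,
        N.HasDimVector (BeilinsonQuiver.idem d f deg (fun _ => Set.univ)) (fun _ => 1) →
          N.IsIndecomposable →
            N.IsInjectiveHull ((BeilinsonQuiver.dualRep d f).toModule.descend _ hM) := by
  refine ⟨BeilinsonQuiver.isModuliOfIndecomposables hd hf T hT, ModuleFamily.exists_weight,
    BeilinsonQuiver.isQuiverGrassmannian hd hf fun j => ?_,
    BeilinsonQuiver.act_eq_zero deg hf _, BeilinsonQuiver.descend_isInjective _ hf,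
    fun N hN hi => BeilinsonQuiver.isInjectiveHull _ hf N ((ModuleFamily.isGood_iff hN).2 hi)⟩
  obtain ⟨a, -, h⟩ := hT j
  exact (Nat.le_add_left _ _).trans h
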